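/- Let $F:[0,1]^2\to\mathbb R^3$ be an injective piecewise-linear map, i.e. an injective map that is affine on each simplex of some finite triangulation of $[0,1]^2$. Let $\ell$ be a piecewise-linear simple closed curve in $[0,1]^2$, i.e. the image of a map $\gamma:[0,1]\to[0,1]^2$ that is affine on each interval of some finite subdivision of $[0,1]$, with $\gamma(0)=\gamma(1)$ and $\gamma$ injective on $[0,1)$. Then $F(\ell)$ is an unknot: there is an ambient isotopy of $\mathbb R^3$, i.e. a continuous map $H:[0,1]\times\mathbb R^3\to\mathbb R^3$ such that every $H_t=H(t,\cdot)$ is a homeomorphism of $\mathbb R^3$, $H_0=\mathrm{id}$, and $H_1(F(\ell))=\{(x,y,z): x^2+y^2=1,\ z=0\}$. -/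

import Mathlib

/-- `f` is piecewise linear on `S`: there is a finite simplicial complex (a triangulation)
with underlying space `S` such that `f` is affine on each of its closed simplices.
Such a map is automatically continuous on `S`. -/
def IsPLOn {E F : Type*} [AddCommGroup E] [Module ℝ E] [AddCommGroup F] [Module ℝ F]
    (f : E → F) (S : Set E) : Prop :=
  ∃ K : Geometry.SimplicialComplex ℝ E, K.faces.Finite ∧ K.space = S ∧
    ∀ s ∈ K.faces, ∃ g : E →ᵃ[ℝ] F, Set.EqOn f g (convexHull ℝ (s : Set E))

/-- The restriction of `γ` to `[0,1]` is a piecewise linear simple closed curve, i.e. a piecewise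
linear embedding of the circle `[0,1]/(0 ~ 1)`. -/
structure IsPLSimpleClosedCurve {E : Type*} [AddCommGroup E] [Module ℝ E] (γ : ℝ → E) :
    Prop where
  pl : IsPLOn γ (Set.Icc (0 : ℝ) 1)
  closed : γ 0 = γ 1
  simple : Set.InjOn γ (Set.Ico (0 : ℝ) 1)

/-- The closed unit square `[0,1]²` in the plane. -/
def unitSquare : Set (EuclideanSpace ℝ (Fin 2)) :=
  {p | ∀ i, p i ∈ Set.Icc (0 : ℝ) 1}

/-- There is an ambient isotopy of `X` (a continuous family of homeomorphisms `H t` of `X`,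
`t ∈ [0,1]`, with `H 0 = id`) carrying `K` onto `L`. -/
def AmbientIsotopic {X : Type*} [TopologicalSpace X] (K L : Set X) : Prop :=
  ∃ H : unitInterval × X → X, Continuous H ∧
    (∀ t, IsHomeomorph fun x => H (t, x)) ∧
    (∀ x, H (0, x) = x) ∧
    (fun x => H (1, x)) '' K = L

/-- The round unit circle in the plane `z = 0` of three-space. -/
def standardCircle : Set (EuclideanSpace ℝ (Fin 3)) :=
  {x | x 0 ^ 2 + x 1 ^ 2 = 1 ∧ x 2 = 0}

/-- `K` is an unknot: it is ambient isotopic to the standard round circle. -/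
def IsUnknot (K : Set (EuclideanSpace ℝ (Fin 3))) : Prop :=
  AmbientIsotopic K standardCircle

/-!
Where `F` is affine on a triangle, an isotopy supported near the image of the triangle slides two
of its sides across to the third. Cutting along the lines that carry the simplices of the
triangulation extends this to every triangle in the domain: the slides across the pieces compose
because `F` is injective, so that each of them misses the rest of the image.

By induction on the number of vertices, every polygon bounds a region across which the complement
of any edge can be swept onto that edge. Let `b` be a strict maximum of a linear functional on the
vertices and let `a` and `c` be its neighbours. Either the triangle `abc` can be split off, or it
contains a vertex `w` visible from `b`, and the diagonal `bw` cuts the polygon in two. In both cases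
the regions bounded by the two parts are glued along their common chord, and sweeping across one of
them turns the polygon into the boundary of the other, until only a triangle is left.
-/

open Set Filter Topology

/-- An ambient isotopy from `K` onto `L` that fixes every point of `R` throughout. -/
def AmbientIsotopicRel {X : Type*} [TopologicalSpace X] (R K L : Set X) : Prop :=
  ∃ H : unitInterval × X → X, Continuous H ∧
    (∀ t, IsHomeomorph fun x => H (t, x)) ∧
    (∀ x, H (0, x) = x) ∧ (∀ t, ∀ x ∈ R, H (t, x) = x) ∧
    (fun x => H (1, x)) '' K = L

namespace AmbientIsotopicRel

variable {X Y : Type*} [TopologicalSpace X] [TopologicalSpace Y] {R K L M A : Set X}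

theorem ambientIsotopic (h : AmbientIsotopicRel R K L) : AmbientIsotopic K L :=
  let ⟨H, continuous_H, homeo, H_zero, _, H_one⟩ := h
  ⟨H, continuous_H, homeo, H_zero, H_one⟩

theorem of_ambientIsotopic (h : AmbientIsotopic K L) : AmbientIsotopicRel ∅ K L :=
  let ⟨H, continuous_H, homeo, H_zero, H_one⟩ := h
  ⟨H, continuous_H, homeo, H_zero, fun _ _ hx => hx.elim, H_one⟩

theorem mono {R' : Set X} (h : AmbientIsotopicRel R K L) (hR : R' ⊆ R) :
    AmbientIsotopicRel R' K L :=
  let ⟨H, continuous_H, homeo, H_zero, fixed, H_one⟩ := h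
  ⟨H, continuous_H, homeo, H_zero, fun t x hx => fixed t x (hR hx), H_one⟩

theorem trans (h : AmbientIsotopicRel R K L) (h' : AmbientIsotopicRel R L M) :
    AmbientIsotopicRel R K M := by
  obtain ⟨H, continuous_H, homeo_H, H_zero, fixed_H, H_one⟩ := h
  obtain ⟨G, continuous_G, homeo_G, G_zero, fixed_G, G_one⟩ := h'
  refine ⟨fun p => G (p.1, H p), by fun_prop, fun t => (homeo_G t).comp (homeo_H t),
    fun x => ?_, fun t x hx => ?_, ?_⟩
  · simp only [H_zero, G_zero]
  · simp only [fixed_H t x hx, fixed_G t x hx]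
  · rw [← G_one, ← H_one, image_image]

/-- The reverse isotopy is `H (1 - t) ∘ (H 1)⁻¹`, which avoids inverting `H` jointly in `t`. -/
theorem symm (h : AmbientIsotopicRel R K L) : AmbientIsotopicRel R L K := by
  obtain ⟨H, continuous_H, homeo, H_zero, fixed, H_one⟩ := h
  let e : X ≃ₜ X := (homeo 1).homeomorph
  have e_apply : ∀ x, e x = H (1, x) := fun _ => rfl
  refine ⟨fun p => H (unitInterval.symm p.1, e.symm p.2), ?_, fun t => ?_, fun x => ?_,
    fun t x hx => ?_, ?_⟩
  · have := unitInterval.continuous_symm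
    fun_prop
  · exact (homeo (unitInterval.symm t)).comp e.symm.isHomeomorph
  · simp only [unitInterval.symm_zero, ← e_apply, e.apply_symm_apply]
  · have he : e.symm x = x := by rw [Homeomorph.symm_apply_eq, e_apply, fixed 1 x hx]
    simp only [he, fixed _ x hx]
  · simp only [← H_one, image_image, unitInterval.symm_one, H_zero, ← e_apply,
      e.symm_apply_apply, image_id']

theorem union (h : AmbientIsotopicRel R K L) (hA : A ⊆ R) :
    AmbientIsotopicRel R (K ∪ A) (L ∪ A) := by
  obtain ⟨H, continuous_H, homeo, H_zero, fixed, H_one⟩ := h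
  refine ⟨H, continuous_H, homeo, H_zero, fixed, ?_⟩
  rw [image_union, H_one]
  congr 1
  exact (image_congr fun x hx => fixed 1 x (hA hx)).trans (image_id _)

theorem image (h : AmbientIsotopicRel R K L) (e : X ≃ₜ Y) :
    AmbientIsotopicRel (e '' R) (e '' K) (e '' L) := by
  obtain ⟨H, continuous_H, homeo, H_zero, fixed, H_one⟩ := h
  refine ⟨fun p => e (H (p.1, e.symm p.2)), by fun_prop,
    fun t => e.isHomeomorph.comp ((homeo t).comp e.symm.isHomeomorph),
    fun x => by simp only [H_zero, e.apply_symm_apply], ?_, ?_⟩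
  · rintro t _ ⟨x, hx, rfl⟩
    simp only [e.symm_apply_apply, fixed t x hx]
  · simp only [← H_one, image_image, e.symm_apply_apply]

end AmbientIsotopicRel

section Displacement

theorem isHomeomorph_of_norm_sub_le {X : Type*} [NormedAddCommGroup X] [ProperSpace X]
    {f : X → X} (hf : Continuous f) (hb : Function.Bijective f) {C : ℝ}
    (hC : ∀ x, ‖f x - x‖ ≤ C) : IsHomeomorph f := by
  suffices IsProperMap f from
    isHomeomorph_iff_continuous_isClosedMap_bijective.2 ⟨hf, this.isClosedMap, hb⟩
  rw [isProperMap_iff_tendsto_cocompact, ← Metric.cobounded_eq_cocompact,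
    ← tendsto_norm_atTop_iff_cobounded]
  refine ⟨hf, tendsto_atTop_mono (fun x => ?_)
    (tendsto_atTop_add_const_right _ (-C) tendsto_norm_cobounded_atTop)⟩
  have triangle := norm_sub_norm_le x (f x)
  have bound := hC x
  rw [norm_sub_rev] at bound
  linarith

theorem bijective_sub_of_bounded {g : ℝ → ℝ} (hg : Continuous g) {C : ℝ} (hC : ∀ y, |g y| ≤ C)
    (hmono : ∀ y₁ y₂, y₁ < y₂ → g y₂ - g y₁ < y₂ - y₁) :
    Function.Bijective fun y => y - g y := by
  refine ⟨StrictMono.injective fun y₁ y₂ hy => ?_, Continuous.surjective (by fun_prop) ?_ ?_⟩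
  · linarith [hmono y₁ y₂ hy]
  · exact tendsto_atTop_mono (fun y => by rw [id]; linarith [(abs_le.1 (hC y)).2])
      (tendsto_atTop_add_const_right _ (-C) tendsto_id)
  · exact tendsto_atBot_mono (fun y => by rw [id]; linarith [(abs_le.1 (hC y)).1])
      (tendsto_atBot_add_const_right _ C tendsto_id)

theorem ambientIsotopicRel_of_displacement {Q : Type*} [NormedAddCommGroup Q] [ProperSpace Q]
    {φ : Q × ℝ → ℝ} (hφ : Continuous φ) {C : ℝ} (hC : ∀ x, |φ x| ≤ C)
    (hmono : ∀ q y₁ y₂, y₁ < y₂ → φ (q, y₂) - φ (q, y₁) < y₂ - y₁)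
    {R : Set (Q × ℝ)} (hR : ∀ x ∈ R, φ x = 0) (K : Set (Q × ℝ)) :
    AmbientIsotopicRel R K ((fun x => (x.1, x.2 - φ x)) '' K) := by
  refine ⟨fun p => (p.2.1, p.2.2 - p.1 * φ p.2), by fun_prop, fun ⟨t, ht0, ht1⟩ => ?_,
    fun x => by simp, fun t x hx => by simp [hR x hx], by simp⟩
  have bound : ∀ x, |t * φ x| ≤ C := fun x => by
    rw [abs_mul, abs_of_nonneg ht0]
    exact (mul_le_of_le_one_left (abs_nonneg _) ht1).trans (hC x)
  have fiber_bijective : ∀ q, Function.Bijective fun y => y - t * φ (q, y) := fun q =>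
    bijective_sub_of_bounded (by fun_prop) (fun y => bound (q, y)) fun y₁ y₂ hy => by
      rw [← mul_sub]
      rcases le_total 0 (φ (q, y₂) - φ (q, y₁)) with hφ0 | hφ0
      · exact (mul_le_of_le_one_left hφ0 ht1).trans_lt (hmono q y₁ y₂ hy)
      · exact (mul_nonpos_of_nonneg_of_nonpos ht0 hφ0).trans_lt (sub_pos.2 hy)
  refine isHomeomorph_of_norm_sub_le (C := C) (by fun_prop) ⟨?_, ?_⟩ fun ⟨q, y⟩ => ?_
  · rintro ⟨q, y⟩ ⟨q', y'⟩ h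
    simp only [Prod.mk.injEq] at h
    obtain ⟨rfl, h⟩ := h
    rw [(fiber_bijective q).injective h]
  · rintro ⟨q, y⟩
    obtain ⟨y', hy'⟩ := (fiber_bijective q).surjective y
    exact ⟨(q, y'), Prod.ext rfl hy'⟩
  · simp only [Prod.mk_sub_mk, sub_self, Prod.norm_mk, norm_zero, Real.norm_eq_abs,
      sub_sub_cancel_left, abs_neg]
    exact max_le ((abs_nonneg _).trans (bound (q, y))) (bound _)

end Displacement

section Graph

/-- The piecewise linear function of `y` that rises from `0` at `-δ` to `k` at `h` and falls back
to `0` at `h + δ`. Its slope stays below `1` when `k ≤ h`, so that subtracting it is a homeomorphism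
of the line. -/
noncomputable def tent (k h δ y : ℝ) : ℝ :=
  max 0 (min (k * (y + δ) / (h + δ)) (k * (h + δ - y) / δ))

section Tent

variable {k h δ y : ℝ}

theorem tent_nonneg : 0 ≤ tent k h δ y := le_max_left _ _

theorem tent_zero : tent 0 h δ y = 0 := by simp [tent]

theorem tent_le (hk : 0 ≤ k) (hh : 0 ≤ h) (hδ : 0 < δ) : tent k h δ y ≤ k := by
  refine max_le hk ?_
  rcases le_total y h with hy | hy
  · refine (min_le_left _ _).trans ((div_le_iff₀ (by linarith)).2 ?_)
    gcongr
  · refine (min_le_right _ _).trans ((div_le_iff₀ hδ).2 ?_)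
    gcongr
    linarith

theorem tent_apex (hk : 0 ≤ k) (hh : 0 ≤ h) (hδ : 0 < δ) : tent k h δ h = k := by
  rw [tent, mul_div_cancel_right₀ _ (by positivity), add_sub_cancel_left,
    mul_div_cancel_right₀ _ hδ.ne', min_self, max_eq_right hk]

theorem tent_eq_zero (hk : 0 ≤ k) (hh : 0 ≤ h) (hδ : 0 < δ) (hy : y ≤ -δ ∨ h + δ ≤ y) :
    tent k h δ y = 0 := by
  refine max_eq_left ?_
  rcases hy with hy | hy
  · exact (min_le_left _ _).trans (div_nonpos_of_nonpos_of_nonneg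
      (mul_nonpos_of_nonneg_of_nonpos hk (by linarith)) (by linarith))
  · exact (min_le_right _ _).trans (div_nonpos_of_nonpos_of_nonneg
      (mul_nonpos_of_nonneg_of_nonpos hk (by linarith)) hδ.le)

theorem tent_sub_lt {y₁ y₂ : ℝ} (hk : 0 ≤ k) (hkh : k ≤ h) (hδ : 0 < δ) (hy : y₁ < y₂) :
    tent k h δ y₂ - tent k h δ y₁ < y₂ - y₁ := by
  have hh : 0 < h + δ := by linarith
  have rise : k * (y₂ + δ) / (h + δ) < k * (y₁ + δ) / (h + δ) + (y₂ - y₁) := by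
    rw [div_add' _ _ _ hh.ne', div_lt_div_iff_of_pos_right hh]
    nlinarith
  have fall : k * (h + δ - y₂) / δ ≤ k * (h + δ - y₁) / δ := by gcongr
  unfold tent
  generalize k * (y₂ + δ) / (h + δ) = r₂, k * (y₁ + δ) / (h + δ) = r₁,
    k * (h + δ - y₂) / δ = f₂, k * (h + δ - y₁) / δ = f₁ at rise fall ⊢
  grind

end Tent

/-- The vertical displacement that pushes the graph of `h`, inside the slice `z = 0`, down to
height `0`, and that dies out at distance `δ` from the region under the graph. Where `h` vanishes
so does the displacement, even if `δ` vanishes there as well and the quotients are meaningless. -/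
noncomputable def graphPush {P : Type*} (h δ : P → ℝ) (x : (P × ℝ) × ℝ) : ℝ :=
  tent (h x.1.1 * max 0 (1 - |x.1.2| / δ x.1.1)) (h x.1.1) (δ x.1.1) x.2

section GraphPush

variable {P : Type*} {h δ : P → ℝ} {x : (P × ℝ) × ℝ}

theorem graphPush_nonneg : 0 ≤ graphPush h δ x := tent_nonneg

theorem graphPush_eq_zero_of_height (hx : h x.1.1 = 0) : graphPush h δ x = 0 := by
  rw [graphPush, hx, zero_mul, tent_zero]

theorem amplitude_mem_Icc {a d z : ℝ} (ha : 0 ≤ a) (hd : 0 ≤ d) :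
    a * max 0 (1 - |z| / d) ∈ Icc 0 a := by
  have : 0 ≤ |z| / d := by positivity
  exact ⟨by positivity, mul_le_of_le_one_right ha (max_le zero_le_one (by linarith))⟩

theorem graphPush_le (hh0 : ∀ s, 0 ≤ h s) (hδ : ∀ s, 0 < h s → 0 < δ s) :
    graphPush h δ x ≤ h x.1.1 := by
  rcases (hh0 x.1.1).eq_or_lt with h0 | h0
  · rw [graphPush_eq_zero_of_height h0.symm, h0]
  · have amp := amplitude_mem_Icc (z := x.1.2) h0.le (hδ _ h0).le
    exact (tent_le amp.1 h0.le (hδ _ h0)).trans amp.2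

theorem graphPush_sub_lt (hh0 : ∀ s, 0 ≤ h s) (hδ : ∀ s, 0 < h s → 0 < δ s) (q : P × ℝ)
    {y₁ y₂ : ℝ} (hy : y₁ < y₂) : graphPush h δ (q, y₂) - graphPush h δ (q, y₁) < y₂ - y₁ := by
  rcases (hh0 q.1).eq_or_lt with h0 | h0
  · rw [graphPush_eq_zero_of_height h0.symm, graphPush_eq_zero_of_height h0.symm]
    linarith
  · have amp := amplitude_mem_Icc (z := q.2) h0.le (hδ _ h0).le
    exact tent_sub_lt amp.1 amp.2 (hδ _ h0) hy

theorem graphPush_graph (hh0 : ∀ s, 0 ≤ h s) (hδ : ∀ s, 0 < h s → 0 < δ s) (s : P) :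
    graphPush h δ ((s, 0), h s) = h s := by
  rcases (hh0 s).eq_or_lt with h0 | h0
  · rw [graphPush_eq_zero_of_height h0.symm, h0]
  · simp only [graphPush, abs_zero, zero_div, sub_zero, zero_le_one, max_eq_right, mul_one]
    exact tent_apex h0.le h0.le (hδ s h0)

theorem continuous_graphPush [TopologicalSpace P] (hh : Continuous h) (hh0 : ∀ s, 0 ≤ h s)
    (hδc : Continuous δ) (hδ : ∀ s, 0 < h s → 0 < δ s) : Continuous (graphPush h δ) := by
  refine continuous_iff_continuousAt.2 fun x => ?_
  rcases (hh0 x.1.1).eq_or_lt with h0 | h0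
  · have tendsto_height : Tendsto (fun x : (P × ℝ) × ℝ => h x.1.1) (𝓝 x) (𝓝 0) := by
      rw [h0]
      exact (hh.comp (continuous_fst.comp continuous_fst)).continuousAt
    rw [ContinuousAt, graphPush_eq_zero_of_height h0.symm]
    exact squeeze_zero (fun _ => graphPush_nonneg) (fun _ => graphPush_le hh0 hδ) tendsto_height
  · have δ_ne : δ x.1.1 ≠ 0 := (hδ _ h0).ne'
    have sum_ne : h x.1.1 + δ x.1.1 ≠ 0 := (add_pos h0 (hδ _ h0)).ne'
    unfold graphPush tent
    fun_prop (disch := assumption)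

theorem graphPush_eq_zero_of_clearance (hh0 : ∀ s, 0 ≤ h s) (hδ : ∀ s, 0 < h s → 0 < δ s)
    (hx : ∀ y', 0 ≤ y' → y' ≤ h x.1.1 → δ x.1.1 ≤ max |x.1.2| |x.2 - y'|) :
    graphPush h δ x = 0 := by
  rcases (hh0 x.1.1).eq_or_lt with h0 | h0
  · exact graphPush_eq_zero_of_height h0.symm
  have δ_pos := hδ _ h0
  rcases le_or_gt (δ x.1.1) |x.1.2| with hz | hz
  · have : 1 ≤ |x.1.2| / δ x.1.1 := (one_le_div δ_pos).2 hz
    rw [graphPush, max_eq_left (by linarith), mul_zero, tent_zero]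
  · have gap : ∀ y', 0 ≤ y' → y' ≤ h x.1.1 → δ x.1.1 ≤ |x.2 - y'| := fun y' hy0 hyh =>
      (le_max_iff.1 (hx y' hy0 hyh)).resolve_left hz.not_ge
    refine tent_eq_zero (amplitude_mem_Icc h0.le δ_pos.le).1 h0.le δ_pos ?_
    rcases le_total x.2 0 with hy | hy
    · have := gap 0 le_rfl h0.le
      rw [sub_zero, abs_of_nonpos hy] at this
      exact Or.inl (by linarith)
    · rcases le_total x.2 (h x.1.1) with hy' | hy'
      · have := gap x.2 hy hy'
        rw [sub_self, abs_zero] at this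
        linarith
      · have := gap _ h0.le le_rfl
        rw [abs_of_nonneg (by linarith)] at this
        exact Or.inr (by linarith)

end GraphPush

variable {P : Type*} [NormedAddCommGroup P] {h : P → ℝ} {R : Set ((P × ℝ) × ℝ)}

theorem exists_clearance (hh : Continuous h) (hh0 : ∀ s, 0 ≤ h s) (hR : IsClosed R)
    (hRh : ∀ s y, 0 ≤ y → y ≤ h s → ((s, 0), y) ∈ R → h s = 0) :
    ∃ δ : P → ℝ, Continuous δ ∧ (∀ s, 0 < h s → 0 < δ s) ∧
      ∀ s z y y', ((s, z), y) ∈ R → 0 ≤ y' → y' ≤ h s → δ s ≤ max |z| |y - y'| := by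
  -- The extra point lies below the region under the graph; it only makes the set nonempty.
  set R' : Set ((P × ℝ) × ℝ) := insert ((0, 0), -1) R with hR'
  have closed : IsClosed R' := by
    rw [hR', insert_eq]
    exact isClosed_singleton.union hR
  obtain ⟨f, f_apply⟩ : ∃ f : P → ℝ → ℝ, ∀ s u, f s u =
      Metric.infDist (((s, 0), u * h s) : (P × ℝ) × ℝ) R' := ⟨_, fun _ _ => rfl⟩
  have hf : Continuous ↿f := by
    change Continuous fun p : P × ℝ => f p.1 p.2
    simp only [f_apply]
    exact (Metric.continuous_infDist_pt R').comp
      (by fun_prop : Continuous fun p : P × ℝ => (((p.1, 0), p.2 * h p.1) : (P × ℝ) × ℝ))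
  have hfs : ∀ s, Continuous (f s) := fun s => hf.comp (by fun_prop : Continuous fun u => (s, u))
  refine ⟨fun s => sInf (f s '' Icc 0 1), isCompact_Icc.continuous_sInf hf, fun s hs => ?_,
    fun s z y y' hmem hy0 hyh => ?_⟩
  · obtain ⟨u, hu, inf_eq⟩ := isCompact_Icc.exists_sInf_image_eq (nonempty_Icc.2 zero_le_one)
      (hfs s).continuousOn
    dsimp only
    rw [inf_eq, f_apply]
    refine (closed.notMem_iff_infDist_pos ⟨_, mem_insert _ _⟩).1 ?_
    have hu0 : 0 ≤ u * h s := mul_nonneg hu.1 (hh0 s)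
    rintro (hmem | hmem)
    · linarith [congrArg Prod.snd hmem]
    · exact hs.ne' (hRh s _ hu0 (mul_le_of_le_one_left (hh0 s) hu.2) hmem)
  · obtain ⟨u, hu, rfl⟩ : ∃ u ∈ Icc (0 : ℝ) 1, u * h s = y' := by
      rcases (hh0 s).eq_or_lt with h0 | h0
      · exact ⟨0, by simp, by linarith⟩
      · exact ⟨y' / h s, ⟨by positivity, (div_le_one h0).2 hyh⟩, div_mul_cancel₀ _ h0.ne'⟩
    calc sInf (f s '' Icc 0 1) ≤ f s u :=
          csInf_le (isCompact_Icc.image (hfs s)).bddBelow (mem_image_of_mem _ hu)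
      _ ≤ dist (((s, 0), u * h s) : (P × ℝ) × ℝ) ((s, z), y) := by
          rw [f_apply]
          exact Metric.infDist_le_dist_of_mem (mem_insert_of_mem _ hmem)
      _ = max |z| |y - u * h s| := by
          simp [Prod.dist_eq, Real.dist_eq, abs_sub_comm y]

theorem ambientIsotopicRel_graph [ProperSpace P] (hh : Continuous h) (hh0 : ∀ s, 0 ≤ h s) {C : ℝ}
    (hC : ∀ s, h s ≤ C) (hR : IsClosed R)
    (hRh : ∀ s y, 0 ≤ y → y ≤ h s → ((s, 0), y) ∈ R → h s = 0) (A : Set P) :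
    AmbientIsotopicRel R ((fun s => ((s, 0), h s)) '' A) ((fun s => ((s, 0), 0)) '' A) := by
  obtain ⟨δ, hδc, hδ, clearance⟩ := exists_clearance hh hh0 hR hRh
  have bound : ∀ x, |graphPush h δ x| ≤ C := fun x => by
    rw [abs_of_nonneg graphPush_nonneg]
    exact (graphPush_le hh0 hδ).trans (hC _)
  have fixed : ∀ x ∈ R, graphPush h δ x = 0 := by
    rintro ⟨⟨s, z⟩, y⟩ hx
    exact graphPush_eq_zero_of_clearance hh0 hδ fun y' => clearance s z y y' hx
  have contraction : ∀ q y₁ y₂, y₁ < y₂ →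
      graphPush h δ (q, y₂) - graphPush h δ (q, y₁) < y₂ - y₁ := fun q _ _ hy =>
    graphPush_sub_lt hh0 hδ q hy
  have continuous : Continuous (graphPush h δ) := continuous_graphPush hh hh0 hδc hδ
  have push := ambientIsotopicRel_of_displacement continuous bound
    contraction fixed ((fun s => ((s, 0), h s)) '' A)
  simpa only [image_image, graphPush_graph hh0 hδ, sub_self] using push

end Graph

section LinearIsotopy

theorem ambientIsotopicRel_add_left {E : Type*} [NormedAddCommGroup E] [NormedSpace ℝ E] (m : E)
    (K : Set E) : AmbientIsotopicRel ∅ K ((fun x => m + x) '' K) :=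
  ⟨fun p => (p.1 : ℝ) • m + p.2, by fun_prop,
    fun t => (Homeomorph.addLeft ((t : ℝ) • m)).isHomeomorph, by simp, by simp, by simp⟩

theorem ambientIsotopicRel_of_isUnit_path {E : Type*} [NormedAddCommGroup E] [NormedSpace ℝ E]
    {A : ℝ → E →L[ℝ] E} (hA : Continuous A) (h0 : A 0 = 1)
    (hunit : ∀ t ∈ Icc (0 : ℝ) 1, IsUnit (A t)) (K : Set E) :
    AmbientIsotopicRel ∅ K (A 1 '' K) := by
  refine ⟨fun p => A p.1 p.2, by fun_prop, fun t => ?_, fun x => by simp [h0], by simp, by simp⟩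
  obtain ⟨U, hU⟩ := hunit t t.2
  simp only [← hU]
  exact (ContinuousLinearEquiv.ofUnit U).toHomeomorph.isHomeomorph

variable {n : Type*} [Fintype n] [DecidableEq n] {K : Set (EuclideanSpace ℝ n)}

open Matrix (toEuclideanCLM)

theorem ambientIsotopicRel_of_matrix_path {M : ℝ → Matrix n n ℝ} (hM : Continuous M)
    (h0 : M 0 = 1) (hdet : ∀ t ∈ Icc (0 : ℝ) 1, (M t).det ≠ 0) (K : Set (EuclideanSpace ℝ n)) :
    AmbientIsotopicRel ∅ K (toEuclideanCLM (𝕜 := ℝ) (M 1) '' K) := by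
  have continuous_toCLM : Continuous (toEuclideanCLM (n := n) (𝕜 := ℝ)) :=
    (toEuclideanCLM (n := n) (𝕜 := ℝ)).toAlgEquiv.toLinearMap.continuous_of_finiteDimensional
  refine ambientIsotopicRel_of_isUnit_path (A := fun t => toEuclideanCLM (𝕜 := ℝ) (M t))
    (continuous_toCLM.comp hM) (by rw [h0, map_one]) (fun t ht => ?_) K
  exact ((Matrix.isUnit_iff_isUnit_det _).2 (hdet t ht).isUnit).map (toEuclideanCLM (𝕜 := ℝ))

theorem ambientIsotopicRel_diagonal_of_pos {d : n → ℝ} (hd : ∀ i, 0 < d i)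
    (K : Set (EuclideanSpace ℝ n)) :
    AmbientIsotopicRel ∅ K (toEuclideanCLM (𝕜 := ℝ) (Matrix.diagonal d) '' K) := by
  have det_ne_zero : ∀ t ∈ Icc (0 : ℝ) 1, (Matrix.diagonal fun i => 1 - t + t * d i).det ≠ 0 := by
    intro t ⟨ht0, ht1⟩
    rw [Matrix.det_diagonal]
    refine Finset.prod_ne_zero_iff.2 fun i _ => ne_of_gt ?_
    rcases ht0.eq_or_lt with rfl | ht
    · simp
    · nlinarith [mul_pos ht (hd i)]
  simpa using ambientIsotopicRel_of_matrix_path (by fun_prop) (by simp) det_ne_zero K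

theorem ambientIsotopicRel_transvection (t : Matrix.TransvectionStruct n ℝ)
    (K : Set (EuclideanSpace ℝ n)) :
    AmbientIsotopicRel ∅ K (toEuclideanCLM (𝕜 := ℝ) t.toMatrix '' K) := by
  obtain ⟨i, j, hij, c⟩ := t
  have continuous : Continuous fun t : ℝ => Matrix.transvection i j (t * c) :=
    continuous_const.add (continuous_matrix fun k l => by
      simp only [Matrix.single_apply]
      split_ifs <;> fun_prop)
  simpa using ambientIsotopicRel_of_matrix_path continuous (by simp)
    (fun t _ => by rw [Matrix.det_transvection_of_ne _ _ hij]; exact one_ne_zero) K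

theorem toEuclideanCLM_mul_image (A B : Matrix n n ℝ) (K : Set (EuclideanSpace ℝ n)) :
    toEuclideanCLM (𝕜 := ℝ) (A * B) '' K =
      toEuclideanCLM (𝕜 := ℝ) A '' (toEuclideanCLM (𝕜 := ℝ) B '' K) := by
  rw [map_mul, image_image]
  rfl

theorem ambientIsotopicRel_diagonal
    (hK : ∀ ε : n → ℝ, (∀ i, ε i * ε i = 1) →
      toEuclideanCLM (𝕜 := ℝ) (Matrix.diagonal ε) '' K = K)
    {d : n → ℝ} (hd : ∀ i, d i ≠ 0) :
    AmbientIsotopicRel ∅ K (toEuclideanCLM (𝕜 := ℝ) (Matrix.diagonal d) '' K) := by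
  have sign_sq : ∀ i, (SignType.sign (d i) : ℝ) * SignType.sign (d i) = 1 := fun i => by
    rcases (hd i).lt_or_gt with h | h <;> simp [h]
  have factor : Matrix.diagonal d =
      Matrix.diagonal (fun i => |d i|) * Matrix.diagonal fun i => (SignType.sign (d i) : ℝ) := by
    simp only [Matrix.diagonal_mul_diagonal, abs_mul_sign]
  rw [factor, toEuclideanCLM_mul_image, hK _ sign_sq]
  exact ambientIsotopicRel_diagonal_of_pos (fun i => abs_pos.2 (hd i)) K

/-- Positive diagonal matrices and transvections are joined to the identity by invertible matrices,
so only the signs of the diagonal part matter. -/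
theorem ambientIsotopicRel_matrix_image
    (hK : ∀ ε : n → ℝ, (∀ i, ε i * ε i = 1) →
      toEuclideanCLM (𝕜 := ℝ) (Matrix.diagonal ε) '' K = K)
    {M : Matrix n n ℝ} (hM : M.det ≠ 0) :
    AmbientIsotopicRel ∅ K (toEuclideanCLM (𝕜 := ℝ) M '' K) := by
  refine Matrix.diagonal_transvection_induction_of_det_ne_zero
    (fun M => AmbientIsotopicRel ∅ K (toEuclideanCLM (𝕜 := ℝ) M '' K)) M hM (fun d hd => ?_)
    (fun t => ambientIsotopicRel_transvection t K) (fun A B hA _ isotopy_A isotopy_B => ?_)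
  · rw [Matrix.det_diagonal, Finset.prod_ne_zero_iff] at hd
    exact ambientIsotopicRel_diagonal hK fun i => hd i (Finset.mem_univ i)
  · obtain ⟨U, hU⟩ :=
      ((Matrix.isUnit_iff_isUnit_det A).2 hA.isUnit).map (toEuclideanCLM (𝕜 := ℝ))
    have isotopy_AB := isotopy_B.image (ContinuousLinearEquiv.ofUnit U).toHomeomorph
    rw [image_empty] at isotopy_AB
    refine isotopy_A.trans ?_
    rw [toEuclideanCLM_mul_image, ← hU]
    exact isotopy_AB

theorem diagonal_image_standardCircle (ε : Fin 3 → ℝ) (hε : ∀ i, ε i * ε i = 1) :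
    toEuclideanCLM (𝕜 := ℝ) (Matrix.diagonal ε) '' standardCircle = standardCircle := by
  have involutive :
      Function.Involutive (toEuclideanCLM (𝕜 := ℝ) (Matrix.diagonal ε)) := fun x => by
    ext i
    simp [Matrix.mulVec_diagonal, ← mul_assoc, hε]
  have sq : ∀ i, ε i ^ 2 = 1 := fun i => by rw [pow_two, hε]
  have ne_zero : ∀ i, ε i ≠ 0 := fun i => left_ne_zero_of_mul_eq_one (hε i)
  rw [involutive.image_eq_preimage_symm]
  ext x
  simp [standardCircle, Matrix.mulVec_diagonal, mul_pow, sq, ne_zero]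

theorem ambientIsotopicRel_linear_image_standardCircle
    (L : EuclideanSpace ℝ (Fin 3) ≃L[ℝ] EuclideanSpace ℝ (Fin 3)) :
    AmbientIsotopicRel ∅ standardCircle (L '' standardCircle) := by
  obtain ⟨M, hM⟩ := EquivLike.surjective (toEuclideanCLM (n := Fin 3) (𝕜 := ℝ))
    (L : EuclideanSpace ℝ (Fin 3) →L[ℝ] EuclideanSpace ℝ (Fin 3))
  have isUnit_M : IsUnit M :=
    (isUnit_map_iff (toEuclideanCLM (n := Fin 3) (𝕜 := ℝ)) M).1 (hM ▸ ⟨L.toUnit, rfl⟩)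
  have := ambientIsotopicRel_matrix_image diagonal_image_standardCircle
    ((Matrix.isUnit_iff_isUnit_det M).1 isUnit_M).ne_zero
  rwa [hM] at this

end LinearIsotopy

section Triangle

variable {E : Type*} [AddCommGroup E] [Module ℝ E]

theorem mem_convexHull_triple {a b c x : E} : x ∈ convexHull ℝ {a, b, c} ↔
    ∃ α β γ : ℝ, 0 ≤ α ∧ 0 ≤ β ∧ 0 ≤ γ ∧ α + β + γ = 1 ∧ α • a + β • b + γ • c = x := by
  constructor
  · intro h
    rw [convexHull_insert (by simp), convexHull_pair, mem_convexJoin] at h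
    obtain ⟨y, rfl, z, ⟨s, t, hs, ht, hst, rfl⟩, u, v, hu, hv, huv, rfl⟩ := h
    refine ⟨u, v * s, v * t, hu, by positivity, by positivity, ?_, by module⟩
    rw [add_assoc, ← mul_add, hst, mul_one, huv]
  · rintro ⟨α, β, γ, hα, hβ, hγ, h, rfl⟩
    have := (convex_convexHull ℝ {a, b, c}).sum_mem
      (t := Finset.univ) (w := ![α, β, γ]) (z := ![a, b, c])
      (by intro i _; fin_cases i <;> assumption) (by simp [Fin.sum_univ_three, h])
      (by intro i _; apply subset_convexHull; fin_cases i <;> simp)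
    simpa [Fin.sum_univ_three] using this

theorem image_abs_eq_union_segment (m u v : E) :
    (fun s : ℝ => m + s • u + (1 - |s|) • v) '' Icc (-1) 1 =
      segment ℝ (m - u) (m + v) ∪ segment ℝ (m + v) (m + u) := by
  ext x
  constructor
  · rintro ⟨s, ⟨hs, hs'⟩, rfl⟩
    rcases le_total s 0 with h | h
    · refine Or.inl ⟨-s, 1 + s, by linarith, by linarith, by ring, ?_⟩
      simp only [abs_of_nonpos h]
      module
    · refine Or.inr ⟨1 - s, s, by linarith, h, by ring, ?_⟩
      simp only [abs_of_nonneg h]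
      module
  · rintro (⟨p, q, hp, hq, hpq, rfl⟩ | ⟨p, q, hp, hq, hpq, rfl⟩)
    · refine ⟨-p, ⟨by linarith, by linarith⟩, ?_⟩
      obtain rfl : q = 1 - p := by linarith
      simp only [abs_neg, abs_of_nonneg hp]
      module
    · refine ⟨q, ⟨by linarith, by linarith⟩, ?_⟩
      obtain rfl : p = 1 - q := by linarith
      simp only [abs_of_nonneg hq]
      module

theorem image_Icc_eq_segment (m u : E) :
    (fun s : ℝ => m + s • u) '' Icc (-1) 1 = segment ℝ (m - u) (m + u) := by
  ext x
  constructor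
  · rintro ⟨s, ⟨hs, hs'⟩, rfl⟩
    exact ⟨(1 - s) / 2, (1 + s) / 2, by linarith, by linarith, by ring, by module⟩
  · rintro ⟨p, q, hp, hq, hpq, rfl⟩
    refine ⟨q - p, ⟨by linarith, by linarith⟩, ?_⟩
    obtain rfl : p = 1 - q := by linarith
    module

theorem exists_symmetric_frame (a b c : E) (h : LinearIndependent ℝ ![b - a, c - a]) :
    ∃ m u v : E, LinearIndependent ℝ ![u, v] ∧ a = m - u ∧ b = m + v ∧ c = m + u := by
  refine ⟨(1 / 2 : ℝ) • (a + c), (1 / 2 : ℝ) • (c - a), b - (1 / 2 : ℝ) • (a + c), ?_,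
    by module, by module, by module⟩
  rw [LinearIndependent.pair_iff] at h ⊢
  intro s t hst
  have := h t (s / 2 - t / 2) (by rw [← hst]; module)
  exact ⟨by linarith, this.1⟩

end Triangle

section Chart

theorem exists_continuousLinearEquiv_of_linearIndependent {u v : EuclideanSpace ℝ (Fin 3)}
    (h : LinearIndependent ℝ ![u, v]) :
    ∃ L : EuclideanSpace ℝ (Fin 3) ≃L[ℝ] EuclideanSpace ℝ (Fin 3),
      ∀ s y : ℝ, L !₂[s, y, 0] = s • u + y • v := by
  obtain ⟨w, hw⟩ := exists_linearIndependent_snoc_of_lt_finrank h (by simp)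
  let b := basisOfLinearIndependentOfCardEqFinrank hw (by simp)
  refine ⟨((WithLp.linearEquiv 2 ℝ (Fin 3 → ℝ)).trans b.equivFun.symm).toContinuousLinearEquiv,
    fun s y => ?_⟩
  simp [b, Module.Basis.equivFun_symm_apply, Fin.sum_univ_three]

/-- Affine coordinates `((s, z), y)` on space, in which the plane `z = 0` is the one that is
parallel to the images under `L` of the first two coordinate axes and contains `m`. -/
noncomputable def chart (m : EuclideanSpace ℝ (Fin 3))
    (L : EuclideanSpace ℝ (Fin 3) ≃L[ℝ] EuclideanSpace ℝ (Fin 3)) :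
    (ℝ × ℝ) × ℝ ≃ₜ EuclideanSpace ℝ (Fin 3) where
  toFun x := m + L !₂[x.1.1, x.2, x.1.2]
  invFun x := ((L.symm (x - m) 0, L.symm (x - m) 2), L.symm (x - m) 1)
  left_inv x := by simp
  right_inv x := by
    have : !₂[L.symm (x - m) 0, L.symm (x - m) 1, L.symm (x - m) 2] = L.symm (x - m) := by
      ext i
      fin_cases i <;> rfl
    simp only [this, L.apply_symm_apply, add_sub_cancel]
  continuous_toFun := by fun_prop
  continuous_invFun := by fun_prop

/-- The part over `[-1, 1]` of the graph of `h` in the plane `z = 0` of a chart. -/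
def arc (h : ℝ → ℝ) : Set ((ℝ × ℝ) × ℝ) := (fun s => ((s, 0), h s)) '' Icc (-1) 1

theorem isClosed_arc {h : ℝ → ℝ} (hh : Continuous h) : IsClosed (arc h) :=
  (isCompact_Icc.image (by fun_prop)).isClosed

theorem mem_arc {h : ℝ → ℝ} {s z y : ℝ} :
    ((s, z), y) ∈ arc h ↔ s ∈ Icc (-1) 1 ∧ z = 0 ∧ y = h s := by
  simp only [arc, mem_image, Prod.mk.injEq]
  grind

theorem ambientIsotopicRel_arc_union {g h : ℝ → ℝ} (hg : Continuous g) (hg0 : ∀ s, 0 ≤ g s)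
    (hh : Continuous h) (hh0 : ∀ s, 0 ≤ h s) {C : ℝ} (hC : ∀ s, h s ≤ C)
    (hgh : ∀ s, g s = 0 → h s = 0) :
    AmbientIsotopicRel ∅ (arc h ∪ arc (-g)) (arc 0 ∪ arc (-g)) := by
  refine ((ambientIsotopicRel_graph hh hh0 hC (isClosed_arc hg.neg) (fun s y hy0 hyh hmem => ?_)
    (Icc (-1) 1)).union subset_rfl).mono (empty_subset _)
  obtain ⟨-, -, rfl⟩ := mem_arc.1 hmem
  exact hgh s (le_antisymm (neg_nonneg.1 hy0) (hg0 s))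

theorem ambientIsotopicRel_arc_union_neg {g h : ℝ → ℝ} (hg : Continuous g) (hg0 : ∀ s, 0 ≤ g s)
    (hh : Continuous h) (hh0 : ∀ s, 0 ≤ h s) {C : ℝ} (hC : ∀ s, h s ≤ C)
    (hgh : ∀ s, g s = 0 → h s = 0) :
    AmbientIsotopicRel ∅ (arc g ∪ arc (-h)) (arc g ∪ arc 0) := by
  have reflected := (ambientIsotopicRel_arc_union hg hg0 hh hh0 hC hgh).image
    ((Homeomorph.refl (ℝ × ℝ)).prodCongr (Homeomorph.neg ℝ))
  have image_arc : ∀ f, ((Homeomorph.refl (ℝ × ℝ)).prodCongr (Homeomorph.neg ℝ)) '' arc f =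
      arc (-f) := fun f => by simp [arc, image_image]
  simpa only [image_empty, image_union, image_arc, neg_neg, neg_zero, union_comm (arc g)]
    using reflected

/-- The height of the upper unit semicircle over `[-1, 1]`. -/
noncomputable def semicircle (s : ℝ) : ℝ := √(1 - s ^ 2)

/-- The height of the two upper sides of the triangle with vertices `(-1, 0)`, `(0, 1)` and
`(1, 0)`. -/
def roof (s : ℝ) : ℝ := max 0 (1 - |s|)

theorem continuous_semicircle : Continuous semicircle := by
  unfold semicircle
  fun_prop

theorem continuous_roof : Continuous roof := by
  unfold roof
  fun_prop

theorem semicircle_nonneg (s : ℝ) : 0 ≤ semicircle s := Real.sqrt_nonneg _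

theorem roof_nonneg (s : ℝ) : 0 ≤ roof s := le_max_left _ _

theorem semicircle_le_one (s : ℝ) : semicircle s ≤ 1 :=
  Real.sqrt_le_one.2 (by linarith [sq_nonneg s])

theorem roof_le_one (s : ℝ) : roof s ≤ 1 :=
  max_le zero_le_one (by linarith [abs_nonneg s])

theorem semicircle_eq_zero {s : ℝ} : semicircle s = 0 ↔ 1 ≤ |s| := by
  rw [semicircle, Real.sqrt_eq_zero', sub_nonpos, one_le_sq_iff_one_le_abs]

theorem roof_eq_zero {s : ℝ} : roof s = 0 ↔ 1 ≤ |s| := by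
  rw [roof, max_eq_left_iff, sub_nonpos]

/-- Both moves slide an arc across a region whose remaining boundary is the fixed arc. -/
theorem ambientIsotopicRel_circle_triangle :
    AmbientIsotopicRel ∅ (arc semicircle ∪ arc (-semicircle)) (arc roof ∪ arc 0) :=
  (ambientIsotopicRel_arc_union continuous_semicircle semicircle_nonneg continuous_semicircle
      semicircle_nonneg semicircle_le_one fun _ => id).trans <|
    (ambientIsotopicRel_arc_union continuous_semicircle semicircle_nonneg continuous_roof
      roof_nonneg roof_le_one fun _ hs => roof_eq_zero.2 (semicircle_eq_zero.1 hs)).symm.trans <|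
    ambientIsotopicRel_arc_union_neg continuous_roof roof_nonneg continuous_semicircle
      semicircle_nonneg semicircle_le_one fun _ hs => semicircle_eq_zero.2 (roof_eq_zero.1 hs)

variable {m u v : EuclideanSpace ℝ (Fin 3)}
  {L : EuclideanSpace ℝ (Fin 3) ≃L[ℝ] EuclideanSpace ℝ (Fin 3)}

theorem chart_apply (hL : ∀ s y : ℝ, L !₂[s, y, 0] = s • u + y • v) (s y : ℝ) :
    chart m L ((s, 0), y) = m + s • u + y • v := by
  rw [add_assoc, ← hL]
  rfl

theorem chart_image_circle :
    chart m L '' (arc semicircle ∪ arc (-semicircle)) =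
      (fun x => m + x) '' (L '' standardCircle) := by
  have circle : (fun x : (ℝ × ℝ) × ℝ => (!₂[x.1.1, x.2, x.1.2] : EuclideanSpace ℝ (Fin 3))) ''
      (arc semicircle ∪ arc (-semicircle)) = standardCircle := by
    ext x
    have height : ∀ s ∈ Icc (-1 : ℝ) 1, s ^ 2 + semicircle s ^ 2 = 1 := fun s hs => by
      rw [semicircle, Real.sq_sqrt (by nlinarith [hs.1, hs.2]), add_sub_cancel]
    constructor
    · rintro ⟨_, ⟨s, hs, rfl⟩ | ⟨s, hs, rfl⟩, rfl⟩ <;> simp [standardCircle, height s hs]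
    · rintro ⟨hx, hx2⟩
      have hx0 : x 0 ∈ Icc (-1) 1 := abs_le.1 ((sq_le_one_iff_abs_le_one _).1 (by nlinarith))
      have hx1 : x 1 = semicircle (x 0) ∨ x 1 = -semicircle (x 0) :=
        sq_eq_sq_iff_eq_or_eq_neg.1 (by linarith [height _ hx0])
      refine ⟨((x 0, 0), x 1), hx1.imp (fun h => mem_arc.2 ⟨hx0, rfl, h⟩)
        (fun h => mem_arc.2 ⟨hx0, rfl, h⟩), ?_⟩
      ext i
      fin_cases i <;> simp [hx2]
  rw [← circle, image_image, image_image]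
  rfl

theorem chart_image_roof (hL : ∀ s y : ℝ, L !₂[s, y, 0] = s • u + y • v) :
    chart m L '' arc roof = segment ℝ (m - u) (m + v) ∪ segment ℝ (m + v) (m + u) := by
  rw [← image_abs_eq_union_segment, arc, image_image]
  refine image_congr fun s hs => ?_
  rw [chart_apply hL, roof, max_eq_right (sub_nonneg.2 (abs_le.2 hs))]

theorem chart_image_base (hL : ∀ s y : ℝ, L !₂[s, y, 0] = s • u + y • v) :
    chart m L '' arc 0 = segment ℝ (m - u) (m + u) := by
  rw [← image_Icc_eq_segment, arc, image_image]
  refine image_congr fun s _ => ?_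
  rw [chart_apply hL, Pi.zero_apply, zero_smul, add_zero]

end Chart

theorem ambientIsotopicRel_triangle {a b c : EuclideanSpace ℝ (Fin 3)}
    (h : LinearIndependent ℝ ![b - a, c - a]) {R : Set (EuclideanSpace ℝ (Fin 3))}
    (hR : IsClosed R) (hRT : R ∩ convexHull ℝ {a, b, c} ⊆ {a, c}) :
    AmbientIsotopicRel R (segment ℝ a b ∪ segment ℝ b c) (segment ℝ a c) := by
  obtain ⟨m, u, v, huv, rfl, rfl, rfl⟩ := exists_symmetric_frame a b c h
  obtain ⟨L, hL⟩ := exists_continuousLinearEquiv_of_linearIndependent huv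
  have disjoint : ∀ s y, 0 ≤ y → y ≤ roof s → ((s, 0), y) ∈ chart m L ⁻¹' R → roof s = 0 := by
    intro s y hy0 hy hmem
    refine roof_eq_zero.2 (not_lt.1 fun hs => ?_)
    rw [roof, max_eq_right (by linarith)] at hy
    obtain ⟨hs1, hs2⟩ := abs_le.1 (show |s| ≤ 1 - y by linarith)
    have corner := hRT ⟨hmem, mem_convexHull_triple.2 ⟨(1 - s - y) / 2, y, (1 + s - y) / 2,
      by linarith, hy0, by linarith, by ring, by rw [chart_apply hL]; module⟩⟩
    have corners : ({m - u, m + u} : Set (EuclideanSpace ℝ (Fin 3))) =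
        chart m L '' {((-1, 0), 0), ((1, 0), 0)} := by
      simp [image_pair, chart_apply hL, sub_eq_add_neg]
    rw [corners, (chart m L).injective.mem_set_image] at corner
    rcases corner with corner | corner <;> simp_all
  have move := (ambientIsotopicRel_graph continuous_roof roof_nonneg roof_le_one
    (hR.preimage (chart m L).continuous) disjoint (Icc (-1) 1)).image (chart m L)
  rw [image_preimage_eq _ (chart m L).surjective] at move
  rw [← chart_image_roof hL, ← chart_image_base hL]
  exact move

theorem isUnknot_triangle {a b c : EuclideanSpace ℝ (Fin 3)}
    (h : LinearIndependent ℝ ![b - a, c - a]) :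
    IsUnknot (segment ℝ a b ∪ segment ℝ b c ∪ segment ℝ c a) := by
  obtain ⟨m, u, v, huv, rfl, rfl, rfl⟩ := exists_symmetric_frame a b c h
  obtain ⟨L, hL⟩ := exists_continuousLinearEquiv_of_linearIndependent huv
  have flatten := ambientIsotopicRel_circle_triangle.image (chart m L)
  rw [image_empty, chart_image_circle, image_union, chart_image_roof hL,
    chart_image_base hL] at flatten
  rw [segment_symm ℝ (m + u) (m - u)]
  exact ((ambientIsotopicRel_linear_image_standardCircle L).trans
    ((ambientIsotopicRel_add_left m _).trans flatten)).symm.ambientIsotopic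

section Simplex

variable {E : Type*} [AddCommGroup E] [Module ℝ E]

theorem mem_convexHull_basis_image {ι : Type*} [Finite ι] (B : AffineBasis ι ℝ E) {J : Set ι}
    {x : E} : x ∈ convexHull ℝ (B '' J) ↔
      (∀ i, 0 ≤ B.coord i x) ∧ ∀ i ∉ J, B.coord i x = 0 := by
  classical
  have := Fintype.ofFinite ι
  constructor
  · intro hx
    have convex : Convex ℝ
        ((⋂ i, B.coord i ⁻¹' Ici 0) ∩ ⋂ i, ⋂ _ : i ∉ J, B.coord i ⁻¹' {0}) :=
      (convex_iInter fun i => (convex_Ici 0).affine_preimage _).inter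
        (convex_iInter fun i => convex_iInter fun _ => (convex_singleton 0).affine_preimage _)
    have := convexHull_min (image_subset_iff.2 fun j hj => ?_) convex hx
    · simpa using this
    · simp only [mem_preimage, mem_inter_iff, mem_iInter, mem_Ici, mem_singleton_iff, B.coord_apply]
      refine ⟨fun i => ?_, fun i hi => if_neg ?_⟩
      · split_ifs <;> norm_num
      · rintro rfl
        exact hi hj
  · rintro ⟨nonneg, zero⟩
    have mem_J : ∀ i, B.coord i x ≠ 0 → i ∈ J := fun i => not_imp_comm.1 (zero i)
    have coord_sum : ∑ i with i ∈ J, B.coord i x = 1 := by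
      rw [← B.sum_coord_apply_eq_one x]
      exact Finset.sum_filter_of_ne fun i _ => mem_J i
    have combination : ∑ i with i ∈ J, B.coord i x • B i = x := by
      conv_rhs => rw [← B.linear_combination_coord_eq_self x]
      exact Finset.sum_filter_of_ne fun i _ hi => mem_J i (left_ne_zero_of_smul hi)
    rw [← combination]
    exact (convex_convexHull ℝ _).sum_mem (fun i _ => nonneg i) coord_sum
      fun i hi => subset_convexHull ℝ _ (mem_image_of_mem B (Finset.mem_filter.1 hi).2)

theorem exists_halfspaces_of_affineIndependent [FiniteDimensional ℝ E] {s : Set E}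
    (hs : AffineIndependent ℝ ((↑) : s → E)) :
    ∃ L : Set (E →ᵃ[ℝ] ℝ), L.Finite ∧ ∀ x, x ∈ convexHull ℝ s ↔ ∀ l ∈ L, 0 ≤ l x := by
  obtain ⟨t, hst, ht, span_eq_top⟩ := exists_subset_affineIndependent_affineSpan_eq_top hs
  have : Finite t := finite_set_of_fin_dim_affineIndependent ℝ ht
  let B : AffineBasis t ℝ E := ⟨fun p => p, ht, by simpa using span_eq_top⟩
  have hull_eq : s = B '' {i | (i : E) ∈ s} := by
    change s = Subtype.val '' (Subtype.val ⁻¹' s)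
    rw [Subtype.image_preimage_coe, inter_eq_right.2 hst]
  refine ⟨range (fun i => B.coord i) ∪ (fun i => -B.coord i) '' {i | (i : E) ∉ s},
    (finite_range _).union ((toFinite _).image _), fun x => ?_⟩
  nth_rewrite 1 [hull_eq]
  simp only [mem_convexHull_basis_image, mem_union, or_imp, forall_and, forall_mem_range,
    forall_mem_image, AffineMap.coe_neg, Pi.neg_apply, Left.nonneg_neg_iff]
  exact and_congr_right fun nonneg =>
    forall₂_congr fun i _ => (nonneg i).ge_iff_eq'.symm

end Simplex

theorem IsPLOn.continuousOn {E F : Type*} [NormedAddCommGroup E] [NormedSpace ℝ E]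
    [FiniteDimensional ℝ E] [NormedAddCommGroup F] [NormedSpace ℝ F] {f : E → F} {S : Set E}
    (hf : IsPLOn f S) : ContinuousOn f S := by
  obtain ⟨K, faces_finite, rfl, affine_on_face⟩ := hf
  have : Finite K.faces := faces_finite
  rw [Geometry.SimplicialComplex.space, biUnion_eq_iUnion]
  refine (locallyFinite_of_finite _).continuousOn_iUnion
    (fun s => (s : Finset E).finite_toSet.isClosed_convexHull ℝ) fun s => ?_
  obtain ⟨g, hg⟩ := affine_on_face s s.2
  exact g.continuous_of_finiteDimensional.continuousOn.congr hg

/-- The functionals cut out the simplices of a triangulation. If none of them changes sign on a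
triangle, then the simplex that contains the barycentre contains the whole triangle. -/
theorem IsPLOn.exists_functionals {E F : Type*} [AddCommGroup E] [Module ℝ E]
    [FiniteDimensional ℝ E] [AddCommGroup F] [Module ℝ F] {f : E → F} {S : Set E}
    (hf : IsPLOn f S) : ∃ L : List (E →ᵃ[ℝ] ℝ), ∀ a b c : E, convexHull ℝ {a, b, c} ⊆ S →
      (∀ l ∈ L, (0 ≤ l a ∧ 0 ≤ l b ∧ 0 ≤ l c) ∨ (l a ≤ 0 ∧ l b ≤ 0 ∧ l c ≤ 0)) →
      ∃ g : E →ᵃ[ℝ] F, EqOn f g (convexHull ℝ {a, b, c}) := by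
  obtain ⟨K, faces_finite, rfl, affine_on_face⟩ := hf
  choose! L L_finite mem_face using
    fun s (hs : s ∈ K.faces) => exists_halfspaces_of_affineIndependent (K.indep hs)
  refine ⟨(faces_finite.biUnion L_finite).toFinset.toList, fun a b c subset same_sign => ?_⟩
  let p := AffineMap.lineMap (AffineMap.lineMap a b (1 / 2 : ℝ)) c (1 / 3 : ℝ)
  have p_mem : p ∈ convexHull ℝ {a, b, c} := mem_convexHull_triple.2
    ⟨1 / 3, 1 / 3, 1 / 3, by norm_num, by norm_num, by norm_num, by norm_num, by
      simp only [p, AffineMap.lineMap_apply_module]; module⟩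
  obtain ⟨s, hs, p_mem_s⟩ := Geometry.SimplicialComplex.mem_space_iff.1 (subset p_mem)
  obtain ⟨g, hg⟩ := affine_on_face s hs
  have vertex_nonneg : ∀ l ∈ L s, 0 ≤ l a ∧ 0 ≤ l b ∧ 0 ≤ l c := by
    intro l hl
    have barycentre : 3 * l p = l a + l b + l c := by
      simp only [p, AffineMap.apply_lineMap]
      simp only [AffineMap.lineMap_apply_module, smul_eq_mul]
      ring
    have p_nonneg := (mem_face s hs p).1 p_mem_s l hl
    rcases same_sign l (by simpa using ⟨s, hs, hl⟩) with h | ⟨ha, hb, hc⟩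
    · exact h
    · exact ⟨by linarith, by linarith, by linarith⟩
  refine ⟨g, hg.mono (convexHull_min ?_ (convex_convexHull ℝ _))⟩
  rintro x (rfl | rfl | rfl)
  · exact (mem_face s hs _).2 fun l hl => (vertex_nonneg l hl).1
  · exact (mem_face s hs _).2 fun l hl => (vertex_nonneg l hl).2.1
  · exact (mem_face s hs _).2 fun l hl => (vertex_nonneg l hl).2.2

section Nondegenerate

variable {E : Type*} [AddCommGroup E] [Module ℝ E]

theorem eq_and_eq_of_smul_add_smul_eq {u v : E} (h : LinearIndependent ℝ ![u, v]) {p q p' q' : ℝ}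
    (e : p • u + q • v = p' • u + q' • v) : p = p' ∧ q = q' := by
  have := LinearIndependent.pair_iff.1 h (p - p') (q - q') (by
    rw [sub_smul, sub_smul, sub_add_sub_comm, e, sub_self])
  exact ⟨by linarith [this.1], by linarith [this.2]⟩

theorem linearIndependent_triangle_rotate {a b c : E} (h : LinearIndependent ℝ ![b - a, c - a]) :
    LinearIndependent ℝ ![c - b, a - b] := by
  rw [LinearIndependent.pair_iff] at h ⊢
  intro s t hst
  have := h (-s - t) s (by rw [← hst]; module)
  exact ⟨this.2, by linarith [this.1, this.2]⟩

theorem linearIndependent_triangle_swap {a b c : E} (h : LinearIndependent ℝ ![b - a, c - a]) :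
    LinearIndependent ℝ ![b - c, a - c] := by
  rw [LinearIndependent.pair_iff] at h ⊢
  intro s t hst
  have := h s (-s - t) (by rw [← hst]; module)
  exact ⟨this.1, by linarith [this.1, this.2]⟩

theorem linearIndependent_triangle_left {a b c : E} (h : LinearIndependent ℝ ![b - a, c - a])
    {t : ℝ} (ht : t ≠ 0) : LinearIndependent ℝ ![b - a, AffineMap.lineMap a c t - a] := by
  rw [LinearIndependent.pair_iff] at h ⊢
  intro p q hpq
  have := h p (q * t) (by rw [← hpq, AffineMap.lineMap_apply_module]; module)
  exact ⟨this.1, by simpa [ht] using this.2⟩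

theorem linearIndependent_triangle_right {a b c : E} (h : LinearIndependent ℝ ![b - a, c - a])
    {t : ℝ} (ht : t ≠ 1) :
    LinearIndependent ℝ ![b - AffineMap.lineMap a c t, c - AffineMap.lineMap a c t] := by
  rw [LinearIndependent.pair_iff] at h ⊢
  intro p q hpq
  have := h p (q * (1 - t) - p * t) (by rw [← hpq, AffineMap.lineMap_apply_module]; module)
  have h1 := this.1
  have h2 : q * (1 - t) = 0 := by rw [← this.2, h1]; ring
  exact ⟨h1, by simpa [sub_eq_zero, ht.symm] using h2⟩

theorem convexHull_inter_of_cut {a b c : E} (h : LinearIndependent ℝ ![b - a, c - a]) {t : ℝ}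
    (h0 : 0 < t) (h1 : t < 1) :
    convexHull ℝ {a, b, AffineMap.lineMap a c t} ∩ convexHull ℝ {AffineMap.lineMap a c t, b, c} ⊆
      segment ℝ b (AffineMap.lineMap a c t) := by
  rintro x ⟨hx, hx'⟩
  obtain ⟨α, β, γ, hα, hβ, hγ, hs, rfl⟩ := mem_convexHull_triple.1 hx
  obtain ⟨α', β', γ', hα', -, hγ', hs', e⟩ := mem_convexHull_triple.1 hx'
  obtain rfl : α = 1 - β - γ := by linarith
  obtain rfl : α' = 1 - β' - γ' := by linarith
  rw [AffineMap.lineMap_apply_module] at e ⊢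
  have coordinates : β' • (b - a) + ((1 - β' - γ') * t + γ') • (c - a) =
      β • (b - a) + (γ * t) • (c - a) := by linear_combination (norm := module) e
  obtain ⟨rfl, coordinate_c⟩ := eq_and_eq_of_smul_add_smul_eq h coordinates
  have hγ'0 : γ' = 0 := by nlinarith [mul_nonneg hα h0.le]
  have hα0 : 1 - β' - γ = 0 := by nlinarith
  refine ⟨β', γ, hβ, hγ, by linarith, ?_⟩
  rw [hα0]
  module

theorem segment_eq_union_of_mem {a b d : E} (hd : d ∈ segment ℝ a b) :
    segment ℝ a b = segment ℝ a d ∪ segment ℝ d b := by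
  rw [segment_eq_image_lineMap] at hd
  obtain ⟨t, ⟨ht0, ht1⟩, rfl⟩ := hd
  have image_Icc : ∀ p q : ℝ, p ≤ q → AffineMap.lineMap a b '' Icc p q =
      segment ℝ (AffineMap.lineMap a b p) (AffineMap.lineMap a b q) := fun p q hpq => by
    rw [← segment_eq_Icc hpq, image_segment]
  rw [segment_eq_image_lineMap, ← Icc_union_Icc_eq_Icc ht0 ht1, image_union, image_Icc _ _ ht0,
    image_Icc _ _ ht1, AffineMap.lineMap_apply_zero, AffineMap.lineMap_apply_one]

end Nondegenerate

section Push

theorem image_inter_image_subset {α β : Type*} {f : α → β} {S A B C : Set α} (hf : InjOn f S)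
    (hA : A ⊆ S) (hB : B ⊆ S) (h : A ∩ B ⊆ C) : f '' A ∩ f '' B ⊆ f '' C := by
  rw [← hf.image_inter hA hB]
  exact image_mono h

theorem insert_insert_singleton_rotate {α : Type*} (a b c : α) :
    ({b, c, a} : Set α) = {a, b, c} := by
  rw [pair_comm c a, insert_comm]

theorem left_mem_triangle {E : Type*} [AddCommGroup E] [Module ℝ E] (a b c : E) :
    a ∈ convexHull ℝ {a, b, c} :=
  subset_convexHull ℝ _ (by simp)

theorem mid_mem_triangle {E : Type*} [AddCommGroup E] [Module ℝ E] (a b c : E) :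
    b ∈ convexHull ℝ {a, b, c} :=
  subset_convexHull ℝ _ (by simp)

theorem right_mem_triangle {E : Type*} [AddCommGroup E] [Module ℝ E] (a b c : E) :
    c ∈ convexHull ℝ {a, b, c} :=
  subset_convexHull ℝ _ (by simp)

theorem triangle_subset {E : Type*} [AddCommGroup E] [Module ℝ E] {C : Set E} (hC : Convex ℝ C)
    {a b c : E} (ha : a ∈ C) (hb : b ∈ C) (hc : c ∈ C) : convexHull ℝ {a, b, c} ⊆ C :=
  convexHull_min (by rintro x (rfl | rfl | rfl) <;> assumption) hC

/-- The image of `B` can be moved across the image of `D` onto the image of the segment `ac`, by an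
isotopy that fixes everything meeting the image of `D` only in those of `a` and `c`. -/
def SweepsOnto {E : Type*} [AddCommGroup E] [Module ℝ E] (F : E → EuclideanSpace ℝ (Fin 3))
    (D B : Set E) (a c : E) : Prop :=
  ∀ R : Set (EuclideanSpace ℝ (Fin 3)), IsClosed R → R ∩ F '' D ⊆ F '' {a, c} →
    AmbientIsotopicRel R (F '' B) (F '' segment ℝ a c)

/-- The image of the path `abc` sweeps across the image of the triangle `abc` onto that of `ac`. -/
def PushesAcross {E : Type*} [AddCommGroup E] [Module ℝ E] (F : E → EuclideanSpace ℝ (Fin 3))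
    (a b c : E) : Prop :=
  SweepsOnto F (convexHull ℝ {a, b, c}) (segment ℝ a b ∪ segment ℝ b c) a c

variable {E : Type*} [NormedAddCommGroup E] [NormedSpace ℝ E]

theorem isCompact_segment (a b : E) : IsCompact (segment ℝ a b) := by
  rw [← convexHull_pair]
  exact (toFinite {a, b}).isCompact_convexHull ℝ

variable {F : E → EuclideanSpace ℝ (Fin 3)} {S : Set E} {a b c d : E}

theorem SweepsOnto.union_right {D B : Set E} (h : SweepsOnto F D B a c) (hF : ContinuousOn F S)
    (hinj : InjOn F S) (hD : D ⊆ S) {P s : Set E} (hs : IsCompact s) (hP : P ⊆ S) (hsS : s ⊆ S)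
    (meet : (P ∪ s) ∩ D ⊆ {a, c}) {R : Set (EuclideanSpace ℝ (Fin 3))} (hR : IsClosed R)
    (avoid : R ∩ F '' S ⊆ F '' P) :
    AmbientIsotopicRel R (F '' (B ∪ s)) (F '' (segment ℝ a c ∪ s)) := by
  rw [image_union, image_union F (segment ℝ a c)]
  refine ((h (R ∪ F '' s) (hR.union (hs.image_of_continuousOn (hF.mono hsS)).isClosed) ?_).union
    subset_union_right).mono subset_union_left
  have avoid_D : (R ∪ F '' s) ∩ F '' D ⊆ F '' (P ∪ s) := by
    rintro x ⟨hx | hx, hxD⟩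
    · exact image_mono subset_union_left (avoid ⟨hx, image_mono hD hxD⟩)
    · exact image_mono subset_union_right hx
  exact fun x hx => image_inter_image_subset hinj (union_subset hP hsS) hD meet
    ⟨avoid_D hx, hx.2⟩

namespace PushesAcross

theorem symm (h : PushesAcross F a b c) : PushesAcross F c b a := by
  intro R hR avoid
  rw [segment_symm ℝ c b, segment_symm ℝ b a, segment_symm ℝ c a, union_comm]
  refine h R hR ?_
  rwa [pair_comm b c, insert_comm a c, pair_comm a b, pair_comm a c]

theorem of_cut_leg (hF : ContinuousOn F (convexHull ℝ {a, b, c}))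
    (hinj : InjOn F (convexHull ℝ {a, b, c})) (hd : d ∈ segment ℝ a b)
    (meet : segment ℝ d a ∩ convexHull ℝ {d, b, c} ⊆ {d})
    (h : PushesAcross F d b c) (h' : PushesAcross F a d c) : PushesAcross F a b c := by
  have convex := convex_convexHull ℝ ({a, b, c} : Set E)
  have ha := left_mem_triangle a b c
  have hb := mid_mem_triangle a b c
  have hc := right_mem_triangle a b c
  have hd' := convex.segment_subset ha hb hd
  intro R hR avoid
  have push := h.union_right hF hinj (triangle_subset convex hd' hb hc) (isCompact_segment d a)
    (pair_subset ha hc) (convex.segment_subset hd' ha) (P := {a, c}) ?_ hR avoid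
  · rw [union_comm, ← union_assoc, segment_symm ℝ d a, ← segment_eq_union_of_mem hd,
      union_comm (segment ℝ d c)] at push
    exact push.trans (h' R hR ((inter_subset_inter_right R
      (image_mono (triangle_subset convex ha hd' hc))).trans avoid))
  · rintro x ⟨(rfl | rfl) | hx, hxT⟩
    · exact .inl (meet ⟨right_mem_segment ℝ _ _, hxT⟩)
    · exact .inr rfl
    · exact .inl (meet ⟨hx, hxT⟩)

theorem of_cut_base (hF : ContinuousOn F (convexHull ℝ {a, b, c}))
    (hinj : InjOn F (convexHull ℝ {a, b, c})) (hd : d ∈ segment ℝ a c)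
    (meet_da : segment ℝ d a ∩ convexHull ℝ {d, b, c} ⊆ {d})
    (meet_bc : segment ℝ b c ∩ convexHull ℝ {a, d, b} ⊆ {b})
    (h : PushesAcross F a d b) (h' : PushesAcross F d b c) : PushesAcross F a b c := by
  have convex := convex_convexHull ℝ ({a, b, c} : Set E)
  have ha := left_mem_triangle a b c
  have hb := mid_mem_triangle a b c
  have hc := right_mem_triangle a b c
  have hd' := convex.segment_subset ha hc hd
  intro R hR avoid
  have push_ab := h.union_right hF hinj (triangle_subset convex ha hd' hb) (isCompact_segment b c)
    (pair_subset ha hc) (convex.segment_subset hb hc) (P := {a, c}) ?_ hR avoid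
  · have push_ac := h'.union_right hF hinj (triangle_subset convex hd' hb hc)
      (isCompact_segment d a) (pair_subset ha hc) (convex.segment_subset hd' ha) (P := {a, c}) ?_
      hR avoid
    · rw [union_comm, ← union_assoc, union_comm (segment ℝ d c),
        segment_symm ℝ d a, ← segment_eq_union_of_mem hd] at push_ac
      exact push_ab.symm.trans push_ac
    · rintro x ⟨(rfl | rfl) | hx, hxT⟩
      · exact .inl (meet_da ⟨right_mem_segment ℝ _ _, hxT⟩)
      · exact .inr rfl
      · exact .inl (meet_da ⟨hx, hxT⟩)
  · rintro x ⟨(rfl | rfl) | hx, hxT⟩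
    · exact .inl rfl
    · exact .inr (meet_bc ⟨right_mem_segment ℝ _ _, hxT⟩)
    · exact .inr (meet_bc ⟨hx, hxT⟩)

end PushesAcross

theorem isUnknot_of_cut (hF : ContinuousOn F (convexHull ℝ {a, b, c}))
    (hinj : InjOn F (convexHull ℝ {a, b, c})) (hd : d ∈ segment ℝ a c)
    (meet_da : segment ℝ d a ∩ convexHull ℝ {b, c, d} ⊆ {d})
    (meet_ba : segment ℝ b a ∩ convexHull ℝ {b, c, d} ⊆ {b}) (h : PushesAcross F b c d)
    (unknot : IsUnknot (F '' (segment ℝ a b ∪ segment ℝ b d ∪ segment ℝ d a))) :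
    IsUnknot (F '' (segment ℝ a b ∪ segment ℝ b c ∪ segment ℝ c a)) := by
  have convex := convex_convexHull ℝ ({a, b, c} : Set E)
  have ha := left_mem_triangle a b c
  have hb := mid_mem_triangle a b c
  have hc := right_mem_triangle a b c
  have hd' := convex.segment_subset ha hc hd
  have push := h.union_right hF hinj (triangle_subset convex hb hc hd')
    ((isCompact_segment b a).union (isCompact_segment d a)) (empty_subset _)
    (union_subset (convex.segment_subset hb ha) (convex.segment_subset hd' ha)) ?_ isClosed_empty
    (by simp)
  · have source : segment ℝ b c ∪ segment ℝ c d ∪ (segment ℝ b a ∪ segment ℝ d a) =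
        segment ℝ a b ∪ segment ℝ b c ∪ segment ℝ c a := by
      rw [segment_symm] at hd
      rw [segment_symm ℝ b a, segment_eq_union_of_mem hd]
      ac_rfl
    have target : segment ℝ b d ∪ (segment ℝ b a ∪ segment ℝ d a) =
        segment ℝ a b ∪ segment ℝ b d ∪ segment ℝ d a := by
      rw [segment_symm ℝ b a]
      ac_rfl
    rw [source, target] at push
    exact (push.trans (.of_ambientIsotopic unknot)).ambientIsotopic
  · rintro x ⟨hx | hx | hx, hxT⟩
    · exact hx.elim
    · exact .inl (meet_ba ⟨hx, hxT⟩)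
    · exact .inr (meet_da ⟨hx, hxT⟩)

/-- The barycentre can be moved in every direction inside the triangle, so an affine map that is
injective on the triangle has no kernel in its plane. -/
theorem linearIndependent_image_triangle {E G : Type*} [AddCommGroup E] [Module ℝ E]
    [AddCommGroup G] [Module ℝ G] {a b c : E} (g : E →ᵃ[ℝ] G)
    (h : LinearIndependent ℝ ![b - a, c - a]) (hg : InjOn g (convexHull ℝ {a, b, c})) :
    LinearIndependent ℝ ![g b - g a, g c - g a] := by
  rw [LinearIndependent.pair_iff]
  intro p q relation
  have moved_mem : ∀ᶠ ε in 𝓝 (0 : ℝ),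
      0 < 1 / 3 - ε * p - ε * q ∧ 0 < 1 / 3 + ε * p ∧ 0 < 1 / 3 + ε * q := by
    refine .and ?_ (.and ?_ ?_) <;>
      exact (isOpen_lt continuous_const (by fun_prop)).mem_nhds (by norm_num)
  obtain ⟨ε, ⟨ha, hb, hc⟩, hε : 0 < ε⟩ :=
    ((moved_mem.filter_mono nhdsWithin_le_nhds).and (self_mem_nhdsWithin (s := Ioi 0))).exists
  let point (x y : ℝ) : E := (x • (b - a) + y • (c - a)) +ᵥ a
  have point_mem : ∀ {x y : ℝ}, 0 ≤ 1 - x - y → 0 ≤ x → 0 ≤ y →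
      point x y ∈ convexHull ℝ {a, b, c} := fun hxy hx hy =>
    mem_convexHull_triple.2 ⟨_, _, _, hxy, hx, hy, by ring, by
      simp only [point, vadd_eq_add]; module⟩
  have map_point : ∀ x y : ℝ, g (point x y) = x • (g b - g a) + y • (g c - g a) + g a := by
    intro x y
    rw [AffineMap.map_vadd, map_add, map_smul, map_smul, vadd_eq_add]
    simp only [← vsub_eq_sub, AffineMap.linearMap_vsub]
  have points_eq : point (1 / 3 + ε * p) (1 / 3 + ε * q) = point (1 / 3) (1 / 3) := by
    refine hg (point_mem (by linarith) hb.le hc.le)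
      (point_mem (by norm_num) (by norm_num) (by norm_num)) ?_
    rw [map_point, map_point]
    linear_combination (norm := module) ε • relation
  obtain ⟨hp, hq⟩ := eq_and_eq_of_smul_add_smul_eq h (vadd_right_cancel a points_eq)
  exact ⟨by simpa [hε.ne'] using hp, by simpa [hε.ne'] using hq⟩

theorem linearIndependent_of_eqOn {G : Type*} [AddCommGroup G] [Module ℝ G] {f : E → G}
    {g : E →ᵃ[ℝ] G} (hg : EqOn f g (convexHull ℝ {a, b, c}))
    (hinj : InjOn f (convexHull ℝ {a, b, c})) (h : LinearIndependent ℝ ![b - a, c - a]) :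
    LinearIndependent ℝ ![f b - f a, f c - f a] := by
  rw [hg (left_mem_triangle a b c), hg (mid_mem_triangle a b c), hg (right_mem_triangle a b c)]
  exact linearIndependent_image_triangle g h (hg.injOn_iff.1 hinj)

theorem image_segment_of_eqOn {G : Type*} [AddCommGroup G] [Module ℝ G] {f : E → G}
    {g : E →ᵃ[ℝ] G} {T : Set E} (hg : EqOn f g T) {p q : E} (h : segment ℝ p q ⊆ T) :
    f '' segment ℝ p q = segment ℝ (f p) (f q) := by
  rw [(hg.mono h).image_eq, image_segment, hg (h (left_mem_segment ℝ p q)),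
    hg (h (right_mem_segment ℝ p q))]

variable {g : E →ᵃ[ℝ] EuclideanSpace ℝ (Fin 3)}

theorem PushesAcross.of_affine (hg : EqOn F g (convexHull ℝ {a, b, c}))
    (hinj : InjOn F (convexHull ℝ {a, b, c})) (h : LinearIndependent ℝ ![b - a, c - a]) :
    PushesAcross F a b c := by
  intro R hR avoid
  rw [image_union, image_segment_of_eqOn hg (segment_subset_convexHull (by simp) (by simp)),
    image_segment_of_eqOn hg (segment_subset_convexHull (by simp) (by simp)),
    image_segment_of_eqOn hg (segment_subset_convexHull (by simp) (by simp))]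
  refine ambientIsotopicRel_triangle (linearIndependent_of_eqOn hg hinj h) hR ?_
  rw [hg.image_eq, AffineMap.image_convexHull] at avoid
  simpa [image_insert_eq, hg (left_mem_triangle a b c), hg (mid_mem_triangle a b c),
    hg (right_mem_triangle a b c)] using avoid

theorem isUnknot_of_affine (hg : EqOn F g (convexHull ℝ {a, b, c}))
    (hinj : InjOn F (convexHull ℝ {a, b, c})) (h : LinearIndependent ℝ ![b - a, c - a]) :
    IsUnknot (F '' (segment ℝ a b ∪ segment ℝ b c ∪ segment ℝ c a)) := by
  rw [image_union, image_union,
    image_segment_of_eqOn hg (segment_subset_convexHull (by simp) (by simp)),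
    image_segment_of_eqOn hg (segment_subset_convexHull (by simp) (by simp)),
    image_segment_of_eqOn hg (segment_subset_convexHull (by simp) (by simp))]
  exact isUnknot_triangle (linearIndependent_of_eqOn hg hinj h)

end Push

section Tame

/-- The image of the triangle `abc` can be swept from any corner to the opposite side, and its
boundary is an unknot. -/
structure IsTameTriangle {E : Type*} [AddCommGroup E] [Module ℝ E]
    (F : E → EuclideanSpace ℝ (Fin 3)) (a b c : E) : Prop where
  push_left : PushesAcross F c a b
  push_mid : PushesAcross F a b c
  push_right : PushesAcross F b c a
  unknot : IsUnknot (F '' (segment ℝ a b ∪ segment ℝ b c ∪ segment ℝ c a))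

theorem IsTameTriangle.rotate {E : Type*} [AddCommGroup E] [Module ℝ E]
    {F : E → EuclideanSpace ℝ (Fin 3)} {a b c : E} (h : IsTameTriangle F a b c) :
    IsTameTriangle F b c a :=
  ⟨h.push_mid, h.push_right, h.push_left, by rw [union_comm, ← union_assoc]; exact h.unknot⟩

theorem segment_inter_subset_of_inter_subset_segment {E : Type*} [AddCommGroup E] [Module ℝ E]
    {p q r : E} {T T' : Set E} (h : LinearIndependent ℝ ![q - p, r - p])
    (inter : T ∩ T' ⊆ segment ℝ p r) (hpq : segment ℝ p q ⊆ T) : segment ℝ p q ∩ T' ⊆ {p} :=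
  fun _ hx => (segment_inter_eq_endpoint_of_linearIndependent_sub ℝ h).subset
    ⟨hx.1, inter ⟨hpq hx.1, hx.2⟩⟩

variable {E : Type*} [NormedAddCommGroup E] [NormedSpace ℝ E]
  {F : E → EuclideanSpace ℝ (Fin 3)} {S : Set E} {a b c : E}

theorem IsTameTriangle.of_cut (hF : ContinuousOn F (convexHull ℝ {a, b, c}))
    (hinj : InjOn F (convexHull ℝ {a, b, c})) (h : LinearIndependent ℝ ![b - a, c - a]) {t : ℝ}
    (h0 : 0 < t) (h1 : t < 1) (hT : IsTameTriangle F a b (AffineMap.lineMap a c t))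
    (hT' : IsTameTriangle F (AffineMap.lineMap a c t) b c) : IsTameTriangle F a b c := by
  have cut := convexHull_inter_of_cut h h0 h1
  have left := linearIndependent_triangle_left h h0.ne'
  have right := linearIndependent_triangle_right h h1.ne
  have hd := lineMap_mem_segment ℝ a c ⟨h0.le, h1.le⟩
  generalize AffineMap.lineMap a c t = d at *
  have cut_symm : convexHull ℝ {d, b, c} ∩ convexHull ℝ {a, b, d} ⊆ segment ℝ b d := by
    rwa [inter_comm]
  have meet_da : segment ℝ d a ∩ convexHull ℝ {d, b, c} ⊆ {d} :=
    segment_inter_subset_of_inter_subset_segment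
      (linearIndependent_triangle_rotate (linearIndependent_triangle_rotate left))
      (segment_symm ℝ b d ▸ cut) (segment_subset_convexHull (by simp) (by simp))
  have meet_ba : segment ℝ b a ∩ convexHull ℝ {d, b, c} ⊆ {b} :=
    segment_inter_subset_of_inter_subset_segment
      (linearIndependent_triangle_rotate (linearIndependent_triangle_swap left)) cut
      (segment_subset_convexHull (by simp) (by simp))
  have meet_bc : segment ℝ b c ∩ convexHull ℝ {a, b, d} ⊆ {b} :=
    segment_inter_subset_of_inter_subset_segment (linearIndependent_triangle_rotate right) cut_symm
      (segment_subset_convexHull (by simp) (by simp))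
  have meet_dc : segment ℝ d c ∩ convexHull ℝ {a, b, d} ⊆ {d} :=
    segment_inter_subset_of_inter_subset_segment
      (linearIndependent_triangle_swap (linearIndependent_triangle_rotate right))
      (segment_symm ℝ b d ▸ cut_symm) (segment_subset_convexHull (by simp) (by simp))
  have rotate := insert_insert_singleton_rotate (α := E)
  refine ⟨?_, ?_, ?_, ?_⟩
  · rw [rotate c a b] at hF hinj
    exact .of_cut_leg hF hinj (by rwa [segment_symm]) (by rwa [← rotate d a b])
      hT.push_left hT'.push_left
  · exact .of_cut_base hF hinj hd meet_da (by rwa [pair_comm d b]) hT.push_right.symm hT'.push_mid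
  · rw [pair_comm b c] at hF hinj
    exact (PushesAcross.of_cut_leg hF hinj hd (by rwa [pair_comm c b])
      hT'.push_right.symm hT.push_right.symm).symm
  · exact isUnknot_of_cut hF hinj hd (by rwa [rotate]) (by rwa [rotate]) hT'.push_right hT.unknot

theorem IsTameTriangle.of_affine {g : E →ᵃ[ℝ] EuclideanSpace ℝ (Fin 3)}
    (hg : EqOn F g (convexHull ℝ {a, b, c})) (hinj : InjOn F (convexHull ℝ {a, b, c}))
    (h : LinearIndependent ℝ ![b - a, c - a]) : IsTameTriangle F a b c := by
  have rotate := insert_insert_singleton_rotate (α := E)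
  have h_rotate := linearIndependent_triangle_rotate h
  refine ⟨?_, .of_affine hg hinj h, ?_, isUnknot_of_affine hg hinj h⟩
  · rw [rotate c a b] at hg hinj
    exact .of_affine hg hinj (linearIndependent_triangle_rotate h_rotate)
  · rw [← rotate a b c] at hg hinj
    exact .of_affine hg hinj h_rotate

/-- The functional `l` does not change sign on the triangle `abc`. -/
def IsUncut {E : Type*} [AddCommGroup E] [Module ℝ E] (l : E →ᵃ[ℝ] ℝ) (a b c : E) : Prop :=
  (0 ≤ l a ∧ 0 ≤ l b ∧ 0 ≤ l c) ∨ (l a ≤ 0 ∧ l b ≤ 0 ∧ l c ≤ 0)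

section Cutting

variable {E : Type*} [AddCommGroup E] [Module ℝ E] {l : E →ᵃ[ℝ] ℝ} {a b c : E}

theorem IsUncut.rotate (h : IsUncut l a b c) : IsUncut l b c a := by
  unfold IsUncut at *
  tauto

theorem IsUncut.cut (h : IsUncut l a b c) {t : ℝ} (h0 : 0 < t) (h1 : t < 1) :
    IsUncut l a b (AffineMap.lineMap a c t) ∧ IsUncut l (AffineMap.lineMap a c t) b c := by
  have hl := l.apply_lineMap a c t
  have ht : t ∈ Icc (0 : ℝ) 1 := ⟨h0.le, h1.le⟩
  rcases h with ⟨ha, hb, hc⟩ | ⟨ha, hb, hc⟩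
  · have hd : l (AffineMap.lineMap a c t) ∈ Ici 0 := by
      rw [hl]; exact (convex_Ici 0).lineMap_mem ha hc ht
    exact ⟨.inl ⟨ha, hb, hd⟩, .inl ⟨hd, hb, hc⟩⟩
  · have hd : l (AffineMap.lineMap a c t) ∈ Iic 0 := by
      rw [hl]; exact (convex_Iic 0).lineMap_mem ha hc ht
    exact ⟨.inr ⟨ha, hb, hd⟩, .inr ⟨hd, hb, hc⟩⟩

theorem exists_lineMap_eq_zero (h : l a * l c < 0) :
    ∃ t : ℝ, 0 < t ∧ t < 1 ∧ l (AffineMap.lineMap a c t) = 0 := by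
  have hne : l a - l c ≠ 0 := fun h0 => by
    rw [sub_eq_zero.1 h0] at h
    exact (mul_self_nonneg _).not_gt h
  refine ⟨l a / (l a - l c), ?_, ?_, ?_⟩
  · rcases mul_neg_iff.1 h with ⟨ha, hc⟩ | ⟨ha, hc⟩
    · exact div_pos ha (by linarith)
    · exact div_pos_of_neg_of_neg ha (by linarith)
  · rcases mul_neg_iff.1 h with ⟨ha, hc⟩ | ⟨ha, hc⟩
    · rw [div_lt_one (by linarith)]; linarith
    · rw [div_lt_one_of_neg (by linarith)]; linarith
  · rw [AffineMap.apply_lineMap, AffineMap.lineMap_apply_module]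
    simp only [smul_eq_mul]
    field_simp
    ring

theorem isUncut_or_mul_neg (l : E →ᵃ[ℝ] ℝ) (a b c : E) :
    IsUncut l a b c ∨ l a * l c < 0 ∨ l b * l a < 0 ∨ l c * l b < 0 := by
  by_contra! h
  obtain ⟨cut, hac, hba, hcb⟩ := h
  rcases lt_trichotomy (l a) 0 with ha | ha | ha
  · exact cut (.inr ⟨ha.le, nonpos_of_mul_nonneg_left hba ha, nonpos_of_mul_nonneg_right hac ha⟩)
  · rcases mul_nonneg_iff.1 hcb with ⟨hc, hb⟩ | ⟨hc, hb⟩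
    · exact cut (.inl ⟨ha.ge, hb, hc⟩)
    · exact cut (.inr ⟨ha.le, hb, hc⟩)
  · exact cut (.inl ⟨ha.le, nonneg_of_mul_nonneg_left hba ha, nonneg_of_mul_nonneg_right hac ha⟩)

/-- Cutting along the zero line of `l` first produces triangles with a corner on this line, and
cutting these once more from that corner produces triangles that the line does not cross. -/
theorem triangle_induction {P : E → E → E → Prop} (l : E →ᵃ[ℝ] ℝ)
    (rotate : ∀ ⦃a b c⦄, P a b c → P b c a)
    (cut : ∀ ⦃a b c⦄ ⦃t : ℝ⦄, 0 < t → t < 1 → P a b (AffineMap.lineMap a c t) →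
      P (AffineMap.lineMap a c t) b c → P a b c)
    (uncut : ∀ ⦃a b c⦄, IsUncut l a b c → P a b c) (a b c : E) : P a b c := by
  have of_mid : ∀ {a b c}, l b = 0 → P a b c := by
    intro a b c hb
    by_cases hac : l a * l c < 0
    · obtain ⟨t, h0, h1, hd⟩ := exists_lineMap_eq_zero hac
      refine cut h0 h1 (uncut ?_) (uncut ?_)
      · rcases le_total 0 (l a) with h | h <;> simp [IsUncut, hb, hd, h]
      · rcases le_total 0 (l c) with h | h <;> simp [IsUncut, hb, hd, h]
    · rcases mul_nonneg_iff.1 (not_lt.1 hac) with ⟨ha, hc⟩ | ⟨ha, hc⟩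
      · exact uncut (.inl ⟨ha, hb.ge, hc⟩)
      · exact uncut (.inr ⟨ha, hb.le, hc⟩)
  have of_mul_neg : ∀ {a b c}, l a * l c < 0 → P a b c := by
    intro a b c hac
    obtain ⟨t, h0, h1, hd⟩ := exists_lineMap_eq_zero hac
    exact cut h0 h1 (rotate (rotate (of_mid hd))) (rotate (of_mid hd))
  rcases isUncut_or_mul_neg l a b c with h | h | h | h
  · exact uncut h
  · exact of_mul_neg h
  · exact rotate (rotate (of_mul_neg h))
  · exact rotate (of_mul_neg h)

end Cutting

theorem isTameTriangle_of_forall_isUncut (hF : ContinuousOn F S) (hinj : InjOn F S)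
    (L : List (E →ᵃ[ℝ] ℝ))
    (uncut : ∀ a b c : E, LinearIndependent ℝ ![b - a, c - a] → convexHull ℝ {a, b, c} ⊆ S →
      (∀ l ∈ L, IsUncut l a b c) → IsTameTriangle F a b c) :
    ∀ a b c : E, LinearIndependent ℝ ![b - a, c - a] → convexHull ℝ {a, b, c} ⊆ S →
      IsTameTriangle F a b c := by
  induction L with
  | nil => exact fun a b c h hS => uncut a b c h hS (by simp)
  | cons l L ih =>
    refine ih fun a b c => triangle_induction l
      (P := fun a b c => LinearIndependent ℝ ![b - a, c - a] → convexHull ℝ {a, b, c} ⊆ S →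
        (∀ k ∈ L, IsUncut k a b c) → IsTameTriangle F a b c) ?_ ?_ ?_ a b c
    · intro a b c hP h hS hL
      rw [insert_insert_singleton_rotate] at hS
      exact (hP (linearIndependent_triangle_rotate (linearIndependent_triangle_rotate h)) hS
        fun k hk => (hL k hk).rotate.rotate).rotate
    · intro a b c t h0 h1 hP hP' h hS hL
      have convex := convex_convexHull ℝ ({a, b, c} : Set E)
      have hd := convex.lineMap_mem (left_mem_triangle a b c) (right_mem_triangle a b c)
        ⟨h0.le, h1.le⟩
      exact .of_cut (hF.mono hS) (hinj.mono hS) h h0 h1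
        (hP (linearIndependent_triangle_left h h0.ne')
          ((triangle_subset convex (left_mem_triangle a b c) (mid_mem_triangle a b c) hd).trans hS)
          fun k hk => ((hL k hk).cut h0 h1).1)
        (hP' (linearIndependent_triangle_right h h1.ne)
          ((triangle_subset convex hd (mid_mem_triangle a b c) (right_mem_triangle a b c)).trans hS)
          fun k hk => ((hL k hk).cut h0 h1).2)
    · exact fun a b c hl h hS hL => uncut a b c h hS (List.forall_mem_cons.2 ⟨hl, hL⟩)

theorem IsPLOn.isTameTriangle [FiniteDimensional ℝ E] (hF : IsPLOn F S) (hinj : InjOn F S)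
    (h : LinearIndependent ℝ ![b - a, c - a]) (hS : convexHull ℝ {a, b, c} ⊆ S) :
    IsTameTriangle F a b c := by
  obtain ⟨L, affine_of_uncut⟩ := hF.exists_functionals
  refine isTameTriangle_of_forall_isUncut hF.continuousOn hinj L (fun a b c h hS hL => ?_)
    a b c h hS
  obtain ⟨g, hg⟩ := affine_of_uncut a b c hS hL
  exact .of_affine hg (hinj.mono hS) h

end Tame

section Arc

variable {E : Type*} [NormedAddCommGroup E] [NormedSpace ℝ E]

/-- `S` is an embedded polygonal arc from `a` to `b` with set of vertices `V`. -/
inductive PolyArc : E → E → Set E → Set E → Prop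
  | edge {a b : E} (h : a ≠ b) : PolyArc a b {a, b} (segment ℝ a b)
  | concat {a b c : E} {V W S T : Set E} (h : PolyArc a b V S) (h' : PolyArc b c W T)
      (hST : S ∩ T ⊆ {b}) : PolyArc a c (V ∪ W) (S ∪ T)

namespace PolyArc

variable {a b c : E} {V S : Set E}

theorem finite (h : PolyArc a b V S) : V.Finite := by
  induction h with
  | edge _ => exact toFinite _
  | concat _ _ _ ih ih' => exact ih.union ih'

theorem ends_mem (h : PolyArc a b V S) : a ∈ V ∧ b ∈ V := by
  induction h with
  | edge _ => simp
  | concat _ _ _ ih ih' => exact ⟨.inl ih.1, .inr ih'.2⟩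

theorem vertices_subset (h : PolyArc a b V S) : V ⊆ S := by
  induction h with
  | edge _ => exact pair_subset (left_mem_segment _ _ _) (right_mem_segment _ _ _)
  | concat _ _ _ ih ih' => exact union_subset_union ih ih'

theorem left_mem (h : PolyArc a b V S) : a ∈ S := h.vertices_subset h.ends_mem.1

theorem right_mem (h : PolyArc a b V S) : b ∈ S := h.vertices_subset h.ends_mem.2

theorem ne (h : PolyArc a b V S) : a ≠ b := by
  induction h with
  | edge h => exact h
  | concat h h' hST ih ih' =>
    rintro rfl
    exact ih (hST ⟨h.left_mem, h'.right_mem⟩)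

theorem isCompact (h : PolyArc a b V S) : IsCompact S := by
  induction h with
  | edge _ => exact isCompact_segment _ _
  | concat _ _ _ ih ih' => exact ih.union ih'

theorem isPreconnected (h : PolyArc a b V S) : IsPreconnected S := by
  induction h with
  | edge _ => exact (convex_segment _ _).isPreconnected
  | concat h h' _ ih ih' => exact ih.union _ h.right_mem h'.left_mem ih'

theorem symm (h : PolyArc a b V S) : PolyArc b a V S := by
  induction h with
  | edge h =>
    rw [pair_comm, segment_symm]
    exact .edge h.symm
  | @concat a m c V W S T h h' hST ih ih' =>
    rw [union_comm V, union_comm S]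
    exact .concat ih' ih (by rwa [inter_comm])

theorem split (h : PolyArc a b V S) {w : E} (hw : w ∈ V) (hwa : w ≠ a) (hwb : w ≠ b) :
    ∃ V₁ V₂ S₁ S₂, PolyArc a w V₁ S₁ ∧ PolyArc w b V₂ S₂ ∧ S₁ ∩ S₂ ⊆ {w} ∧ V = V₁ ∪ V₂ ∧
      S = S₁ ∪ S₂ := by
  induction h with
  | edge h => rcases hw with rfl | rfl <;> contradiction
  | @concat a m c V W S T h h' hST ih ih' =>
    by_cases hwm : w = m
    · subst hwm
      exact ⟨V, W, S, T, h, h', hST, rfl, rfl⟩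
    rcases hw with hw | hw
    · obtain ⟨V₁, V₂, S₁, S₂, h₁, h₂, meet, rfl, rfl⟩ := ih hw hwa hwm
      refine ⟨V₁, V₂ ∪ W, S₁, S₂ ∪ T, h₁, h₂.concat h' fun x hx => hST ⟨.inr hx.1, hx.2⟩, ?_,
        union_assoc _ _ _, union_assoc _ _ _⟩
      rintro x ⟨hx₁, hx₂ | hxT⟩
      · exact meet ⟨hx₁, hx₂⟩
      · obtain rfl := hST ⟨.inl hx₁, hxT⟩
        exact meet ⟨hx₁, h₂.right_mem⟩
    · obtain ⟨V₁, V₂, S₁, S₂, h₁, h₂, meet, rfl, rfl⟩ := ih' hw hwm hwb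
      refine ⟨V ∪ V₁, V₂, S ∪ S₁, S₂, h.concat h₁ fun x hx => hST ⟨hx.1, .inl hx.2⟩, h₂, ?_,
        (union_assoc _ _ _).symm, (union_assoc _ _ _).symm⟩
      rintro x ⟨hxS | hx₁, hx₂⟩
      · obtain rfl := hST ⟨hxS, .inr hx₂⟩
        exact meet ⟨h₁.left_mem, hx₂⟩
      · exact meet ⟨hx₁, hx₂⟩

theorem eq_edge_or_exists_first_edge (h : PolyArc a b V S) :
    (V = {a, b} ∧ S = segment ℝ a b) ∨ ∃ p V' S', a ≠ p ∧ PolyArc p b V' S' ∧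
      segment ℝ a p ∩ S' ⊆ {p} ∧ V = insert a V' ∧ S = segment ℝ a p ∪ S' := by
  induction h with
  | edge _ => exact .inl ⟨rfl, rfl⟩
  | @concat a m c V W S T h h' hST ih ih' =>
    right
    rcases ih with ⟨rfl, rfl⟩ | ⟨p, V', S', hne, hp, meet, rfl, rfl⟩
    · refine ⟨m, W, T, h.ne, h', hST, ?_, rfl⟩
      rw [insert_union, singleton_union, insert_eq_of_mem h'.ends_mem.1]
    · refine ⟨p, V' ∪ W, S' ∪ T, hne, hp.concat h' fun x hx => hST ⟨.inr hx.1, hx.2⟩, ?_,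
        insert_union, union_assoc _ _ _⟩
      rintro x ⟨hx, hx' | hxT⟩
      · exact meet ⟨hx, hx'⟩
      · obtain rfl := hST ⟨.inl hx, hxT⟩
        exact meet ⟨hx, hp.right_mem⟩

theorem exists_edge_of_mem (h : PolyArc a b V S) {x : E} (hx : x ∈ S) (hxV : x ∉ V) :
    ∃ p ∈ V, ∃ q ∈ V, x ∈ openSegment ℝ p q ∧ segment ℝ p q ⊆ S ∧
      Disjoint (openSegment ℝ p q) V := by
  induction h with
  | @edge a b h =>
    refine ⟨a, by simp, b, by simp, mem_openSegment_of_ne_left_right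
      (fun e => hxV (by simp [e])) (fun e => hxV (by simp [e])) hx, Subset.rfl, ?_⟩
    rw [disjoint_right]
    rintro y (rfl | rfl) hy
    · exact h (left_mem_openSegment_iff.1 hy)
    · exact h (right_mem_openSegment_iff.1 hy)
  | @concat a m c V W S T h h' hST ih ih' =>
    rw [mem_union, not_or] at hxV
    rcases hx with hx | hx
    · obtain ⟨p, hp, q, hq, hxpq, subset, disjoint⟩ := ih hx hxV.1
      refine ⟨p, .inl hp, q, .inl hq, hxpq, subset.trans subset_union_left,
        disjoint.union_right (disjoint_left.2 fun y hy hyW => ?_)⟩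
      obtain rfl : y = m := hST ⟨subset (openSegment_subset_segment _ _ _ hy),
        h'.vertices_subset hyW⟩
      exact disjoint_left.1 disjoint hy h.ends_mem.2
    · obtain ⟨p, hp, q, hq, hxpq, subset, disjoint⟩ := ih' hx hxV.2
      refine ⟨p, .inr hp, q, .inr hq, hxpq, subset.trans subset_union_right,
        (disjoint_left.2 fun y hy hyV => ?_).union_right disjoint⟩
      obtain rfl : y = m := hST ⟨h.vertices_subset hyV,
        subset (openSegment_subset_segment _ _ _ hy)⟩
      exact disjoint_left.1 disjoint hy h'.ends_mem.1

theorem isPreconnected_diff (h : PolyArc a b V S) : IsPreconnected (S \ {a}) ∧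
    IsPreconnected (S \ {b}) ∧ IsPreconnected (S \ {a, b}) := by
  induction h with
  | @edge a b h =>
    have image {I : Set ℝ} (hI : IsPreconnected I) :
        IsPreconnected (AffineMap.lineMap a b '' I) :=
      hI.image _ (AffineMap.lineMap_continuous (R := ℝ)).continuousOn
    have ha : ({a} : Set E) = AffineMap.lineMap a b '' ({0} : Set ℝ) := by simp
    have hb : ({b} : Set E) = AffineMap.lineMap a b '' ({1} : Set ℝ) := by simp
    have hab : ({a, b} : Set E) = AffineMap.lineMap a b '' ({0, 1} : Set ℝ) := by
      simp [image_insert_eq]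
    have injective := AffineMap.lineMap_injective ℝ h
    rw [segment_eq_image_lineMap, hab, ha, hb, ← image_sdiff injective, ← image_sdiff injective,
      ← image_sdiff injective, Icc_sdiff_left, Icc_sdiff_right, Icc_sdiff_both]
    exact ⟨image isPreconnected_Ioc, image isPreconnected_Ico, image isPreconnected_Ioo⟩
  | @concat a m c V W S T h h' hST ih ih' =>
    have ha : a ∉ T := fun hT => h.ne (hST ⟨h.left_mem, hT⟩)
    have hc : c ∉ S := fun hS => h'.ne (hST ⟨hS, h'.right_mem⟩).symm
    have hma : m ∈ S \ {a} := ⟨h.right_mem, h.ne.symm⟩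
    have hmc : m ∈ T \ {c} := ⟨h'.left_mem, h'.ne⟩
    have diff_left : (S ∪ T) \ {a} = (S \ {a}) ∪ T := by
      rw [union_sdiff_distrib, sdiff_singleton_eq_self ha]
    have diff_right : (S ∪ T) \ {c} = S ∪ (T \ {c}) := by
      rw [union_sdiff_distrib, sdiff_singleton_eq_self hc]
    have diff_both : (S ∪ T) \ {a, c} = (S \ {a}) ∪ (T \ {c}) := by
      rw [insert_eq, ← sdiff_sdiff, diff_left, union_sdiff_distrib, sdiff_sdiff_comm,
        sdiff_singleton_eq_self hc]
    rw [diff_left, diff_right, diff_both]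
    exact ⟨ih.1.union m hma h'.left_mem h'.isPreconnected,
      h.isPreconnected.union m h.right_mem hmc ih'.2.1, ih.1.union m hma hmc ih'.2.1⟩

theorem vertices_eq_pair (h : PolyArc a b V S) (subset : segment ℝ a b ⊆ S)
    (disjoint : Disjoint (openSegment ℝ a b) V) : V = {a, b} := by
  cases h with
  | edge h => rfl
  | @concat _ m _ V W S T h h' hST =>
    exfalso
    obtain ⟨x, hx, hxST⟩ := isPreconnected_closed_iff.1
      (convex_segment (𝕜 := ℝ) a b).isPreconnected S T h.isCompact.isClosed h'.isCompact.isClosed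
      subset ⟨a, left_mem_segment _ _ _, h.left_mem⟩ ⟨b, right_mem_segment _ _ _, h'.right_mem⟩
    obtain rfl := hST hxST
    exact disjoint_left.1 disjoint (mem_openSegment_of_ne_left_right h.ne h'.ne.symm hx)
      (.inl h.ends_mem.2)

end PolyArc

/-- `P` is a simple closed polygon with set of vertices `V`. -/
def PolyLoop (V P : Set E) : Prop :=
  ∃ a b V₁ V₂ S₁ S₂, PolyArc a b V₁ S₁ ∧ PolyArc a b V₂ S₂ ∧ S₁ ∩ S₂ ⊆ {a, b} ∧
    V = V₁ ∪ V₂ ∧ P = S₁ ∪ S₂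

namespace PolyLoop

variable {V P : Set E} {v : E}

theorem finite (h : PolyLoop V P) : V.Finite := by
  obtain ⟨a, b, V₁, V₂, S₁, S₂, h₁, h₂, -, rfl, -⟩ := h
  exact h₁.finite.union h₂.finite

theorem nonempty (h : PolyLoop V P) : V.Nonempty := by
  obtain ⟨a, b, V₁, V₂, S₁, S₂, h₁, -, -, rfl, -⟩ := h
  exact ⟨a, .inl h₁.ends_mem.1⟩

theorem vertices_subset (h : PolyLoop V P) : V ⊆ P := by
  obtain ⟨a, b, V₁, V₂, S₁, S₂, h₁, h₂, -, rfl, rfl⟩ := h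
  exact union_subset_union h₁.vertices_subset h₂.vertices_subset

theorem exists_arcs_of_mem (h : PolyLoop V P) (hv : v ∈ V) :
    ∃ b V₁ V₂ S₁ S₂, PolyArc v b V₁ S₁ ∧ PolyArc v b V₂ S₂ ∧ S₁ ∩ S₂ ⊆ {v, b} ∧
      V = V₁ ∪ V₂ ∧ P = S₁ ∪ S₂ := by
  obtain ⟨a, b, V₁, V₂, S₁, S₂, h₁, h₂, meet, rfl, rfl⟩ := h
  wlog hv₁ : v ∈ V₁ generalizing V₁ V₂ S₁ S₂
  · rw [union_comm V₁, union_comm S₁]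
    exact this V₂ V₁ S₂ S₁ h₂ h₁ (by rwa [inter_comm]) hv.symm (hv.resolve_left hv₁)
  rcases eq_or_ne v a with rfl | ha
  · exact ⟨b, V₁, V₂, S₁, S₂, h₁, h₂, meet, rfl, rfl⟩
  rcases eq_or_ne v b with rfl | hb
  · exact ⟨a, V₁, V₂, S₁, S₂, h₁.symm, h₂.symm, by rwa [pair_comm], rfl, rfl⟩
  obtain ⟨V₃, V₄, S₃, S₄, h₃, h₄, meet', rfl, rfl⟩ := h₁.split hv₁ ha hb
  refine ⟨a, V₃, V₄ ∪ V₂, S₃, S₄ ∪ S₂, h₃.symm, h₄.concat h₂.symm ?_, ?_, union_assoc _ _ _,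
    union_assoc _ _ _⟩
  · rintro x ⟨hx₄, hx₂⟩
    rcases meet ⟨.inr hx₄, hx₂⟩ with rfl | rfl
    · exact absurd (meet' ⟨h₃.left_mem, hx₄⟩).symm ha
    · rfl
  · rintro x ⟨hx₃, hx₄ | hx₂⟩
    · exact .inl (meet' ⟨hx₃, hx₄⟩)
    · rcases meet ⟨.inl hx₃, hx₂⟩ with rfl | rfl
      · exact .inr rfl
      · exact absurd (meet' ⟨hx₃, h₄.right_mem⟩).symm hb

theorem exists_edge_of_mem (h : PolyLoop V P) (hv : v ∈ V) :
    ∃ p S, v ≠ p ∧ PolyArc v p V S ∧ segment ℝ v p ∩ S ⊆ {v, p} ∧ P = segment ℝ v p ∪ S := by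
  obtain ⟨b, V₁, V₂, S₁, S₂, h₁, h₂, meet, rfl, rfl⟩ := h.exists_arcs_of_mem hv
  rcases h₁.eq_edge_or_exists_first_edge with
    ⟨rfl, rfl⟩ | ⟨p, V₃, S₃, hvp, h₃, meet_edge, rfl, rfl⟩
  · refine ⟨b, S₂, h₂.ne, ?_, meet, rfl⟩
    rwa [union_eq_self_of_subset_left (pair_subset h₂.ends_mem.1 h₂.ends_mem.2)]
  · have hv₃ : v ∉ S₃ := fun hv₃ => hvp (meet_edge ⟨left_mem_segment ℝ v p, hv₃⟩)
    have rest : PolyArc p v (V₃ ∪ V₂) (S₃ ∪ S₂) := by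
      refine h₃.concat h₂.symm ?_
      rintro x ⟨hx₃, hx₂⟩
      rcases meet ⟨.inr hx₃, hx₂⟩ with rfl | rfl
      · exact absurd hx₃ hv₃
      · rfl
    refine ⟨p, S₃ ∪ S₂, hvp, ?_, ?_, union_assoc _ _ _⟩
    · rw [insert_union, insert_eq_of_mem rest.ends_mem.2]
      exact rest.symm
    · rintro x ⟨hx, hx₃ | hx₂⟩
      · exact .inr (meet_edge ⟨hx, hx₃⟩)
      · rcases meet ⟨.inl hx, hx₂⟩ with rfl | rfl
        · exact .inl rfl
        · exact .inr (meet_edge ⟨hx, h₃.right_mem⟩)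

theorem exists_neighbors (h : PolyLoop V P) (hv : v ∈ V) :
    ∃ p q V' S', v ≠ p ∧ v ≠ q ∧ PolyArc p q V' S' ∧ segment ℝ v p ∩ segment ℝ v q ⊆ {v} ∧
      segment ℝ v p ∩ S' ⊆ {p} ∧ segment ℝ v q ∩ S' ⊆ {q} ∧ V = insert v V' ∧
      P = segment ℝ v p ∪ segment ℝ v q ∪ S' := by
  obtain ⟨q, S, hvq, arc, meet, rfl⟩ := h.exists_edge_of_mem hv
  rcases arc.eq_edge_or_exists_first_edge with
    ⟨rfl, rfl⟩ | ⟨p, V', S', hvp, arc', meet_edge, rfl, rfl⟩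
  · rcases meet ⟨midpoint_mem_segment v q, midpoint_mem_segment v q⟩ with e | e
    · exact absurd ((midpoint_eq_left_iff ℝ).1 e) hvq
    · exact absurd ((midpoint_eq_right_iff ℝ).1 e) hvq
  · refine ⟨p, q, V', S', hvp, hvq, arc', ?_, meet_edge, ?_, rfl, ?_⟩
    · rintro x ⟨hxp, hxq⟩
      rcases meet ⟨hxq, .inl hxp⟩ with rfl | rfl
      · rfl
      · exact absurd (meet_edge ⟨hxp, arc'.right_mem⟩).symm arc'.ne
    · rintro x ⟨hxq, hx'⟩
      rcases meet ⟨hxq, .inr hx'⟩ with rfl | rfl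
      · exact absurd (meet_edge ⟨left_mem_segment ℝ x p, hx'⟩) hvp
      · rfl
    · rw [← union_assoc, union_comm (segment ℝ v q)]

end PolyLoop

end Arc

section Region

variable {E : Type*} [NormedAddCommGroup E] [NormedSpace ℝ E]

/-- A nonzero linear functional has no local maximum in the open set `K \ C`. -/
theorem subset_of_isOpen_diff {K C : Set E} (hK : IsCompact K) (hC : IsClosed C)
    (hconv : Convex ℝ C) (hne : C.Nonempty) (hopen : IsOpen (K \ C)) : K ⊆ C := by
  intro x hx
  by_contra hxC
  obtain ⟨f, r, hfC, hfx⟩ := geometric_hahn_banach_closed_point hconv hC hxC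
  obtain ⟨y, hy, hmax⟩ := hK.exists_isMaxOn ⟨x, hx⟩ f.continuous.continuousOn
  have hyC : y ∉ C := fun h => (hfC y h).not_gt (hfx.trans_le (hmax hx))
  have local_max : IsLocalMax f y := by
    filter_upwards [hopen.mem_nhds ⟨hy, hyC⟩] with z hz using hmax hz.1
  have f_eq_zero : f = 0 := local_max.hasFDerivAt_eq_zero f.hasFDerivAt
  obtain ⟨c, hc⟩ := hne
  simpa [f_eq_zero] using (hfC c hc).trans hfx

theorem interior_segment_eq_empty [FiniteDimensional ℝ E] (hE : 1 < Module.finrank ℝ E) (a b : E) :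
    interior (segment ℝ a b) = ∅ := by
  rw [← convexHull_pair, ← not_nonempty_iff_eq_empty,
    interior_convexHull_nonempty_iff_affineSpan_eq_top]
  intro span_eq_top
  have finrank_le := collinear_iff_finrank_le_one.1 (collinear_pair ℝ a b)
  rw [← direction_affineSpan, span_eq_top, AffineSubspace.direction_top, finrank_top] at finrank_le
  exact hE.not_ge finrank_le

/-- The two half-spaces must be opposite, as otherwise they overlap in an open set. -/
theorem union_mem_nhds_of_halfspaces {D₁ D₂ : Set E} {x : E} {n₁ n₂ : E →L[ℝ] ℝ}
    (h₁ : ∀ᶠ y in 𝓝 x, n₁ x ≤ n₁ y → y ∈ D₁) (h₂ : ∀ᶠ y in 𝓝 x, n₂ x ≤ n₂ y → y ∈ D₂)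
    (hD : interior (D₁ ∩ D₂) = ∅) : D₁ ∪ D₂ ∈ 𝓝 x := by
  have no_overlap : ∀ᶠ y in 𝓝 x, ¬ (n₁ x < n₁ y ∧ n₂ x < n₂ y) := by
    filter_upwards [(h₁.and h₂).eventually_nhds] with y hy ⟨hy₁, hy₂⟩
    refine notMem_empty y (hD ▸ mem_interior_iff_mem_nhds.2 ?_)
    filter_upwards [hy, (isOpen_lt continuous_const n₁.continuous).mem_nhds hy₁,
      (isOpen_lt continuous_const n₂.continuous).mem_nhds hy₂] with z hz hz₁ hz₂
    exact ⟨hz.1 (le_of_lt hz₁), hz.2 (le_of_lt hz₂)⟩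
  have reflect : Tendsto (fun y => x + x - y) (𝓝 x) (𝓝 x) := by
    have continuous : Continuous fun y => x + x - y := by fun_prop
    simpa using continuous.tendsto x
  filter_upwards [h₁, h₂, reflect.eventually no_overlap] with y hy₁ hy₂ not_both
  by_contra hy
  rw [mem_union, not_or] at hy
  have lt₁ := not_le.1 (mt hy₁ hy.1)
  have lt₂ := not_le.1 (mt hy₂ hy.2)
  refine not_both ⟨?_, ?_⟩ <;> rw [map_sub, map_add] <;> linarith

theorem isOpen_union_diff {X : Type*} [TopologicalSpace X] {A₁ A₂ C D₁ D₂ : Set X}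
    (h₁ : IsOpen (D₁ \ (A₁ ∪ C))) (h₂ : IsOpen (D₂ \ (A₂ ∪ C))) (hA : IsClosed (A₁ ∪ A₂))
    (nhds : ∀ x ∈ C, x ∉ A₁ ∪ A₂ → D₁ ∪ D₂ ∈ 𝓝 x) : IsOpen ((D₁ ∪ D₂) \ (A₁ ∪ A₂)) := by
  rw [isOpen_iff_mem_nhds]
  rintro x ⟨hxD, hxA⟩
  refine inter_mem ?_ (hA.isOpen_compl.mem_nhds hxA)
  by_cases hxC : x ∈ C
  · exact nhds x hxC hxA
  rcases hxD with hx | hx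
  · filter_upwards [h₁.mem_nhds ⟨hx, fun h => h.elim (fun h => hxA (.inl h)) hxC⟩] with y hy
    exact .inl hy.1
  · filter_upwards [h₂.mem_nhds ⟨hx, fun h => h.elim (fun h => hxA (.inr h)) hxC⟩] with y hy
    exact .inr hy.1

/-- The segment `uv` is an edge of the polygon `P` with set of vertices `V`, and `B` is the rest
of `P`. -/
structure IsEdge (V P : Set E) (u v : E) (B : Set E) : Prop where
  left_mem : u ∈ V
  right_mem : v ∈ V
  ne : u ≠ v
  disjoint : Disjoint (openSegment ℝ u v) V
  isClosed : IsClosed B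
  inter_eq : segment ℝ u v ∩ B = {u, v}
  eq_union : P = segment ℝ u v ∪ B

/-- A region `D` bounded by the polygon `P` with vertex set `V`, such that the image under `F` of
the rest of `P` can be swept across `F(D)` onto any edge, and the image of `P` is an unknot. -/
structure IsSweptRegion (F : E → EuclideanSpace ℝ (Fin 3)) (V P D : Set E) : Prop where
  isClosed : IsClosed D
  subset_hull : D ⊆ convexHull ℝ V
  boundary_subset : P ⊆ D
  isOpen : IsOpen (D \ P)
  halfDisc : ∀ x ∈ P, x ∉ V → ∃ n : E →L[ℝ] ℝ, ∀ᶠ y in 𝓝 x, n x ≤ n y → y ∈ D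
  sweep : ∀ u v B, IsEdge V P u v B → SweepsOnto F D B u v
  unknot : IsUnknot (F '' P)

theorem IsEdge.mem_pair {V P B : Set E} {u v x : E} (h : IsEdge V P u v B)
    (hx : x ∈ segment ℝ u v) (hxV : x ∈ V) : x ∈ ({u, v} : Set E) := by
  by_contra hne
  rw [mem_insert_iff, mem_singleton_iff, not_or] at hne
  exact disjoint_left.1 h.disjoint
    (mem_openSegment_of_ne_left_right (Ne.symm hne.1) (Ne.symm hne.2) hx) hxV

theorem PolyArc.isEdge_chord {b w : E} {V A : Set E} (h : PolyArc b w V A)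
    (meet : A ∩ segment ℝ b w ⊆ {b, w}) : IsEdge V (A ∪ segment ℝ b w) b w A where
  left_mem := h.ends_mem.1
  right_mem := h.ends_mem.2
  ne := h.ne
  disjoint := by
    rw [disjoint_left]
    intro x hx hxV
    rcases meet ⟨h.vertices_subset hxV, openSegment_subset_segment _ _ _ hx⟩ with rfl | rfl
    · exact h.ne (left_mem_openSegment_iff.1 hx)
    · exact h.ne (right_mem_openSegment_iff.1 hx)
  isClosed := h.isCompact.isClosed
  inter_eq := ((inter_comm _ _).subset.trans meet).antisymm <| pair_subset
    ⟨left_mem_segment _ _ _, h.left_mem⟩ ⟨right_mem_segment _ _ _, h.right_mem⟩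
  eq_union := union_comm _ _

section Glue

variable {V₁ V₂ A₁ A₂ : Set E} {b w : E}

theorem IsEdge.subset_or_subset {u v : E} {B : Set E} (h : IsEdge (V₁ ∪ V₂) (A₁ ∪ A₂) u v B)
    (hA₁ : PolyArc b w V₁ A₁) (hA₂ : PolyArc b w V₂ A₂) (meet : A₁ ∩ A₂ ⊆ {b, w}) :
    segment ℝ u v ⊆ A₁ ∨ segment ℝ u v ⊆ A₂ := by
  have open_subset : openSegment ℝ u v ⊆ A₁ ∪ A₂ := by
    rw [h.eq_union]
    exact (openSegment_subset_segment ℝ u v).trans subset_union_left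
  have avoids_meet : openSegment ℝ u v ∩ (A₁ ∩ A₂) = ∅ :=
    disjoint_iff_inter_eq_empty.1 <| h.disjoint.mono_right <|
      meet.trans ((pair_subset hA₁.ends_mem.1 hA₁.ends_mem.2).trans subset_union_left)
  rw [← closure_openSegment, hA₁.isCompact.isClosed.closure_subset_iff,
    hA₂.isCompact.isClosed.closure_subset_iff]
  exact isPreconnected_iff_subset_of_disjoint_closed.1 (convex_openSegment u v).isPreconnected
    A₁ A₂ hA₁.isCompact.isClosed hA₂.isCompact.isClosed open_subset avoids_meet

theorem IsEdge.eq_union_of_subset {u v : E} {B : Set E}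
    (h : IsEdge (V₁ ∪ V₂) (A₁ ∪ A₂) u v B) (hA₁ : PolyArc b w V₁ A₁) (meet : A₁ ∩ A₂ ⊆ {b, w})
    (huv : segment ℝ u v ⊆ A₁) : B = A₂ ∪ (B ∩ A₁) := by
  refine Subset.antisymm (fun x hx => ?_) (union_subset (fun x hx => ?_) inter_subset_left)
  · exact (h.eq_union.superset (.inr hx)).symm.imp_right fun hx₁ => ⟨hx, hx₁⟩
  · rcases h.eq_union.subset (.inr hx) with hxuv | hxB
    · have hxV : x ∈ V₁ := pair_subset hA₁.ends_mem.1 hA₁.ends_mem.2 (meet ⟨huv hxuv, hx⟩)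
      exact (h.inter_eq.superset (h.mem_pair hxuv (.inl hxV))).2
    · exact hxB

theorem IsEdge.of_subset_left {u v : E} {B : Set E} (h : IsEdge (V₁ ∪ V₂) (A₁ ∪ A₂) u v B)
    (hA₁ : PolyArc b w V₁ A₁) (hA₂ : PolyArc b w V₂ A₂) (meet : A₁ ∩ A₂ ⊆ {b, w})
    (meet_chord : A₁ ∩ segment ℝ b w ⊆ {b, w}) (huv : segment ℝ u v ⊆ A₁) :
    IsEdge V₁ (A₁ ∪ segment ℝ b w) u v (segment ℝ b w ∪ (B ∩ A₁)) := by
  have ends_mem : ({b, w} : Set E) ⊆ V₁ := pair_subset hA₁.ends_mem.1 hA₁.ends_mem.2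
  have mem_left {x : E} (hx : x ∈ V₁ ∪ V₂) (hxA : x ∈ A₁) : x ∈ V₁ :=
    hx.elim id fun hx₂ => ends_mem (meet ⟨hxA, hA₂.vertices_subset hx₂⟩)
  refine ⟨mem_left h.left_mem (huv (left_mem_segment _ _ _)),
    mem_left h.right_mem (huv (right_mem_segment _ _ _)), h.ne,
    h.disjoint.mono_right subset_union_left,
    (isCompact_segment b w).isClosed.union (h.isClosed.inter hA₁.isCompact.isClosed), ?_, ?_⟩
  · refine Subset.antisymm ?_ fun x hx => ?_
    · rintro x ⟨hx, hxbw | hxB⟩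
      · exact h.mem_pair hx (.inl (ends_mem (meet_chord ⟨huv hx, hxbw⟩)))
      · exact h.inter_eq.subset ⟨hx, hxB.1⟩
    · obtain ⟨hxuv, hxB⟩ := h.inter_eq.superset hx
      exact ⟨hxuv, .inr ⟨hxB, huv hxuv⟩⟩
  · have hA₁_eq : A₁ = segment ℝ u v ∪ (B ∩ A₁) := by
      rw [union_inter_distrib_left, ← h.eq_union, union_eq_self_of_subset_left huv,
        inter_eq_right.2 subset_union_left]
    nth_rewrite 1 [hA₁_eq]
    ac_rfl

variable {F : E → EuclideanSpace ℝ (Fin 3)} {D₁ D₂ : Set E}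

theorem IsSweptRegion.isCompact {V P D : Set E} (h : IsSweptRegion F V P D) (hV : V.Finite) :
    IsCompact D :=
  (hV.isCompact_convexHull ℝ).of_isClosed_subset h.isClosed h.subset_hull

theorem IsSweptRegion.inter_subset_chord (hA₁ : PolyArc b w V₁ A₁) (hA₂ : PolyArc b w V₂ A₂)
    (hD₁ : IsSweptRegion F V₁ (A₁ ∪ segment ℝ b w) D₁)
    (hD₂ : IsSweptRegion F V₂ (A₂ ∪ segment ℝ b w) D₂)
    (outside₁ : A₁ ∩ D₂ ⊆ segment ℝ b w) (outside₂ : A₂ ∩ D₁ ⊆ segment ℝ b w) :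
    D₁ ∩ D₂ ⊆ segment ℝ b w := by
  refine subset_of_isOpen_diff ((hD₁.isCompact hA₁.finite).inter (hD₂.isCompact hA₂.finite))
    (isCompact_segment b w).isClosed (convex_segment b w) ⟨b, left_mem_segment _ _ _⟩ ?_
  have diff_eq : (D₁ ∩ D₂) \ segment ℝ b w =
      (D₁ \ (A₁ ∪ segment ℝ b w)) ∩ (D₂ \ (A₂ ∪ segment ℝ b w)) := by
    refine Subset.antisymm ?_ fun x hx => ⟨⟨hx.1.1, hx.2.1⟩, fun hxbw => hx.1.2 (.inr hxbw)⟩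
    rintro x ⟨⟨hx₁, hx₂⟩, hxbw⟩
    exact ⟨⟨hx₁, fun h => h.elim (fun h => hxbw (outside₁ ⟨h, hx₂⟩)) hxbw⟩,
      ⟨hx₂, fun h => h.elim (fun h => hxbw (outside₂ ⟨h, hx₁⟩)) hxbw⟩⟩
  exact diff_eq ▸ hD₁.isOpen.inter hD₂.isOpen

/-- First the second arc is swept onto the chord, then the chord and the rest of the first arc are
swept onto the edge. -/
theorem sweepsOnto_glue (hF : ContinuousOn F (D₁ ∪ D₂)) (hinj : InjOn F (D₁ ∪ D₂))
    (hA₁ : PolyArc b w V₁ A₁) (hA₂ : PolyArc b w V₂ A₂) (meet : A₁ ∩ A₂ ⊆ {b, w})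
    (meet_chord₁ : A₁ ∩ segment ℝ b w ⊆ {b, w}) (meet_chord₂ : A₂ ∩ segment ℝ b w ⊆ {b, w})
    (hD₁ : IsSweptRegion F V₁ (A₁ ∪ segment ℝ b w) D₁)
    (hD₂ : IsSweptRegion F V₂ (A₂ ∪ segment ℝ b w) D₂) (hD : D₁ ∩ D₂ ⊆ segment ℝ b w)
    {u v : E} {B : Set E} (edge : IsEdge (V₁ ∪ V₂) (A₁ ∪ A₂) u v B)
    (huv : segment ℝ u v ⊆ A₁) : SweepsOnto F (D₁ ∪ D₂) B u v := by
  have hA₁D₁ : A₁ ⊆ D₁ := subset_union_left.trans hD₁.boundary_subset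
  have huvA₁ : {u, v} ∪ (B ∩ A₁) ⊆ A₁ := union_subset
    (pair_subset (huv (left_mem_segment _ _ _)) (huv (right_mem_segment _ _ _))) inter_subset_right
  have hBA₁ : IsCompact (B ∩ A₁) := hA₁.isCompact.inter_left edge.isClosed
  intro R hR avoid
  have onto_chord := (hD₂.sweep b w A₂ (hA₂.isEdge_chord meet_chord₂)).union_right hF hinj
    subset_union_right hBA₁ ((subset_union_left.trans huvA₁).trans (hA₁D₁.trans subset_union_left))
    ((subset_union_right.trans huvA₁).trans (hA₁D₁.trans subset_union_left))
    (fun x hx => meet_chord₁ ⟨huvA₁ hx.1, hD ⟨hA₁D₁ (huvA₁ hx.1), hx.2⟩⟩) hR avoid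
  rw [← edge.eq_union_of_subset hA₁ meet huv] at onto_chord
  exact onto_chord.trans (hD₁.sweep u v _ (edge.of_subset_left hA₁ hA₂ meet meet_chord₁ huv) R hR
    ((inter_subset_inter_right R (image_mono subset_union_left)).trans avoid))

theorem isUnknot_glue (hF : ContinuousOn F (D₁ ∪ D₂)) (hinj : InjOn F (D₁ ∪ D₂))
    (hA₁ : IsCompact A₁) (hA₂ : PolyArc b w V₂ A₂)
    (meet_chord₁ : A₁ ∩ segment ℝ b w ⊆ {b, w}) (meet_chord₂ : A₂ ∩ segment ℝ b w ⊆ {b, w})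
    (hD₁ : IsSweptRegion F V₁ (A₁ ∪ segment ℝ b w) D₁)
    (hD₂ : IsSweptRegion F V₂ (A₂ ∪ segment ℝ b w) D₂) (hD : D₁ ∩ D₂ ⊆ segment ℝ b w) :
    IsUnknot (F '' (A₁ ∪ A₂)) := by
  have hA₁D₁ : A₁ ⊆ D₁ := subset_union_left.trans hD₁.boundary_subset
  have onto_chord := (hD₂.sweep b w A₂ (hA₂.isEdge_chord meet_chord₂)).union_right hF hinj
    subset_union_right hA₁ (empty_subset _) (hA₁D₁.trans subset_union_left)
    (by
      rw [empty_union]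
      exact fun x hx => meet_chord₁ ⟨hx.1, hD ⟨hA₁D₁ hx.1, hx.2⟩⟩)
    isClosed_empty (by simp)
  rw [union_comm A₂, union_comm (segment ℝ b w)] at onto_chord
  exact (onto_chord.trans (.of_ambientIsotopic hD₁.unknot)).ambientIsotopic

theorem isSweptRegion_glue [FiniteDimensional ℝ E] (hE : 1 < Module.finrank ℝ E)
    (hF : ContinuousOn F (D₁ ∪ D₂)) (hinj : InjOn F (D₁ ∪ D₂))
    (hA₁ : PolyArc b w V₁ A₁) (hA₂ : PolyArc b w V₂ A₂) (meet : A₁ ∩ A₂ ⊆ {b, w})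
    (meet_chord₁ : A₁ ∩ segment ℝ b w ⊆ {b, w}) (meet_chord₂ : A₂ ∩ segment ℝ b w ⊆ {b, w})
    (hD₁ : IsSweptRegion F V₁ (A₁ ∪ segment ℝ b w) D₁)
    (hD₂ : IsSweptRegion F V₂ (A₂ ∪ segment ℝ b w) D₂)
    (outside₁ : A₁ ∩ D₂ ⊆ segment ℝ b w) (outside₂ : A₂ ∩ D₁ ⊆ segment ℝ b w) :
    IsSweptRegion F (V₁ ∪ V₂) (A₁ ∪ A₂) (D₁ ∪ D₂) := by
  have hD := IsSweptRegion.inter_subset_chord hA₁ hA₂ hD₁ hD₂ outside₁ outside₂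
  refine ⟨hD₁.isClosed.union hD₂.isClosed, ?_, ?_, ?_, ?_, fun u v B edge => ?_,
    isUnknot_glue hF hinj hA₁.isCompact hA₂ meet_chord₁ meet_chord₂ hD₁ hD₂ hD⟩
  · exact union_subset (hD₁.subset_hull.trans (convexHull_mono subset_union_left))
      (hD₂.subset_hull.trans (convexHull_mono subset_union_right))
  · exact union_subset_union (subset_union_left.trans hD₁.boundary_subset)
      (subset_union_left.trans hD₂.boundary_subset)
  · refine isOpen_union_diff hD₁.isOpen hD₂.isOpen (hA₁.isCompact.union hA₂.isCompact).isClosed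
      fun x hx hxA => ?_
    obtain ⟨n₁, hn₁⟩ := hD₁.halfDisc x (.inr hx) fun h => hxA (.inl (hA₁.vertices_subset h))
    obtain ⟨n₂, hn₂⟩ := hD₂.halfDisc x (.inr hx) fun h => hxA (.inr (hA₂.vertices_subset h))
    exact union_mem_nhds_of_halfspaces hn₁ hn₂
      (subset_empty_iff.1 ((interior_mono hD).trans (interior_segment_eq_empty hE b w).subset))
  · rintro x (hx | hx) hxV
    · obtain ⟨n, hn⟩ := hD₁.halfDisc x (.inl hx) fun h => hxV (.inl h)
      exact ⟨n, hn.mono fun y hy h => .inl (hy h)⟩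
    · obtain ⟨n, hn⟩ := hD₂.halfDisc x (.inl hx) fun h => hxV (.inr h)
      exact ⟨n, hn.mono fun y hy h => .inr (hy h)⟩
  · rcases edge.subset_or_subset hA₁ hA₂ meet with huv | huv
    · exact sweepsOnto_glue hF hinj hA₁ hA₂ meet meet_chord₁ meet_chord₂ hD₁ hD₂ hD edge huv
    · rw [union_comm D₁] at hF hinj ⊢
      rw [union_comm V₁, union_comm A₁] at edge
      exact sweepsOnto_glue hF hinj hA₂ hA₁ (by rwa [inter_comm]) meet_chord₂ meet_chord₁ hD₂ hD₁
        (by rwa [inter_comm]) edge huv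

end Glue

end Region

section Plane

theorem range_fin_three {α : Type*} (f : Fin 3 → α) : range f = {f 0, f 1, f 2} := by
  ext
  simp [Fin.exists_fin_succ, eq_comm]

theorem exists_affineBasis_of_finrank_eq_two {E : Type*} [AddCommGroup E] [Module ℝ E]
    (hE : Module.finrank ℝ E = 2) {a b c : E} (h : LinearIndependent ℝ ![b - a, c - a]) :
    ∃ B : AffineBasis (Fin 3) ℝ E, B 0 = a ∧ B 1 = b ∧ B 2 = c := by
  have : FiniteDimensional ℝ E := .of_finrank_pos (by omega)
  have independent : AffineIndependent ℝ ![a, b, c] := by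
    rw [affineIndependent_iff_linearIndependent_vsub ℝ _ (0 : Fin 3),
      ← linearIndependent_equiv (finSuccAboveEquiv (0 : Fin 3))]
    have differences : (fun i => ![a, b, c] i -ᵥ ![a, b, c] 0) ∘ Subtype.val ∘
        finSuccAboveEquiv (0 : Fin 3) = ![b - a, c - a] := by
      ext i
      fin_cases i <;> rfl
    exact differences ▸ h
  exact ⟨⟨_, independent, independent.affineSpan_eq_top_iff_card_eq_finrank_add_one.2
    (by simp [hE])⟩, rfl, rfl, rfl⟩

variable {E : Type*} [NormedAddCommGroup E] [NormedSpace ℝ E]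

section Coordinates

variable {B : AffineBasis (Fin 3) ℝ E} {x : E}

theorem mem_triangle_iff :
    x ∈ convexHull ℝ {B 0, B 1, B 2} ↔ ∀ i, 0 ≤ B.coord i x := by
  rw [← range_fin_three, B.convexHull_eq_nonneg_coord, mem_ofPred_eq]

theorem mem_segment_basis_iff {i j : Fin 3} : x ∈ segment ℝ (B i) (B j) ↔
    (∀ k, 0 ≤ B.coord k x) ∧ ∀ k, k ≠ i → k ≠ j → B.coord k x = 0 := by
  rw [← convexHull_pair, ← image_pair, mem_convexHull_basis_image]
  simp

theorem mem_triangle_boundary_iff :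
    x ∈ segment ℝ (B 0) (B 1) ∪ segment ℝ (B 1) (B 2) ∪ segment ℝ (B 2) (B 0) ↔
      (∀ i, 0 ≤ B.coord i x) ∧ ∃ i, B.coord i x = 0 := by
  simp only [mem_union, mem_segment_basis_iff, ← and_or_left]
  refine and_congr_right fun _ => ?_
  simp [Fin.forall_fin_succ, Fin.exists_fin_succ, or_comm, or_left_comm]

theorem eq_vertex_of_coord_eq_zero (hx : ∀ i, 0 ≤ B.coord i x) {i j : Fin 3} (hij : i ≠ j)
    (hi : B.coord i x = 0) (hj : B.coord j x = 0) : ∃ k, x = B k := by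
  have exists_third : ∀ i j : Fin 3, i ≠ j → ∃ k, ∀ l, l ≠ k → l = i ∨ l = j := by decide
  obtain ⟨k, others⟩ := exists_third i j hij
  have : x ∈ convexHull ℝ (B '' {k}) := (mem_convexHull_basis_image B).2
    ⟨hx, fun l hl => (others l hl).elim (· ▸ hi) (· ▸ hj)⟩
  exact ⟨k, by simpa using this⟩

theorem exists_coord_eq_add (B : AffineBasis (Fin 3) ℝ E) (i : Fin 3) :
    ∃ (f : E →L[ℝ] ℝ) (r : ℝ), ∀ x, B.coord i x = f x + r := by
  have : FiniteDimensional ℝ E := B.finiteDimensional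
  exact ⟨LinearMap.toContinuousLinearMap (B.coord i).linear, B.coord i 0,
    fun x => congrFun (B.coord i).decomp x⟩

theorem isOpen_triangle_diff_boundary (B : AffineBasis (Fin 3) ℝ E) :
    IsOpen (convexHull ℝ {B 0, B 1, B 2} \
      (segment ℝ (B 0) (B 1) ∪ segment ℝ (B 1) (B 2) ∪ segment ℝ (B 2) (B 0))) := by
  have : FiniteDimensional ℝ E := B.finiteDimensional
  convert isOpen_interior (s := convexHull ℝ (range B)) using 1
  ext x
  rw [B.interior_convexHull, Set.mem_sdiff, mem_triangle_iff, mem_triangle_boundary_iff,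
    mem_ofPred_eq]
  refine ⟨fun ⟨hx, boundary⟩ i => (hx i).lt_of_ne' fun h => boundary ⟨hx, i, h⟩,
    fun hx => ⟨fun i => (hx i).le, ?_⟩⟩
  rintro ⟨-, i, h⟩
  exact (hx i).ne' h

theorem eventually_mem_triangle {i : Fin 3} (hi : 0 ≤ B.coord i x)
    (pos : ∀ j, j ≠ i → 0 < B.coord j x) :
    ∀ᶠ y in 𝓝 x, B.coord i x ≤ B.coord i y → y ∈ convexHull ℝ {B 0, B 1, B 2} := by
  have : FiniteDimensional ℝ E := B.finiteDimensional
  have near : ∀ᶠ y in 𝓝 x, ∀ j, j ≠ i → 0 < B.coord j y :=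
    eventually_all.2 fun j => eventually_imp_distrib_left.2 fun hj =>
      (continuous_barycentric_coord B j).continuousAt.eventually_const_lt (pos j hj)
  filter_upwards [near] with y hy hiy
  refine mem_triangle_iff.2 fun j => ?_
  rcases eq_or_ne j i with rfl | hj
  · exact hi.trans hiy
  · exact (hy j hj).le

theorem exists_halfDisc_triangle
    (hx : x ∈ segment ℝ (B 0) (B 1) ∪ segment ℝ (B 1) (B 2) ∪ segment ℝ (B 2) (B 0))
    (hxV : x ∉ ({B 0, B 1, B 2} : Set E)) :
    ∃ n : E →L[ℝ] ℝ, ∀ᶠ y in 𝓝 x, n x ≤ n y → y ∈ convexHull ℝ {B 0, B 1, B 2} := by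
  obtain ⟨nonneg, i, hi⟩ := mem_triangle_boundary_iff.1 hx
  have pos : ∀ j, j ≠ i → 0 < B.coord j x := fun j hj => (nonneg j).lt_of_ne' fun h => hxV <| by
    obtain ⟨k, rfl⟩ := eq_vertex_of_coord_eq_zero nonneg hj h hi
    exact range_fin_three B ▸ mem_range_self k
  obtain ⟨f, r, coord_eq⟩ := exists_coord_eq_add B i
  refine ⟨f, ?_⟩
  filter_upwards [eventually_mem_triangle hi.ge pos] with y hy hxy
  rw [coord_eq, coord_eq] at hy
  exact hy (add_le_add_left hxy r)

end Coordinates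

theorem IsEdge.symm {V P B : Set E} {u v : E} (h : IsEdge V P u v B) : IsEdge V P v u B where
  left_mem := h.right_mem
  right_mem := h.left_mem
  ne := h.ne.symm
  disjoint := openSegment_symm ℝ u v ▸ h.disjoint
  isClosed := h.isClosed
  inter_eq := by rw [segment_symm, pair_comm, h.inter_eq]
  eq_union := by rw [segment_symm, h.eq_union]

theorem IsEdge.eq_union_of_triangle {a b c : E} (h : LinearIndependent ℝ ![b - a, c - a])
    {V B : Set E}
    (edge : IsEdge V (segment ℝ a b ∪ segment ℝ b c ∪ segment ℝ c a) a c B) :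
    B = segment ℝ a b ∪ segment ℝ b c := by
  have meet_a := (segment_inter_eq_endpoint_of_linearIndependent_sub ℝ h).subset
  have meet_c := (segment_inter_eq_endpoint_of_linearIndependent_sub ℝ
    (linearIndependent_triangle_rotate (linearIndependent_triangle_rotate h))).subset
  have ends : {a, c} ⊆ B := edge.inter_eq.ge.trans inter_subset_right
  refine Subset.antisymm (fun x hx => ?_) (union_subset (fun x hx => ?_) fun x hx => ?_)
  · rcases edge.eq_union.ge (.inr hx) with h' | h'
    · exact h'
    · rcases edge.inter_eq.subset ⟨segment_symm ℝ c a ▸ h', hx⟩ with rfl | rfl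
      · exact .inl (left_mem_segment _ _ _)
      · exact .inr (right_mem_segment _ _ _)
  · rcases edge.eq_union.le (.inl (.inl hx)) with h' | h'
    · exact ends (.inl (meet_a ⟨hx, h'⟩))
    · exact h'
  · rcases edge.eq_union.le (.inl (.inr hx)) with h' | h'
    · exact ends (.inr (meet_c ⟨segment_symm ℝ a c ▸ h', segment_symm ℝ b c ▸ hx⟩))
    · exact h'

variable {F : E → EuclideanSpace ℝ (Fin 3)} {a b c : E}

theorem SweepsOnto.symm {D B : Set E} (h : SweepsOnto F D B a c) : SweepsOnto F D B c a := by
  rwa [SweepsOnto, pair_comm c a, segment_symm ℝ c a]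

theorem IsTameTriangle.sweepsOnto_of_isEdge (hT : IsTameTriangle F a b c)
    (h : LinearIndependent ℝ ![b - a, c - a]) {u v : E} {B : Set E}
    (edge : IsEdge {a, b, c} (segment ℝ a b ∪ segment ℝ b c ∪ segment ℝ c a) u v B) :
    SweepsOnto F (convexHull ℝ {a, b, c}) B u v := by
  have of_opposite : ∀ a b c : E, IsTameTriangle F a b c →
      LinearIndependent ℝ ![b - a, c - a] → ∀ (V B : Set E),
      IsEdge V (segment ℝ a b ∪ segment ℝ b c ∪ segment ℝ c a) a c B →
        SweepsOnto F (convexHull ℝ {a, b, c}) B a c := by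
    intro a b c hT h V B edge
    rw [edge.eq_union_of_triangle h]
    exact hT.push_mid
  have h_rotate := linearIndependent_triangle_rotate h
  have boundary₁ : segment ℝ b c ∪ segment ℝ c a ∪ segment ℝ a b =
      segment ℝ a b ∪ segment ℝ b c ∪ segment ℝ c a := by rw [union_comm, union_assoc]
  have boundary₂ : segment ℝ c a ∪ segment ℝ a b ∪ segment ℝ b c =
      segment ℝ a b ∪ segment ℝ b c ∪ segment ℝ c a := by rw [union_assoc, union_comm]
  have sweep_ac := of_opposite a b c hT h {a, b, c} B
  have sweep_ba := of_opposite b c a hT.rotate h_rotate {a, b, c} B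
  have sweep_cb := of_opposite c a b hT.rotate.rotate
    (linearIndependent_triangle_rotate h_rotate) {a, b, c} B
  rw [boundary₁, insert_insert_singleton_rotate a b c] at sweep_ba
  rw [boundary₂, ← insert_insert_singleton_rotate c a b] at sweep_cb
  obtain ⟨rfl | rfl | rfl, rfl | rfl | rfl⟩ := And.intro edge.left_mem edge.right_mem
  · exact absurd rfl edge.ne
  · exact (sweep_ba edge.symm).symm
  · exact sweep_ac edge
  · exact sweep_ba edge
  · exact absurd rfl edge.ne
  · exact (sweep_cb edge.symm).symm
  · exact (sweep_ac edge.symm).symm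
  · exact sweep_cb edge
  · exact absurd rfl edge.ne

theorem IsTameTriangle.isSweptRegion (hE : Module.finrank ℝ E = 2) (hT : IsTameTriangle F a b c)
    (h : LinearIndependent ℝ ![b - a, c - a]) :
    IsSweptRegion F {a, b, c} (segment ℝ a b ∪ segment ℝ b c ∪ segment ℝ c a)
      (convexHull ℝ {a, b, c}) := by
  obtain ⟨B, rfl, rfl, rfl⟩ := exists_affineBasis_of_finrank_eq_two hE h
  exact {
    isClosed := (toFinite _).isClosed_convexHull ℝ
    subset_hull := Subset.rfl
    boundary_subset := fun x hx => mem_triangle_iff.2 (mem_triangle_boundary_iff.1 hx).1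
    isOpen := isOpen_triangle_diff_boundary B
    halfDisc := fun x => exists_halfDisc_triangle
    sweep := fun u v A edge => hT.sweepsOnto_of_isEdge h edge
    unknot := hT.unknot }

end Plane

section Diagonal

theorem exists_mem_extremePoints_isMaxOn {E : Type*} [AddCommGroup E] [Module ℝ E]
    [TopologicalSpace E] [T2Space E] [IsTopologicalAddGroup E] [ContinuousSMul ℝ E]
    [LocallyConvexSpace ℝ E] {K : Set E} (hK : IsCompact K) (hne : K.Nonempty) (f : E →L[ℝ] ℝ) :
    ∃ x ∈ K.extremePoints ℝ, IsMaxOn f K x := by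
  obtain ⟨y, hy, max⟩ := hK.exists_isMaxOn hne f.continuous.continuousOn
  have exposed : IsExposed ℝ K (f.toExposed K) := ContinuousLinearMap.toExposed.isExposed
  obtain ⟨x, hx⟩ := (exposed.isCompact hK).extremePoints_nonempty ⟨y, hy, max⟩
  exact ⟨x, exposed.isExtreme.extremePoints_subset_extremePoints hx, hx.1.2⟩

variable {E : Type*} [NormedAddCommGroup E] [NormedSpace ℝ E] {a b c x : E} {V S T : Set E}

theorem eventually_lineMap_nhdsGT {p : E → Prop} (h : ∀ᶠ z in 𝓝 x, p z) (y : E) :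
    ∀ᶠ s : ℝ in 𝓝[>] 0, (0 < s ∧ s < 1) ∧ p (AffineMap.lineMap x y s) := by
  have tendsto : Tendsto (AffineMap.lineMap x y : ℝ → E) (𝓝 0) (𝓝 x) :=
    AffineMap.lineMap_continuous.tendsto' 0 x (AffineMap.lineMap_apply_zero x y)
  exact Filter.Eventually.and (Ioo_mem_nhdsGT one_pos)
    ((tendsto.eventually h).filter_mono nhdsWithin_le_nhds)

theorem lineMap_mem_of_segment_subset {y : E} {s : ℝ} (hs : 0 < s ∧ s < 1)
    (h : segment ℝ x y ⊆ S) : AffineMap.lineMap x y s ∈ S :=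
  h (lineMap_mem_segment _ _ _ ⟨hs.1.le, hs.2.le⟩)

theorem PolyArc.exists_vertex_isMaxOn (h : PolyArc a c V S) (hT : IsClosed T)
    (hne : (S ∩ T).Nonempty) (f : E →L[ℝ] ℝ)
    (interior : ∀ x ∈ S ∩ T, IsMaxOn f (S ∩ T) x → T ∈ 𝓝 x) :
    ∃ w ∈ V, w ∈ T ∧ IsMaxOn f (S ∩ T) w := by
  obtain ⟨w, ⟨⟨hwS, hwT⟩, extreme⟩, max⟩ :=
    exists_mem_extremePoints_isMaxOn (h.isCompact.inter_right hT) hne f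
  refine ⟨w, by_contra fun hwV => ?_, hwT, max⟩
  obtain ⟨p, hp, q, -, hw, subset, -⟩ := h.exists_edge_of_mem hwS hwV
  have near := interior w ⟨hwS, hwT⟩ max
  obtain ⟨s, ⟨hs, hp'⟩, -, hq'⟩ :=
    ((eventually_lineMap_nhdsGT near p).and (eventually_lineMap_nhdsGT near q)).exists
  have hw' := openSegment_subset_segment _ _ _ hw
  have shrunk : w ∈ openSegment ℝ (AffineMap.lineMap w p s) (AffineMap.lineMap w q s) := by
    rw [← AffineMap.homothety_eq_lineMap, ← AffineMap.homothety_eq_lineMap, ← image_openSegment]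
    exact ⟨w, hw, AffineMap.homothety_apply_same _ _⟩
  have fixed := extreme
    ⟨lineMap_mem_of_segment_subset hs
      (((convex_segment p q).segment_subset hw' (left_mem_segment _ _ _)).trans subset), hp'⟩
    ⟨lineMap_mem_of_segment_subset hs
      (((convex_segment p q).segment_subset hw' (right_mem_segment _ _ _)).trans subset), hq'⟩
    shrunk
  rw [AffineMap.lineMap_eq_left_iff] at fixed
  exact hwV ((fixed.resolve_right hs.1.ne') ▸ hp)

theorem segment_inter_subset_of_isMaxOn {f : E →L[ℝ] ℝ} {w : E} (hT : Convex ℝ T) (hb : b ∈ T)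
    (hw : w ∈ T) (max : IsMaxOn f (S ∩ T) w) (lt : f w < f b) : segment ℝ b w ∩ S ⊆ {w} := by
  rintro _ ⟨⟨s, t, hs, ht, hst, rfl⟩, hS⟩
  have le : f (s • b + t • w) ≤ f w := max ⟨hS, hT hb hw hs ht hst⟩
  rw [map_add, map_smul, map_smul, smul_eq_mul, smul_eq_mul, eq_sub_of_add_eq' hst] at le
  obtain rfl : s = 0 := le_antisymm (by nlinarith) hs
  obtain rfl : t = 1 := by simpa using hst
  simp

theorem eq_of_isMaxOn_of_mem_openSegment {f : E →L[ℝ] ℝ} {p q : E}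
    (halfDisc : ∀ᶠ y in 𝓝 x, f x ≤ f y → y ∈ T) (max : IsMaxOn f (S ∩ T) x)
    (hx : x ∈ openSegment ℝ p q) (subset : segment ℝ p q ⊆ S) : f p = f x ∧ f q = f x := by
  have endpoint_le : ∀ e ∈ segment ℝ p q, f e ≤ f x := by
    intro e he
    by_contra! lt
    obtain ⟨s, hs, mem⟩ := (eventually_lineMap_nhdsGT halfDisc e).exists
    have rise : f (AffineMap.lineMap x e s) = f x + s * (f e - f x) := by
      rw [AffineMap.lineMap_apply_module']
      simp [add_comm]
    have higher : f x < f (AffineMap.lineMap x e s) := by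
      rw [rise]
      exact lt_add_of_pos_right _ (mul_pos hs.1 (sub_pos.2 lt))
    exact (max ⟨lineMap_mem_of_segment_subset hs (((convex_segment p q).segment_subset
      (openSegment_subset_segment _ _ _ hx) he).trans subset), mem higher.le⟩).not_gt higher
  have hp := endpoint_le p (left_mem_segment _ _ _)
  have hq := endpoint_le q (right_mem_segment _ _ _)
  obtain ⟨s, t, hs, ht, hst, rfl⟩ := hx
  rw [map_add, map_smul, map_smul, smul_eq_mul, smul_eq_mul, eq_sub_of_add_eq' hst] at hp hq ⊢
  have eq : f p = f q := le_antisymm (by nlinarith) (by nlinarith)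
  constructor <;> rw [eq] <;> ring

theorem PolyArc.exists_vertex_mem_openSegment (h : PolyArc a c V S) (hV : V ≠ {a, c})
    (hx : x ∈ openSegment ℝ a c) (hxS : x ∈ S)
    (collinear : ∀ p q, x ∈ openSegment ℝ p q → segment ℝ p q ⊆ S →
      p ∈ range (AffineMap.lineMap a c : ℝ → E) ∧ q ∈ range (AffineMap.lineMap a c : ℝ → E)) :
    ∃ w ∈ V, w ∈ openSegment ℝ a c := by
  by_contra! none
  have hxV : x ∉ V := fun hxV => none x hxV hx
  obtain ⟨p, hp, q, hq, hxpq, subset, disjoint⟩ := h.exists_edge_of_mem hxS hxV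
  obtain ⟨⟨s, rfl⟩, t, rfl⟩ := collinear p q hxpq subset
  have hst : s ≠ t := by
    rintro rfl
    rw [openSegment_same] at hxpq
    exact hxV (hxpq ▸ hp)
  have mem_edge_iff : ∀ r : ℝ, AffineMap.lineMap a c r ∈
      openSegment ℝ (AffineMap.lineMap a c s) (AffineMap.lineMap a c t : E) ↔
      r ∈ Ioo (min s t) (max s t) := fun r => by
    rw [← image_openSegment, (AffineMap.lineMap_injective ℝ h.ne).mem_set_image,
      openSegment_eq_Ioo' hst]
  have outside : ∀ r : ℝ, AffineMap.lineMap a c r ∈ V → r ∉ Ioo 0 1 := fun r hr hr' =>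
    none _ hr (lineMap_mem_openSegment _ _ _ hr')
  have ha : (0 : ℝ) ∉ Ioo (min s t) (max s t) := fun h0 =>
    disjoint_left.1 disjoint ((mem_edge_iff 0).2 h0) (by simpa using h.ends_mem.1)
  have hc : (1 : ℝ) ∉ Ioo (min s t) (max s t) := fun h1 =>
    disjoint_left.1 disjoint ((mem_edge_iff 1).2 h1) (by simpa using h.ends_mem.2)
  have hs := outside s hp
  have ht := outside t hq
  rw [openSegment_eq_image_lineMap] at hx
  obtain ⟨r, hr, rfl⟩ := hx
  have hrst := (mem_edge_iff r).1 hxpq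
  have : s = 0 ∧ t = 1 ∨ s = 1 ∧ t = 0 := by
    grind
  rcases this with ⟨rfl, rfl⟩ | ⟨rfl, rfl⟩
  · rw [AffineMap.lineMap_apply_zero, AffineMap.lineMap_apply_one] at subset disjoint
    exact hV (h.vertices_eq_pair subset disjoint)
  · rw [AffineMap.lineMap_apply_zero, AffineMap.lineMap_apply_one] at subset disjoint
    exact hV (h.vertices_eq_pair (segment_symm ℝ c a ▸ subset) (openSegment_symm ℝ c a ▸ disjoint))

theorem mem_range_lineMap_of_coord_eq_zero {B : AffineBasis (Fin 3) ℝ E}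
    (hx : B.coord 0 x = 0) : x ∈ range (AffineMap.lineMap (B 1) (B 2) : ℝ → E) := by
  refine ⟨B.coord 2 x, B.ext_elem fun i => ?_⟩
  have sum := B.sum_coord_apply_eq_one x
  rw [Fin.sum_univ_three, hx, zero_add] at sum
  rw [AffineMap.apply_lineMap]
  fin_cases i <;> simp [hx, AffineMap.lineMap_apply_module, ← eq_sub_of_add_eq sum]

theorem coord_zero_lt_one {B : AffineBasis (Fin 3) ℝ E} (pos : ∀ j, j ≠ 0 → 0 < B.coord j x) :
    B.coord 0 x < 1 := by
  have sum := B.sum_coord_apply_eq_one x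
  rw [Fin.sum_univ_three] at sum
  linarith [pos 1 (by decide), pos 2 (by decide)]

theorem coord_pos_of_segment_inter {B : AffineBasis (Fin 3) ℝ E}
    (ha : segment ℝ (B 0) (B 1) ∩ S ⊆ {B 1}) (hc : segment ℝ (B 0) (B 2) ∩ S ⊆ {B 2})
    (hxS : x ∈ S) (hxT : x ∈ convexHull ℝ {B 0, B 1, B 2}) (hxa : x ≠ B 1) (hxc : x ≠ B 2) :
    ∀ j, j ≠ 0 → 0 < B.coord j x := by
  have nonneg := mem_triangle_iff.1 hxT
  refine fun j hj => (nonneg j).lt_of_ne' fun hx => ?_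
  obtain rfl | rfl : j = 1 ∨ j = 2 := by omega
  · exact hxc (hc ⟨mem_segment_basis_iff.2 ⟨nonneg, fun k h0 h2 => (by omega : k = 1) ▸ hx⟩, hxS⟩)
  · exact hxa (ha ⟨mem_segment_basis_iff.2 ⟨nonneg, fun k h0 h1 => (by omega : k = 2) ▸ hx⟩, hxS⟩)

theorem mem_openSegment_basis {B : AffineBasis (Fin 3) ℝ E} (h0 : B.coord 0 x = 0)
    (pos : ∀ j, j ≠ 0 → 0 < B.coord j x) : x ∈ openSegment ℝ (B 1) (B 2) := by
  refine mem_openSegment_of_ne_left_right ?_ ?_ (mem_segment_basis_iff.2 ⟨fun j => ?_, ?_⟩)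
  · rintro rfl
    simpa using pos 2
  · rintro rfl
    simpa using pos 1
  · rcases eq_or_ne j 0 with rfl | hj
    · exact h0.ge
    · exact (pos j hj).le
  · exact fun k h1 h2 => (by omega : k = 0) ▸ h0

section Visibility

variable {B : AffineBasis (Fin 3) ℝ E}

theorem PolyArc.exists_vertex_isMaxOn_coord (h : PolyArc (B 1) (B 2) V S)
    (ha : segment ℝ (B 0) (B 1) ∩ S ⊆ {B 1}) (hc : segment ℝ (B 0) (B 2) ∩ S ⊆ {B 2})
    {y : E} (hy : y ∈ S ∩ convexHull ℝ {B 0, B 1, B 2}) (y_pos : 0 < B.coord 0 y) :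
    ∃ w ∈ V, w ≠ B 1 ∧ w ≠ B 2 ∧ w ∈ convexHull ℝ {B 0, B 1, B 2} ∧
      IsMaxOn (B.coord 0) (S ∩ convexHull ℝ {B 0, B 1, B 2}) w := by
  have : FiniteDimensional ℝ E := B.finiteDimensional
  obtain ⟨f, r, coord_eq⟩ := exists_coord_eq_add B 0
  have isMaxOn_iff : ∀ {K z}, IsMaxOn (B.coord 0) K z ↔ IsMaxOn f K z := by
    simp [isMaxOn_iff, coord_eq]
  have max_pos : ∀ z, IsMaxOn f (S ∩ convexHull ℝ {B 0, B 1, B 2}) z → 0 < B.coord 0 z :=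
    fun z max => y_pos.trans_le (isMaxOn_iff.2 max hy)
  have ne : ∀ z, 0 < B.coord 0 z → z ≠ B 1 ∧ z ≠ B 2 := fun z hz =>
    ⟨fun e => by simp [e] at hz, fun e => by simp [e] at hz⟩
  obtain ⟨w, hw, hwT, max⟩ := h.exists_vertex_isMaxOn ((toFinite _).isClosed_convexHull ℝ)
    ⟨y, hy⟩ f fun z hz max => by
      have z_pos := max_pos z max
      have side_pos := coord_pos_of_segment_inter ha hc hz.1 hz.2 (ne z z_pos).1 (ne z z_pos).2
      rw [← mem_interior_iff_mem_nhds, ← range_fin_three, B.interior_convexHull]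
      exact fun j => (eq_or_ne j 0).elim (· ▸ z_pos) (side_pos j)
  exact ⟨w, hw, (ne w (max_pos w max)).1, (ne w (max_pos w max)).2, hwT, isMaxOn_iff.2 max⟩

theorem PolyArc.exists_vertex_mem_openSegment_basis (h : PolyArc (B 1) (B 2) V S)
    (ha : segment ℝ (B 0) (B 1) ∩ S ⊆ {B 1}) (hc : segment ℝ (B 0) (B 2) ∩ S ⊆ {B 2})
    (hV : V ≠ {B 1, B 2})
    (base : ∀ y ∈ S ∩ convexHull ℝ {B 0, B 1, B 2}, B.coord 0 y = 0) (hxS : x ∈ S)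
    (hxT : x ∈ convexHull ℝ {B 0, B 1, B 2}) (hxa : x ≠ B 1) (hxc : x ≠ B 2) :
    ∃ w ∈ V, w ∈ openSegment ℝ (B 1) (B 2) := by
  obtain ⟨f, r, coord_eq⟩ := exists_coord_eq_add B 0
  have x_base := base x ⟨hxS, hxT⟩
  have side_pos := coord_pos_of_segment_inter ha hc hxS hxT hxa hxc
  refine h.exists_vertex_mem_openSegment hV (mem_openSegment_basis x_base side_pos) hxS
    fun p q hx subset => ?_
  have halfDisc := eventually_mem_triangle x_base.ge side_pos
  have max : IsMaxOn f (S ∩ convexHull ℝ {B 0, B 1, B 2}) x := fun y hy => by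
    have := (base y hy).trans x_base.symm
    rw [coord_eq, coord_eq] at this
    exact (add_right_cancel this).le
  simp only [coord_eq, add_le_add_iff_right] at halfDisc
  obtain ⟨hp, hq⟩ := eq_of_isMaxOn_of_mem_openSegment halfDisc max hx subset
  exact ⟨mem_range_lineMap_of_coord_eq_zero (by rw [coord_eq, hp, ← coord_eq, x_base]),
    mem_range_lineMap_of_coord_eq_zero (by rw [coord_eq, hq, ← coord_eq, x_base])⟩

theorem PolyArc.exists_diagonal (h : PolyArc (B 1) (B 2) V S)
    (ha : segment ℝ (B 0) (B 1) ∩ S ⊆ {B 1}) (hc : segment ℝ (B 0) (B 2) ∩ S ⊆ {B 2})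
    (hV : V ≠ {B 1, B 2}) (hxS : x ∈ S)
    (hxT : x ∈ convexHull ℝ {B 0, B 1, B 2}) (hxa : x ≠ B 1) (hxc : x ≠ B 2) :
    ∃ w ∈ V, w ≠ B 1 ∧ w ≠ B 2 ∧ w ∈ convexHull ℝ {B 0, B 1, B 2} ∧
      segment ℝ (B 0) w ∩ S ⊆ {w} := by
  obtain ⟨w, hw, hwa, hwc, hwT, max⟩ : ∃ w ∈ V, w ≠ B 1 ∧ w ≠ B 2 ∧
      w ∈ convexHull ℝ {B 0, B 1, B 2} ∧
      IsMaxOn (B.coord 0) (S ∩ convexHull ℝ {B 0, B 1, B 2}) w := by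
    by_cases high : ∃ y ∈ S ∩ convexHull ℝ {B 0, B 1, B 2}, 0 < B.coord 0 y
    · obtain ⟨y, hy, y_pos⟩ := high
      exact h.exists_vertex_isMaxOn_coord ha hc hy y_pos
    · push Not at high
      have base : ∀ y ∈ S ∩ convexHull ℝ {B 0, B 1, B 2}, B.coord 0 y = 0 := fun y hy =>
        (high y hy).antisymm (mem_triangle_iff.1 hy.2 0)
      obtain ⟨w, hw, hw_open⟩ := h.exists_vertex_mem_openSegment_basis ha hc hV base hxS hxT hxa hxc
      have hwT : w ∈ convexHull ℝ {B 0, B 1, B 2} :=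
        mem_triangle_iff.2 (mem_segment_basis_iff.1 (openSegment_subset_segment _ _ _ hw_open)).1
      refine ⟨w, hw, ?_, ?_, hwT, fun y hy => ?_⟩
      · rintro rfl
        exact h.ne (left_mem_openSegment_iff.1 hw_open)
      · rintro rfl
        exact h.ne (right_mem_openSegment_iff.1 hw_open)
      · exact (base y hy).le.trans (base w ⟨h.vertices_subset hw, hwT⟩).ge
  obtain ⟨f, r, coord_eq⟩ := exists_coord_eq_add B 0
  have w_lt := coord_zero_lt_one
    (coord_pos_of_segment_inter ha hc (h.vertices_subset hw) hwT hwa hwc)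
  refine ⟨w, hw, hwa, hwc, hwT, segment_inter_subset_of_isMaxOn (f := f) (convex_convexHull ℝ _)
    (left_mem_triangle _ _ _) hwT (fun y hy => ?_) ?_⟩
  · have le : B.coord 0 y ≤ B.coord 0 w := max hy
    rwa [coord_eq, coord_eq, add_le_add_iff_right] at le
  · rwa [← B.coord_apply_eq 0, coord_eq, coord_eq, add_lt_add_iff_right] at w_lt

end Visibility

end Diagonal

section Support

theorem disjoint_of_isPreconnected {Y : Type*} [TopologicalSpace Y] {X D P : Set Y}
    (hX : IsPreconnected X) (hD : IsClosed D) (hDP : IsOpen (D \ P)) (hXP : Disjoint X P) {x : Y}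
    (hx : x ∈ X) (hxD : x ∉ D) : Disjoint X D := by
  rw [disjoint_left]
  intro y hy hyD
  obtain ⟨z, -, hzD, hzD'⟩ := hX (D \ P) Dᶜ hDP hD.isOpen_compl
    (fun z hz => (em (z ∈ D)).imp (fun h => ⟨h, disjoint_left.1 hXP hz⟩) id)
    ⟨y, hy, hyD, disjoint_left.1 hXP hy⟩ ⟨x, hx, hxD⟩
  exact hzD' hzD.1

variable {E : Type*} [NormedAddCommGroup E] [NormedSpace ℝ E]

theorem map_lineMap_apply (f : E →L[ℝ] ℝ) (x y : E) (s : ℝ) :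
    f (AffineMap.lineMap x y s) = AffineMap.lineMap (f x) (f y) s :=
  f.toLinearMap.toAffineMap.apply_lineMap x y s

variable {f : E →L[ℝ] ℝ} {b : E}

theorem lt_of_mem_convexHull {W : Set E} (h : ∀ v ∈ W, f v < f b) {x : E}
    (hx : x ∈ convexHull ℝ W) : f x < f b :=
  convexHull_min (t := {x | f x < f b}) h
    (convex_halfSpace_lt f.toLinearMap.isLinear (f b)) hx

theorem lt_of_mem_convexHull_of_ne {W : Set E} (h : ∀ v ∈ W, v ≠ b → f v < f b) {x : E}
    (hx : x ∈ convexHull ℝ W) (hxb : x ≠ b) : f x < f b := by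
  have hx' : x ∈ convexHull ℝ (insert b (W \ {b})) := by
    rw [insert_sdiff_singleton]
    exact convexHull_mono (subset_insert _ _) hx
  rcases (W \ {b}).eq_empty_or_nonempty with empty | nonempty
  · rw [empty, insert_empty_eq, convexHull_singleton] at hx'
    exact absurd hx' hxb
  rw [convexHull_insert nonempty, mem_convexJoin] at hx'
  obtain ⟨_, rfl, y, hy, hx'⟩ := hx'
  rw [segment_eq_image_lineMap] at hx'
  obtain ⟨t, ht, rfl⟩ := hx'
  have ht0 : 0 < t := ht.1.lt_of_ne' fun h0 => hxb (by simp [h0])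
  rw [map_lineMap_apply, lineMap_lt_left_iff_lt ht0]
  exact lt_of_mem_convexHull (fun v hv => h v hv.1 hv.2) hy

theorem exists_strict_maximum_of_finite {V : Set E} (hV : V.Finite) (hne : V.Nonempty) :
    ∃ b ∈ V, ∃ f : E →L[ℝ] ℝ, ∀ v ∈ V, v ≠ b → f v < f b := by
  obtain ⟨b, hb⟩ := (hV.isCompact_convexHull ℝ).extremePoints_nonempty
    ((convexHull_nonempty_iff (𝕜 := ℝ)).2 hne)
  have isolated : b ∉ convexHull ℝ (V \ {b}) := fun h =>
    (((convex_convexHull ℝ V).mem_extremePoints_iff_mem_sdiff_convexHull_sdiff).1 hb).2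
      (convexHull_mono (sdiff_subset_sdiff_left (subset_convexHull ℝ V)) h)
  obtain ⟨f, u, below, above⟩ := geometric_hahn_banach_closed_point (convex_convexHull ℝ _)
    ((hV.subset sdiff_subset).isClosed_convexHull ℝ) isolated
  exact ⟨b, extremePoints_convexHull_subset hb, f, fun v hv hvb =>
    (below v (subset_convexHull ℝ _ ⟨hv, hvb⟩)).trans above⟩

theorem linearIndependent_of_segment_inter {a c : E} (ha : f a < f b) (hc : f c < f b)
    (h : segment ℝ b a ∩ segment ℝ b c ⊆ {b}) : LinearIndependent ℝ ![a - b, c - b] := by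
  by_contra dependent
  rcases sameRay_or_sameRay_neg_iff_not_linearIndependent.2 dependent with same | opposite
  · rcases wbtw_total_of_sameRay_vsub_left (x := b) (y := a) (z := c) same with hw | hw
    · obtain rfl : a = b := h ⟨right_mem_segment _ _ _, mem_segment_iff_wbtw.2 hw⟩
      exact ha.false
    · obtain rfl : c = b := h ⟨mem_segment_iff_wbtw.2 hw, right_mem_segment _ _ _⟩
      exact hc.false
  · rw [neg_sub] at opposite
    have hw : b ∈ segment ℝ c a :=
      mem_segment_iff_wbtw.2 (wbtw_iff_sameRay_vsub.2 opposite.symm)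
    exact lt_irrefl (f b)
      ((convex_halfSpace_lt f.toLinearMap.isLinear (f b)).segment_subset hc ha hw)

theorem PolyArc.inter_subset_ends {a c y : E} {V A D P : Set E} (h : PolyArc a c V A)
    (hD : IsClosed D) (hDP : IsOpen (D \ P)) (meet : A ∩ P ⊆ {a, c}) (hy : y ∈ A)
    (hya : y ≠ a) (hyc : y ≠ c) (hyD : y ∉ D) : A ∩ D ⊆ {a, c} := by
  have disjoint := disjoint_of_isPreconnected h.isPreconnected_diff.2.2 hD hDP
    (disjoint_left.2 fun x hx hxP => hx.2 (meet ⟨hx.1, hxP⟩)) ⟨hy, by simp [hya, hyc]⟩ hyD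
  exact fun x hx => by_contra fun hx' => disjoint_left.1 disjoint ⟨hx.1, hx'⟩ hx.2

theorem segment_inter_subset_of_map_eq {k : E →L[ℝ] ℝ} {a w : E} (hkw : k w = k b)
    (hka : k a ≠ k b) : segment ℝ b a ∩ segment ℝ b w ⊆ {b} := by
  rintro x ⟨hxa, hxw⟩
  rw [segment_eq_image_lineMap] at hxa hxw
  obtain ⟨s, -, rfl⟩ := hxa
  obtain ⟨t, -, e⟩ := hxw
  have hk : k (AffineMap.lineMap b a s) = k b := by
    rw [← e, map_lineMap_apply, hkw, AffineMap.lineMap_same_apply]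
  rw [map_lineMap_apply, AffineMap.lineMap_eq_left_iff] at hk
  rw [mem_singleton_iff, hk.resolve_left hka.symm, AffineMap.lineMap_apply_zero]

theorem exists_eq_and_lt {k : E →L[ℝ] ℝ} {a w : E} (hkw : k w = k b) (hka : k b < k a)
    (hfw : f w < f b) : ∃ z, f z = f b ∧ k b < k z := by
  refine ⟨a - ((f a - f b) / (f w - f b)) • (w - b), ?_, ?_⟩
  · rw [map_sub, map_smul, map_sub, smul_eq_mul, div_mul_cancel₀ _ (sub_neg.2 hfw).ne,
      sub_sub_cancel]
  · rwa [map_sub, map_smul, map_sub, hkw, sub_self, smul_zero, sub_zero]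

/-- Next to `b`, the open half-plane `k b < k x` is connected, avoids the boundary of `D`, and
contains points outside `D` because `f` attains its maximum over `D` at `b`. -/
theorem exists_mem_segment_notMem {k : E →L[ℝ] ℝ} {a c w : E} {S D : Set E} (hkw : k w = k b)
    (hka : k b < k a) (hkc : k c ≤ k b) (hfw : f w < f b) (hD : IsClosed D) (hS : IsClosed S)
    (hb : b ∉ S) (hDf : ∀ x ∈ D, x ≠ b → f x < f b)
    (hDo : IsOpen (D \ (segment ℝ b c ∪ S ∪ segment ℝ b w))) :
    ∃ y ∈ segment ℝ b a, y ≠ b ∧ y ∉ D := by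
  obtain ⟨r, hr, ball_subset⟩ := Metric.isOpen_iff.1 hS.isOpen_compl b hb
  have ball_mem := Metric.ball_mem_nhds b hr
  have halfBall_preconnected : IsPreconnected ({x | k b < k x} ∩ Metric.ball b r) :=
    ((convex_halfSpace_gt k.toLinearMap.isLinear (k b)).inter (convex_ball b r)).isPreconnected
  have below : ∀ v, k v ≤ k b → segment ℝ b v ⊆ {x | k x ≤ k b} := fun v =>
    (convex_halfSpace_le k.toLinearMap.isLinear (k b)).segment_subset (le_refl (k b))
  have halfBall_disjoint : Disjoint ({x | k b < k x} ∩ Metric.ball b r)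
      (segment ℝ b c ∪ S ∪ segment ℝ b w) := by
    rw [disjoint_left]
    rintro x ⟨hx : k b < k x, hx_ball⟩ ((h | h) | h)
    · exact hx.not_ge (below c hkc h)
    · exact ball_subset hx_ball h
    · exact hx.not_ge (below w hkw.le h)
  have climb : ∀ v, k b < k v → ∀ t : ℝ, 0 < t → k b < k (AffineMap.lineMap b v t) :=
    fun v hv t ht => by rwa [map_lineMap_apply, left_lt_lineMap_iff_lt ht]
  obtain ⟨z, hfz, hkz⟩ := exists_eq_and_lt hkw hka hfw
  obtain ⟨t, ht, t_ball⟩ := (eventually_lineMap_nhdsGT ball_mem z).exists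
  have halfBall_diff : AffineMap.lineMap b z t ∉ D := fun hmem => by
    have := hDf _ hmem fun e => (climb z hkz t ht.1).ne' (by rw [e])
    rw [map_lineMap_apply, hfz, AffineMap.lineMap_same_apply] at this
    exact this.false
  have disjoint := disjoint_of_isPreconnected halfBall_preconnected hD hDo halfBall_disjoint
    ⟨climb z hkz t ht.1, t_ball⟩ halfBall_diff
  obtain ⟨s, hs, s_ball⟩ := (eventually_lineMap_nhdsGT ball_mem a).exists
  have s_climb := climb a hka s hs.1
  exact ⟨_, lineMap_mem_segment _ _ _ ⟨hs.1.le, hs.2.le⟩, fun e => s_climb.ne' (by rw [e]),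
    disjoint_left.1 disjoint ⟨s_climb, s_ball⟩⟩

end Support

section SweptRegions

variable {E : Type*} [NormedAddCommGroup E] [NormedSpace ℝ E]
  {F : E → EuclideanSpace ℝ (Fin 3)} {f k : E →L[ℝ] ℝ} {a b c w : E} {V V₁ V₂ S S₁ S₂ Q D : Set E}

theorem PolyArc.cons (h : PolyArc a w V S) (hba : b ≠ a) (ha : segment ℝ b a ∩ S ⊆ {a}) :
    PolyArc b w (insert b V) (segment ℝ b a ∪ S) := by
  have := (PolyArc.edge hba).concat h ha
  rwa [insert_union, singleton_union, insert_eq_of_mem h.ends_mem.1] at this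

theorem PolyArc.polyLoop (h : PolyArc a c V S) (meet : S ∩ segment ℝ a c ⊆ {a, c}) :
    PolyLoop V (S ∪ segment ℝ a c) :=
  ⟨a, c, V, {a, c}, S, segment ℝ a c, h, .edge h.ne, meet,
    (union_eq_left.2 (pair_subset h.ends_mem.1 h.ends_mem.2)).symm, rfl⟩

theorem PolyArc.eq_segment_of_vertices_eq_pair (h : PolyArc a c {a, c} S) :
    S = segment ℝ a c := by
  rcases h.eq_edge_or_exists_first_edge with h | ⟨p, V', S', hap, h', meet, hV', rfl⟩
  · exact h.2
  have ha : a ∉ V' := fun ha => hap (meet ⟨left_mem_segment ℝ a p, h'.vertices_subset ha⟩)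
  have subset : V' ⊆ {c} := fun x hx =>
    (hV'.superset (.inr hx)).resolve_left fun e => ha (e ▸ hx)
  exact absurd (subset h'.ends_mem.1) h'.ne

section Ear

theorem PolyArc.of_triangle (h : LinearIndependent ℝ ![b - a, c - a]) :
    PolyArc a c {a, b, c} (segment ℝ a b ∪ segment ℝ b c) := by
  have h_rotate := linearIndependent_triangle_rotate h
  have hab : a ≠ b := fun e => h.ne_zero 0 (by simp [e])
  have hbc : b ≠ c := fun e => h_rotate.ne_zero 0 (by simp [e])
  refine (PolyArc.edge hbc).cons hab ?_
  rw [segment_symm ℝ a b, inter_comm, segment_inter_eq_endpoint_of_linearIndependent_sub ℝ h_rotate]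

theorem triangle_sides_inter_chord (h : LinearIndependent ℝ ![b - a, c - a]) :
    (segment ℝ a b ∪ segment ℝ b c) ∩ segment ℝ a c ⊆ {a, c} := by
  rw [union_inter_distrib_right, segment_inter_eq_endpoint_of_linearIndependent_sub ℝ h,
    segment_symm ℝ b c, segment_symm ℝ a c, inter_comm (segment ℝ c b),
    segment_inter_eq_endpoint_of_linearIndependent_sub ℝ
      (linearIndependent_triangle_rotate (linearIndependent_triangle_rotate h)), singleton_union]

theorem isSweptRegion_of_ear (hE : Module.finrank ℝ E = 2) (hF : IsPLOn F Q) (hinj : InjOn F Q)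
    (hQ : Convex ℝ Q) (h : PolyArc a c V S) (hLI : LinearIndependent ℝ ![b - a, c - a])
    (hVQ : insert b V ⊆ Q) (hT : S ∩ convexHull ℝ {a, b, c} ⊆ {a, c}) (hbV : b ∉ convexHull ℝ V)
    (hD : IsSweptRegion F V (S ∪ segment ℝ a c) D) :
    IsSweptRegion F (insert b V) (segment ℝ a b ∪ segment ℝ b c ∪ S)
      (convexHull ℝ {a, b, c} ∪ D) := by
  have : FiniteDimensional ℝ E := .of_finrank_pos (by omega)
  have ends_subset : {a, c} ⊆ V := pair_subset h.ends_mem.1 h.ends_mem.2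
  have chord_subset : {a, c} ⊆ segment ℝ a c :=
    pair_subset (left_mem_segment _ _ _) (right_mem_segment _ _ _)
  have vertices_eq : {a, b, c} ∪ V = insert b V := by
    rw [insert_comm, insert_union, union_eq_self_of_subset_left ends_subset]
  have hTQ : convexHull ℝ {a, b, c} ⊆ Q :=
    convexHull_min ((subset_union_left.trans vertices_eq.subset).trans hVQ) hQ
  have hDQ : D ⊆ Q := hD.subset_hull.trans (convexHull_min ((subset_insert _ _).trans hVQ) hQ)
  have region := (hF.isTameTriangle hinj hLI hTQ).isSweptRegion hE hLI
  rw [segment_symm ℝ c a] at region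
  have ear := PolyArc.of_triangle hLI
  have meet : (segment ℝ a b ∪ segment ℝ b c) ∩ S ⊆ {a, c} := fun x hx =>
    hT ⟨hx.2, region.boundary_subset (.inl hx.1)⟩
  have meet_chord := triangle_sides_inter_chord hLI
  have ear_outside : (segment ℝ a b ∪ segment ℝ b c) ∩ D ⊆ {a, c} :=
    ear.inter_subset_ends hD.isClosed hD.isOpen
      ((inter_union_distrib_left _ _ _).subset.trans (union_subset meet meet_chord))
      (.inl (right_mem_segment ℝ a b)) (fun e => hLI.ne_zero 0 (by simp [e]))
      (fun e => (linearIndependent_triangle_rotate hLI).ne_zero 0 (by simp [e]))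
      fun hb => hbV (hD.subset_hull hb)
  rw [← vertices_eq]
  exact isSweptRegion_glue hE.ge (hF.continuousOn.mono (union_subset hTQ hDQ))
    (hinj.mono (union_subset hTQ hDQ)) ear h meet meet_chord
    (fun x hx => hT ⟨hx.1, region.boundary_subset (.inr hx.2)⟩) region hD
    (ear_outside.trans chord_subset) (hT.trans chord_subset)

end Ear

section Diagonal

theorem cons_inter_diagonal_subset (hkw : k w = k b) (hka : k a ≠ k b)
    (hw : segment ℝ b w ∩ S ⊆ {w}) :
    (segment ℝ b a ∪ S) ∩ segment ℝ b w ⊆ {b, w} := by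
  rintro x ⟨hx | hx, hxw⟩
  · exact .inl (segment_inter_subset_of_map_eq hkw hka ⟨hx, hxw⟩)
  · exact .inr (hw ⟨hxw, hx⟩)

theorem cons_inter_cons_subset (h₁ : PolyArc a w V₁ S₁) (h₂ : PolyArc c w V₂ S₂)
    (meet : S₁ ∩ S₂ ⊆ {w}) (hi : segment ℝ b a ∩ segment ℝ b c ⊆ {b})
    (ha : segment ℝ b a ∩ (S₁ ∪ S₂) ⊆ {a}) (hc : segment ℝ b c ∩ (S₁ ∪ S₂) ⊆ {c}) :
    (segment ℝ b a ∪ S₁) ∩ (segment ℝ b c ∪ S₂) ⊆ {b, w} := by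
  rintro x ⟨hx₁ | hx₁, hx₂ | hx₂⟩
  · exact .inl (hi ⟨hx₁, hx₂⟩)
  · obtain rfl : x = a := ha ⟨hx₁, .inr hx₂⟩
    exact absurd (meet ⟨h₁.left_mem, hx₂⟩) h₁.ne
  · obtain rfl : x = c := hc ⟨hx₂, .inl hx₁⟩
    exact absurd (meet ⟨hx₁, h₂.left_mem⟩) h₂.ne
  · exact .inr (meet ⟨hx₁, hx₂⟩)

theorem inter_subset_of_diagonal (h₁ : PolyArc b w V₁ (segment ℝ b a ∪ S₁))
    (h₂ : PolyArc c w V₂ S₂) (hb : b ∉ S₂)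
    (meet : (segment ℝ b a ∪ S₁) ∩ (segment ℝ b c ∪ S₂) ⊆ {b, w})
    (meet_chord : (segment ℝ b a ∪ S₁) ∩ segment ℝ b w ⊆ {b, w})
    (hf : ∀ v ∈ V₂, f v < f b) (hkw : k w = k b) (hka : k b < k a) (hkc : k c ≤ k b)
    (hD : IsSweptRegion F (insert b V₂) (segment ℝ b c ∪ S₂ ∪ segment ℝ b w) D) :
    (segment ℝ b a ∪ S₁) ∩ D ⊆ segment ℝ b w := by
  have below : ∀ x ∈ D, x ≠ b → f x < f b := fun x hx =>
    lt_of_mem_convexHull_of_ne (fun v hv hvb => hf v (hv.resolve_left hvb)) (hD.subset_hull hx)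
  obtain ⟨y, hy, hyb, hyD⟩ := exists_mem_segment_notMem hkw hka hkc (hf w h₂.ends_mem.2)
    hD.isClosed h₂.isCompact.isClosed hb below hD.isOpen
  have hyw : y ≠ w := fun e => hyD (hD.boundary_subset (.inr (e ▸ right_mem_segment ℝ b y)))
  exact (h₁.inter_subset_ends hD.isClosed hD.isOpen
    ((inter_union_distrib_left _ _ _).subset.trans (union_subset meet meet_chord))
    (.inl hy) hyb hyw hyD).trans (pair_subset (left_mem_segment _ _ _) (right_mem_segment _ _ _))

theorem insert_ssubset_insert_union (h₁ : PolyArc a w V₁ S₁) (h₂ : PolyArc c w V₂ S₂)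
    (meet : S₁ ∩ S₂ ⊆ {w}) (hbc : b ≠ c) : insert b V₁ ⊂ insert b (V₁ ∪ V₂) := by
  refine (ssubset_iff_of_subset (insert_subset_insert subset_union_left)).2
    ⟨c, .inr (.inr h₂.ends_mem.1), ?_⟩
  rintro (e | hc)
  · exact hbc e.symm
  · exact h₂.ne (meet ⟨h₁.vertices_subset hc, h₂.left_mem⟩)

theorem exists_isSweptRegion_of_diagonal [FiniteDimensional ℝ E] (hE : 1 < Module.finrank ℝ E)
    (hF : ContinuousOn F Q) (hinj : InjOn F Q) (hQ : Convex ℝ Q)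
    (h₁ : PolyArc a w V₁ S₁) (h₂ : PolyArc c w V₂ S₂) (meet : S₁ ∩ S₂ ⊆ {w})
    (hi : segment ℝ b a ∩ segment ℝ b c ⊆ {b})
    (ha : segment ℝ b a ∩ (S₁ ∪ S₂) ⊆ {a}) (hc : segment ℝ b c ∩ (S₁ ∪ S₂) ⊆ {c})
    (hw : segment ℝ b w ∩ (S₁ ∪ S₂) ⊆ {w}) (hVQ : insert b (V₁ ∪ V₂) ⊆ Q)
    (hf : ∀ v ∈ V₁ ∪ V₂, f v < f b) (hkw : k w = k b) (hka : k b < k a) (hkc : k c < k b)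
    (IH : ∀ V P, PolyLoop V P → V ⊂ insert b (V₁ ∪ V₂) → ∃ D, IsSweptRegion F V P D) :
    ∃ D, IsSweptRegion F (insert b (V₁ ∪ V₂)) (segment ℝ b a ∪ segment ℝ b c ∪ (S₁ ∪ S₂)) D := by
  have hba : b ≠ a := fun e => hka.ne (congrArg k e)
  have hbc : b ≠ c := fun e => hkc.ne' (congrArg k e)
  have hb : b ∉ S₁ ∪ S₂ := fun hb => hba (ha ⟨left_mem_segment ℝ b a, hb⟩)
  have arc₁ := h₁.cons hba ((inter_subset_inter_right _ subset_union_left).trans ha)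
  have arc₂ := h₂.cons hbc ((inter_subset_inter_right _ subset_union_right).trans hc)
  have meet_arcs := cons_inter_cons_subset h₁ h₂ meet hi ha hc
  have meet_chord₁ := cons_inter_diagonal_subset hkw hka.ne'
    ((inter_subset_inter_right _ subset_union_left).trans hw)
  have meet_chord₂ := cons_inter_diagonal_subset hkw hkc.ne
    ((inter_subset_inter_right _ subset_union_right).trans hw)
  have proper₁ := insert_ssubset_insert_union h₁ h₂ meet hbc
  have proper₂ := insert_ssubset_insert_union h₂ h₁ (inter_comm S₁ S₂ ▸ meet) hba
  rw [union_comm V₂ V₁] at proper₂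
  obtain ⟨D₁, hD₁⟩ := IH _ _ (arc₁.polyLoop meet_chord₁) proper₁
  obtain ⟨D₂, hD₂⟩ := IH _ _ (arc₂.polyLoop meet_chord₂) proper₂
  have outside₁ := inter_subset_of_diagonal arc₁ h₂ (fun h => hb (.inr h)) meet_arcs meet_chord₁
    (fun v hv => hf v (.inr hv)) hkw hka hkc.le hD₂
  have outside₂ := inter_subset_of_diagonal (k := -k) arc₂ h₁ (fun h => hb (.inl h))
    (inter_comm _ _ ▸ meet_arcs) meet_chord₂ (fun v hv => hf v (.inl hv)) (neg_inj.2 hkw)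
    (neg_lt_neg hkc) (neg_le_neg hka.le) hD₁
  have hDQ : D₁ ∪ D₂ ⊆ Q := union_subset
    (hD₁.subset_hull.trans (convexHull_min (proper₁.subset.trans hVQ) hQ))
    (hD₂.subset_hull.trans (convexHull_min (proper₂.subset.trans hVQ) hQ))
  rw [insert_union_distrib, union_union_union_comm]
  exact ⟨_, isSweptRegion_glue hE (hF.mono hDQ) (hinj.mono hDQ) arc₁ arc₂ meet_arcs meet_chord₁
    meet_chord₂ hD₁ hD₂ outside₁ outside₂⟩

theorem exists_map_eq_separating {B : AffineBasis (Fin 3) ℝ E}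
    (hw : ∀ j, j ≠ 0 → 0 < B.coord j w) :
    ∃ k : E →L[ℝ] ℝ, k w = k (B 0) ∧ k (B 0) < k (B 1) ∧ k (B 2) < k (B 0) := by
  obtain ⟨f₁, r₁, h₁⟩ := exists_coord_eq_add B 1
  obtain ⟨f₂, r₂, h₂⟩ := exists_coord_eq_add B 2
  let k := B.coord 2 w • f₁ - B.coord 1 w • f₂
  have hk : ∀ x, k x - k (B 0) = B.coord 2 w * B.coord 1 x - B.coord 1 w * B.coord 2 x := by
    intro x
    have e₁ : f₁ (B 0) = -r₁ := by linarith [h₁ (B 0), B.coord_apply_ne (i := 1) (j := 0) (by simp)]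
    have e₂ : f₂ (B 0) = -r₂ := by linarith [h₂ (B 0), B.coord_apply_ne (i := 2) (j := 0) (by simp)]
    simp only [k, sub_apply, smul_apply, smul_eq_mul, e₁,
      e₂, h₁ x, h₂ x]
    ring
  have w₁ := hw 1 (by decide)
  have w₂ := hw 2 (by decide)
  refine ⟨k, ?_, ?_, ?_⟩
  · rw [← sub_eq_zero, hk, mul_comm, sub_self]
  · rw [← sub_pos, hk]
    simpa [B.coord_apply] using w₂
  · rw [← sub_neg, hk]
    simpa [B.coord_apply] using w₁

end Diagonal

theorem exists_isSweptRegion_of_corner (hE : Module.finrank ℝ E = 2) (hF : IsPLOn F Q)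
    (hinj : InjOn F Q) (hQ : Convex ℝ Q) (h : PolyArc a c V S)
    (hi : segment ℝ b a ∩ segment ℝ b c ⊆ {b}) (ha : segment ℝ b a ∩ S ⊆ {a})
    (hc : segment ℝ b c ∩ S ⊆ {c}) (hf : ∀ v ∈ V, f v < f b) (hVQ : insert b V ⊆ Q)
    (IH : ∀ W P, PolyLoop W P → W ⊂ insert b V → ∃ D, IsSweptRegion F W P D) :
    ∃ D, IsSweptRegion F (insert b V) (segment ℝ b a ∪ segment ℝ b c ∪ S) D := by
  have : FiniteDimensional ℝ E := .of_finrank_pos (by omega)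
  have hLI := linearIndependent_of_segment_inter (hf a h.ends_mem.1) (hf c h.ends_mem.2) hi
  have hLI' := linearIndependent_triangle_rotate (linearIndependent_triangle_swap hLI)
  by_cases hV : V = {a, c}
  · subst hV
    have hTQ : convexHull ℝ {a, b, c} ⊆ Q := convexHull_min (insert_comm a b {c} ▸ hVQ) hQ
    have := (hF.isTameTriangle hinj hLI' hTQ).isSweptRegion hE hLI'
    rw [h.eq_segment_of_vertices_eq_pair, segment_symm ℝ b a, segment_symm ℝ a c, insert_comm]
    exact ⟨_, this⟩
  by_cases hT : S ∩ convexHull ℝ {b, a, c} ⊆ {a, c}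
  · rw [insert_comm] at hT
    obtain ⟨D, hD⟩ := IH V _ (h.polyLoop fun x hx => hT ⟨hx.1,
      segment_subset_convexHull (by simp) (by simp) hx.2⟩)
      (ssubset_insert fun hb => (hf b hb).false)
    rw [segment_symm ℝ b a]
    exact ⟨_, isSweptRegion_of_ear hE hF hinj hQ h hLI' hVQ hT
      (fun hb => (lt_of_mem_convexHull hf hb).false) hD⟩
  · obtain ⟨B, rfl, rfl, rfl⟩ := exists_affineBasis_of_finrank_eq_two hE hLI
    obtain ⟨x, ⟨hxS, hxT⟩, hx⟩ := not_subset.1 hT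
    obtain ⟨w, hwV, hwa, hwc, hwT, hw⟩ := h.exists_diagonal ha hc hV hxS hxT
      (fun e => hx (.inl e)) (fun e => hx (.inr e))
    obtain ⟨k, hkw, hka, hkc⟩ := exists_map_eq_separating
      (coord_pos_of_segment_inter ha hc (h.vertices_subset hwV) hwT hwa hwc)
    obtain ⟨V₁, V₂, S₁, S₂, h₁, h₂, meet, rfl, rfl⟩ := h.split hwV hwa hwc
    exact exists_isSweptRegion_of_diagonal hE.ge hF.continuousOn hinj hQ h₁ h₂.symm meet hi ha hc
      hw hVQ hf hkw hka hkc IH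

theorem PolyLoop.exists_isSweptRegion {P : Set E} (h : PolyLoop V P)
    (hE : Module.finrank ℝ E = 2) (hF : IsPLOn F Q) (hinj : InjOn F Q) (hQ : Convex ℝ Q)
    (hVQ : V ⊆ Q) : ∃ D, IsSweptRegion F V P D := by
  induction hn : V.ncard using Nat.strong_induction_on generalizing V P with
  | _ n ih =>
  have IH : ∀ W P', PolyLoop W P' → W ⊂ V → ∃ D, IsSweptRegion F W P' D := fun W P' h' proper =>
    ih _ (hn ▸ ncard_lt_ncard proper h.finite) h' (proper.subset.trans hVQ) rfl
  obtain ⟨b, hb, f, hf⟩ := exists_strict_maximum_of_finite h.finite h.nonempty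
  obtain ⟨a, c, W, S, hba, _, arc, hi, ha, hc, rfl, rfl⟩ := h.exists_neighbors hb
  have hbW : b ∉ W := fun hb =>
    hba (ha ⟨left_mem_segment ℝ b a, arc.vertices_subset hb⟩)
  exact exists_isSweptRegion_of_corner hE hF hinj hQ arc hi ha hc
    (fun v hv => hf v (.inr hv) fun e => hbW (e ▸ hv)) hVQ IH

end SweptRegions

section Curve

variable {E : Type*} [NormedAddCommGroup E] [NormedSpace ℝ E] {γ : ℝ → E} {B : Set ℝ} {u v : ℝ}

/-- The points of `B` cut `[u, v]` into intervals on each of which the curve `γ` is affine. The set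
`B` may contain further points, also outside `[u, v]`. -/
def IsBreakpointSet (γ : ℝ → E) (u v : ℝ) (B : Set ℝ) : Prop :=
  ∀ t t', u ≤ t → t < t' → t' ≤ v → Disjoint B (Ioo t t') → ∃ g : ℝ →ᵃ[ℝ] E, EqOn γ g (Icc t t')

theorem Icc_subset_convexHull_of_disjoint {s : Set ℝ} {t t' : ℝ} (h : t < t')
    (hs : Disjoint s (Ioo t t')) {m : ℝ} (hm : m ∈ convexHull ℝ s) (hmt : m ∈ Ioo t t') :
    Icc t t' ⊆ convexHull ℝ s := by
  have outside : ∀ x ∈ s, x ≤ t ∨ t' ≤ x := fun x hx => by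
    by_contra! between
    exact disjoint_left.1 hs hx between
  obtain ⟨x, hx, hxt⟩ : ∃ x ∈ s, x ≤ t := by
    by_contra! above
    exact hmt.2.not_ge (convexHull_min
      (fun x hx => (outside x hx).resolve_left (above x hx).not_ge) (convex_Ici t') hm)
  obtain ⟨y, hy, hyt⟩ : ∃ y ∈ s, t' ≤ y := by
    by_contra! below
    exact hmt.1.not_ge (convexHull_min
      (fun x hx => (outside x hx).resolve_right (below x hx).not_ge) (convex_Iic t) hm)
  calc Icc t t' ⊆ Icc x y := Icc_subset_Icc hxt hyt
    _ = segment ℝ x y := (segment_eq_Icc (hxt.trans (h.le.trans hyt))).symm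
    _ ⊆ convexHull ℝ s := segment_subset_convexHull hx hy

theorem IsPLOn.exists_isBreakpointSet (h : IsPLOn γ (Icc u v)) :
    ∃ B : Set ℝ, B.Finite ∧ IsBreakpointSet γ u v B := by
  obtain ⟨K, finite, space_eq, affine⟩ := h
  refine ⟨⋃ s ∈ K.faces, (s : Set ℝ), finite.biUnion fun s _ => s.finite_toSet, ?_⟩
  intro t t' hu htt hv hB
  obtain ⟨m, hm⟩ := exists_between htt
  have hmK : m ∈ K.space := space_eq ▸ ⟨hu.trans hm.1.le, hm.2.le.trans hv⟩
  obtain ⟨s, hs, hms⟩ := Geometry.SimplicialComplex.mem_space_iff.1 hmK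
  obtain ⟨g, hg⟩ := affine s hs
  exact ⟨g, hg.mono <| Icc_subset_convexHull_of_disjoint htt
    (hB.mono_left (subset_biUnion_of_mem (u := fun s : Finset ℝ => (s : Set ℝ)) hs)) hms hm⟩

theorem IsBreakpointSet.exists_polyArc (h : IsBreakpointSet γ u v B) (hB : B.Finite) {t t' : ℝ}
    (hu : u ≤ t) (htt : t < t') (hv : t' ≤ v) (hinj : InjOn γ (Icc t t')) :
    ∃ V, PolyArc (γ t) (γ t') V (γ '' Icc t t') := by
  induction hn : (B ∩ Ioo t t').ncard using Nat.strong_induction_on generalizing t t' with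
  | _ n ih =>
  rcases (B ∩ Ioo t t').eq_empty_or_nonempty with empty | ⟨m, hmB, hm⟩
  · obtain ⟨g, hg⟩ := h t t' hu htt hv (disjoint_iff_inter_eq_empty.2 empty)
    have ht := left_mem_Icc.2 htt.le
    have ht' := right_mem_Icc.2 htt.le
    have image_eq : γ '' Icc t t' = segment ℝ (γ t) (γ t') := by
      rw [hg.image_eq, ← segment_eq_Icc htt.le, image_segment, hg ht, hg ht']
    rw [image_eq]
    exact ⟨_, .edge fun e => htt.ne (hinj ht ht' e)⟩
  · have fewer : ∀ I : Set ℝ, I ⊆ Ioo t t' → m ∉ I → (B ∩ I).ncard < n := fun I hI hmI =>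
      hn ▸ ncard_lt_ncard ((ssubset_iff_of_subset (inter_subset_inter_right B hI)).2
        ⟨m, ⟨hmB, hm⟩, fun hx => hmI hx.2⟩) (hB.inter_of_left _)
    obtain ⟨V, hV⟩ := ih _ (fewer (Ioo t m) (Ioo_subset_Ioo_right hm.2.le) (by simp)) hu hm.1
      (hm.2.le.trans hv) (hinj.mono (Icc_subset_Icc_right hm.2.le)) rfl
    obtain ⟨W, hW⟩ := ih _ (fewer (Ioo m t') (Ioo_subset_Ioo_left hm.1.le) (by simp))
      (hu.trans hm.1.le) hm.2 hv (hinj.mono (Icc_subset_Icc_left hm.1.le)) rfl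
    have meet : γ '' Icc t m ∩ γ '' Icc m t' ⊆ {γ m} := by
      rw [← hinj.image_inter (Icc_subset_Icc_right hm.2.le) (Icc_subset_Icc_left hm.1.le),
        Icc_inter_Icc_eq_singleton hm.1.le hm.2.le, image_singleton]
    rw [← Icc_union_Icc_eq_Icc hm.1.le hm.2.le, image_union]
    exact ⟨_, hV.concat hW meet⟩

theorem IsPLSimpleClosedCurve.injOn_Ioc (h : IsPLSimpleClosedCurve γ) : InjOn γ (Ioc 0 1) := by
  have end_ne : ∀ x ∈ Ioo (0 : ℝ) 1, γ x ≠ γ 1 := fun x hx e =>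
    hx.1.ne' (h.simple ⟨hx.1.le, hx.2⟩ ⟨le_rfl, one_pos⟩ (e.trans h.closed.symm))
  rw [← Ioo_insert_right one_pos, injOn_insert right_notMem_Ioo]
  exact ⟨h.simple.mono Ioo_subset_Ico_self, fun ⟨x, hx, e⟩ => end_ne x hx e⟩

theorem IsPLSimpleClosedCurve.image_inter_subset (h : IsPLSimpleClosedCurve γ) {m : ℝ}
    (hm : m ∈ Ioo (0 : ℝ) 1) : γ '' Icc 0 m ∩ γ '' Icc m 1 ⊆ {γ 0, γ m} := by
  rintro _ ⟨⟨x, hx, rfl⟩, y, hy, e⟩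
  rcases hx.1.eq_or_lt with rfl | x_pos
  · exact .inl rfl
  obtain rfl : y = x :=
    h.injOn_Ioc ⟨hm.1.trans_le hy.1, hy.2⟩ ⟨x_pos, hx.2.trans hm.2.le⟩ e
  exact .inr (congrArg γ (le_antisymm hx.2 hy.1))

theorem IsPLSimpleClosedCurve.exists_polyLoop (h : IsPLSimpleClosedCurve γ) :
    ∃ V, PolyLoop V (γ '' Icc (0 : ℝ) 1) := by
  obtain ⟨B, hB, breakpoints⟩ := h.pl.exists_isBreakpointSet
  have hm : (1 / 2 : ℝ) ∈ Ioo 0 1 := ⟨by norm_num, by norm_num⟩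
  obtain ⟨V, hV⟩ := breakpoints.exists_polyArc hB le_rfl hm.1 hm.2.le
    (h.simple.mono (Icc_subset_Ico_right hm.2))
  obtain ⟨W, hW⟩ := breakpoints.exists_polyArc hB hm.1.le hm.2 le_rfl
    (h.injOn_Ioc.mono (Icc_subset_Ioc_left hm.1))
  rw [← Icc_union_Icc_eq_Icc hm.1.le hm.2.le, image_union]
  exact ⟨V ∪ W, _, _, V, W, _, _, hV, h.closed ▸ hW.symm, h.image_inter_subset hm, rfl, rfl⟩

end Curve

theorem convex_unitSquare : Convex ℝ unitSquare := by
  intro x hx y hy s t hs ht hst i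
  exact convex_Icc (0 : ℝ) 1 (hx i) (hy i) hs ht hst

theorem mainTheorem4_general {E : Type*} [NormedAddCommGroup E] [NormedSpace ℝ E]
    (hE : Module.finrank ℝ E = 2) {F : E → EuclideanSpace ℝ (Fin 3)} {Q : Set E}
    (hF : IsPLOn F Q) (hinj : InjOn F Q) (hQ : Convex ℝ Q) {γ : ℝ → E}
    (hγ : IsPLSimpleClosedCurve γ) (hmem : MapsTo γ (Icc 0 1) Q) :
    IsUnknot (F '' (γ '' Icc 0 1)) := by
  obtain ⟨V, loop⟩ := hγ.exists_polyLoop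
  obtain ⟨D, region⟩ := loop.exists_isSweptRegion hE hF hinj hQ
    (loop.vertices_subset.trans hmem.image_subset)
  exact region.unknot

/-- An injective piecewise linear map from the unit square to three-space sends every piecewise
linear simple closed curve in the square to an unknot. -/
theorem mainTheorem4
    (F : EuclideanSpace ℝ (Fin 2) → EuclideanSpace ℝ (Fin 3))
    (hF : IsPLOn F unitSquare) (hinj : Set.InjOn F unitSquare)
    (γ : ℝ → EuclideanSpace ℝ (Fin 2)) (hγ : IsPLSimpleClosedCurve γ)
    (hmem : Set.MapsTo γ (Set.Icc (0 : ℝ) 1) unitSquare) :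
    IsUnknot (F '' (γ '' Set.Icc (0 : ℝ) 1)) :=
  mainTheorem4_general finrank_euclideanSpace_fin hF hinj convex_unitSquare hγ hmem
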